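/- Let $K$ be a field of characteristic $2$ (for example an algebraically closed one) and $\alpha\in K$, $\alpha\ne 0,1$. In characteristic $2$ a Lie superalgebra $\mathfrak g=\mathfrak g_{\bar0}\oplus\mathfrak g_{\bar1}$ carries a bracket and a squaring $x\mapsto x^2$, a quadratic map $\mathfrak g_{\bar1}\to\mathfrak g_{\bar0}$ whose polarization is the bracket of odd elements and such that $[x^2,y]=[x,[x,y]]$ for odd $x$ and all $y$. Its desuperization forgets parity and squaring. A 2-cochain of $\mathfrak g$ with values in $\mathfrak g$ is a pair $(c,q)$ of a symmetric bilinear map $c$ with $c(u,u)=0$ for $u\in\mathfrak g_{\bar 0}$ and a quadratic map $q:\mathfrak g_{\bar1}\to\mathfrak g$ with polarization $c|_{\mathfrak g_{\bar1}}$; cocycles and coboundaries are given by the linearized Jacobi identities, and $H^2(\mathfrak g;\mathfrak g)$ includes even and odd classes. The deform $\mathfrak g_{tc}$ by $(c,q)$ with parameter value $t\in K$ has bracket $[\cdot,\cdot]+tc$ and squaring $x^2+tq(x)$. A NIS is a non-degenerate symmetric bilinear form $B$ with $B([x,z],y)=B(x,[z,y])$. Let $\mathfrak{wk}(4;\alpha)$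 be the $34$-dimensional Lie algebra with Cartan matrix $$\begin{pmatrix}0&\alpha&1&0\\ \alpha&0&0&0\\ 1&0&0&1\\ 0&0&1&0\end{pmatrix}$$ and Chevalley generators $x_i,h_i,y_i$ ($1\le i\le4$, $[h_i,x_j]=A_{ij}x_j$, $[x_i,y_j]=\delta_{ij}h_i$), with the basis $x_1,\dots,x_{15},h_1,\dots,h_4,y_1,\dots,y_{15}$ where $x_5=[x_1,x_2]$, $x_6=[x_1,x_3]$, $x_7=[x_3,x_4]$, $x_8=[x_3,x_5]$, $x_9=[x_4,x_6]$, $x_{10}=[x_5,x_6]$, $x_{11}=[x_5,x_7]$, $x_{12}=[x_5,x_9]$, $x_{13}=[x_8,x_9]$, $x_{14}=[x_9,x_{10}]$, $x_{15}=[x_{10},x_{11}]$ and likewise for the $y_i$. Let $\mathfrak g=\mathfrak{bgl}(4;\alpha)$ be its superization with $x_1,y_1$ odd and $x_i,y_i$ even for $i=2,3,4$, in which root vectors have zero square. Let $\gamma_i$ be the weight of $x_i$. Hats denote the dual basis; $k\otimes\hat a\wedge\hat b$ sends $(a,b)$ and $(b,a)$ to $k$, and $k\otimes\hat a^{\wedge2}$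 is the quadratic term $a\mapsto k$. Put $$\begin{aligned} c_0={}&(1+\alpha)\bigl(h_4\otimes\hat x_1\wedge\hat y_1+y_3\otimes\hat x_1\wedge\hat y_6+y_7\otimes\hat x_1\wedge\hat y_9+x_3\otimes\hat x_6\wedge\hat y_1+(h_3+h_4)\otimes\hat x_6\wedge\hat y_6+y_4\otimes\hat x_6\wedge\hat y_9+x_7\otimes\hat x_9\wedge\hat y_1+x_4\otimes\hat x_9\wedge\hat y_6\\&\quad+h_3\otimes\hat x_9\wedge\hat y_9+x_8\otimes\hat x_{10}\wedge\hat y_1+x_5\otimes\hat x_{10}\wedge\hat y_6+x_{11}\otimes\hat x_{12}\wedge\hat y_1+x_5\otimes\hat x_{12}\wedge\hat y_9+x_{11}\otimes\hat x_{13}\wedge\hat y_6+x_8\otimes\hat x_{13}\wedge\hat y_9\bigr)\\ &+\alpha(1+\alpha)\bigl(h_4\otimes\hat x_5\wedge\hat y_5+y_3\otimes\hat x_5\wedge\hat y_8+y_7\otimes\hat x_5\wedge\hat y_{11}+x_3\otimes\hat x_8\wedge\hat y_5+(h_3+h_4)\otimes\hat x_8\wedge\hat y_8+y_4\otimes\hat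 x_8\wedge\hat y_{11}+x_6\otimes\hat x_{10}\wedge\hat y_5+x_1\otimes\hat x_{10}\wedge\hat y_8\\&\quad+x_7\otimes\hat x_{11}\wedge\hat y_5+x_4\otimes\hat x_{11}\wedge\hat y_8+h_3\otimes\hat x_{11}\wedge\hat y_{11}+x_9\otimes\hat x_{12}\wedge\hat y_5+x_1\otimes\hat x_{12}\wedge\hat y_{11}+x_9\otimes\hat x_{13}\wedge\hat y_8+x_6\otimes\hat x_{13}\wedge\hat y_{11}\bigr)\\ &+\alpha(1+\alpha)^2\bigl(h_3\otimes\hat x_{10}\wedge\hat y_{10}+y_4\otimes\hat x_{10}\wedge\hat y_{12}+y_7\otimes\hat x_{10}\wedge\hat y_{13}+x_4\otimes\hat x_{12}\wedge\hat y_{10}+(h_3+h_4)\otimes\hat x_{12}\wedge\hat y_{12}\\&\quad+y_3\otimes\hat x_{12}\wedge\hat y_{13}+x_7\otimes\hat x_{13}\wedge\hat y_{10}+x_3\otimes\hat x_{13}\wedge\hat y_{12}+h_4\otimes\hat x_{13}\wedge\hat y_{13}\bigr)\\ &+y_{10}\otimes\hat y_1\wedge\hat y_8+y_{12}\otimes\hat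 y_1\wedge\hat y_{11}+y_{10}\otimes\hat y_5\wedge\hat y_6+y_{12}\otimes\hat y_5\wedge\hat y_9+y_{13}\otimes\hat y_6\wedge\hat y_{11}+y_{13}\otimes\hat y_8\wedge\hat y_9, \end{aligned}$$ an alternating map on $\mathfrak{wk}(4;\alpha)$, and let $\bar c_0$ be the cochain of $\mathfrak g$ given by the same formula (with $q=0$ on basis vectors). Then: 1. $\mathfrak g$ is a Lie superalgebra whose desuperization is $\mathfrak{wk}(4;\alpha)$. Up to a nonzero factor it has exactly one NIS. The nonzero entries of its Gram matrix $\Gamma$ are, up to symmetry, $(h_1,h_2)=\alpha$, $(h_1,h_3)=(h_3,h_4)=1$ and $(x_i,y_i)=\nu_i$, where $\nu_i=1$ for $i=1,2,3,4,6,7,9$; $\nu_i=\alpha$ for $i=5,8,11$; $\nu_i=\alpha(1+\alpha)$ for $i=10,12,13$; $\nu_{14}=\alpha^2(1+\alpha)$; $\nu_{15}=\alpha^3(1+\alpha)$. 2. $H^2(\mathfrak g;\mathfrak g)$ has a basis consisting of the classes of $19$ even cocycles: $\bar c_0$, of weight $0$, and, for each $i\in\{13,12,10,11,9,8,5,6,1\}$,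 one cocycle of weight $-2\gamma_i$ and one of weight $2\gamma_i$ with respect to the grading by the root lattice (so those of non-positive degree have degrees $-12,-10,-8,-8,-6,-6,-4,-4,-2,0$). For odd $\gamma_i$ the one of weight $-2\gamma_i$ can be chosen with the quadratic term, respectively, $\alpha^2(1+\alpha)h_3\otimes\hat x_{11}^{\wedge2}$, $(1+\alpha)h_3\otimes\hat x_9^{\wedge2}$, $\alpha^2(1+\alpha)(h_3+h_4)\otimes\hat x_8^{\wedge2}$, $\alpha^2(1+\alpha)h_4\otimes\hat x_5^{\wedge2}$, $(1+\alpha)(h_3+h_4)\otimes\hat x_6^{\wedge2}$, $(1+\alpha)h_4\otimes\hat x_1^{\wedge2}$, and the one of weight $2\gamma_i$ with the same term with $\hat y_i$ in place of $\hat x_i$. In particular all deforms depend on even parameters. 3. Let $c$ be any 2-cocycle of $\mathfrak g$ that is homogeneous of a nonzero weight and not a coboundary. Then, for every $t\in K$, $\mathfrak g_{tc}$ is a Lie superalgebra, and every Gram matrix of a NIS on $\mathfrak g$ is the Gram matrix of a NIS on $\mathfrak g_{tc}$. 4. For every $t\in K$, $\mathfrak g_{t\bar c_0}$ is a Lie superalgebra,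 its desuperization is the deform $\mathfrak{wk}(4;\alpha)_{tc_0}$ with bracket $[\cdot,\cdot]+tc_0$, and the latter is a Lie algebra. Let $\Gamma_{c_0}(t)$ be obtained from $\Gamma$ by multiplying by $1+(1+\alpha)t$ the entries $(h_1,h_2)$ and $(x_i,y_i)$, $i\ne3,4,7$, and the symmetric ones. The Gram matrices of the NISes on $\mathfrak g_{t\bar c_0}$ are the nonzero multiples of $\Gamma_{c_0}(t)$ if $(1+\alpha)t\ne1$, and there is no NIS if $(1+\alpha)t=1$. For $t\ne0$ no Gram matrix of a NIS on $\mathfrak g_{t\bar c_0}$ is the Gram matrix of a NIS on $\mathfrak g$. The Gram matrices of the NISes on $\mathfrak{wk}(4;\alpha)_{tc_0}$ are the same as those on $\mathfrak g_{t\bar c_0}$. -/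

import Mathlib

open scoped Matrix

namespace Bgl

/-! ## Lie superalgebras in characteristic 2

In characteristic 2 all signs disappear, and the squaring of odd elements is an additional
operation that is not determined by the bracket. -/

section General

variable (K V : Type*) [Field K] [AddCommGroup V] [Module K V]

/-- A superspace with a bracket and a squaring defined on its odd part
(the axioms are in `SuperAlg.IsLieSuperalgebra`). -/
structure SuperAlg where
  evenPart : Submodule K V
  oddPart : Submodule K V
  bracket : V →ₗ[K] V →ₗ[K] V
  sq : QuadraticMap K oddPart V

end General

section General

variable {K V : Type*} [Field K] [AddCommGroup V] [Module K V]

/-- `br` is the bracket of a Lie algebra over a field of characteristic 2. -/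
structure IsLieBracket (br : V →ₗ[K] V →ₗ[K] V) : Prop where
  alternating : ∀ u, br u u = 0
  jacobi : ∀ u v w, br u (br v w) + br v (br w u) + br w (br u v) = 0

/-- The axioms of a Lie superalgebra over a field of characteristic 2: the even part is a Lie
algebra, the odd part is a module over it, the squaring is a quadratic map from the odd part to the
even part whose polarization is the bracket of odd elements, and `[x², y] = [x, [x, y]]` for
`x` odd and `y` arbitrary. -/
structure SuperAlg.IsLieSuperalgebra (L : SuperAlg K V) : Prop where
  isCompl : IsCompl L.evenPart L.oddPart
  even_even : ∀ u ∈ L.evenPart, ∀ v ∈ L.evenPart, L.bracket u v ∈ L.evenPart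
  even_odd : ∀ u ∈ L.evenPart, ∀ v ∈ L.oddPart, L.bracket u v ∈ L.oddPart
  odd_odd : ∀ u ∈ L.oddPart, ∀ v ∈ L.oddPart, L.bracket u v ∈ L.evenPart
  symm : ∀ u v, L.bracket u v = L.bracket v u
  alternating : ∀ u ∈ L.evenPart, L.bracket u u = 0
  jacobi : ∀ u ∈ L.evenPart, ∀ v ∈ L.evenPart, ∀ w,
    L.bracket (L.bracket u v) w = L.bracket u (L.bracket v w) + L.bracket v (L.bracket u w)
  sq_even : ∀ x : L.oddPart, L.sq x ∈ L.evenPart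
  sq_add : ∀ x y : L.oddPart, L.sq (x + y) = L.sq x + L.sq y + L.bracket x y
  sq_bracket : ∀ (x : L.oddPart) (v : V), L.bracket (L.sq x) v = L.bracket x (L.bracket x v)

/-- The desuperization: forget the parity and the squaring. -/
def SuperAlg.desuperization (L : SuperAlg K V) : V →ₗ[K] V →ₗ[K] V := L.bracket

/-! ### Second cohomology with coefficients in the adjoint module -/

/-- The ambient space of 2-cochains: a pair `(c, q)` modifies the bracket by `c` and the squaring
by `q`. Cochains of both parities are included. -/
abbrev SuperAlg.PreCochain (L : SuperAlg K V) : Type _ :=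
  (V →ₗ[K] V →ₗ[K] V) × QuadraticMap K L.oddPart V

/-- The space of 2-cocycles of `L` with values in the adjoint module. The first three conditions
say that `(c, q)` is a 2-cochain; the last two are the linearizations of the Jacobi identity and of
`[x², v] = [x, [x, v]]`. -/
def SuperAlg.Z2 (L : SuperAlg K V) : Submodule K L.PreCochain where
  carrier := {c |
    (∀ u v, c.1 u v = c.1 v u) ∧
    (∀ u ∈ L.evenPart, c.1 u u = 0) ∧
    (∀ x y : L.oddPart, c.2 (x + y) = c.2 x + c.2 y + c.1 x y) ∧
    (∀ u v w, c.1 (L.bracket u v) w + c.1 (L.bracket v w) u + c.1 (L.bracket w u) v +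
      (L.bracket (c.1 u v) w + L.bracket (c.1 v w) u + L.bracket (c.1 w u) v) = 0) ∧
    (∀ (x : L.oddPart) (v : V), c.1 (L.sq x) v + L.bracket (c.2 x) v =
      c.1 x (L.bracket x v) + L.bracket x (c.1 x v))}
  zero_mem' := by simp
  add_mem' := by
    rintro c d ⟨c1, c2, c3, c4, c5⟩ ⟨d1, d2, d3, d4, d5⟩
    refine ⟨fun u v => ?_, fun u hu => ?_, fun x y => ?_, fun u v w => ?_, fun x v => ?_⟩
    · simp [c1 u v, d1 u v]
    · simp [c2 u hu, d2 u hu]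
    · simp only [Prod.snd_add, Prod.fst_add, add_apply, LinearMap.add_apply, c3, d3]
      abel
    · have h := congrArg₂ (· + ·) (c4 u v w) (d4 u v w)
      simp only [add_zero] at h
      rw [← h]
      simp only [Prod.fst_add, LinearMap.add_apply, map_add]
      abel
    · have h := congrArg₂ (· + ·) (c5 x v) (d5 x v)
      simp only [Prod.snd_add, Prod.fst_add, add_apply, LinearMap.add_apply,
        map_add] at h ⊢
      rw [add_add_add_comm, h]
      abel
  smul_mem' := by
    rintro a c ⟨c1, c2, c3, c4, c5⟩
    refine ⟨fun u v => ?_, fun u hu => ?_, fun x y => ?_, fun u v w => ?_, fun x v => ?_⟩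
    · simp [c1 u v]
    · simp [c2 u hu]
    · simp [c3]
    · have h := congrArg (a • ·) (c4 u v w)
      simpa using h
    · have h := congrArg (a • ·) (c5 x v)
      simpa using h

/-- The space of 2-coboundaries: the differentials of linear maps `f : L → L`. -/
def SuperAlg.B2 (L : SuperAlg K V) : Submodule K L.PreCochain where
  carrier := {c | ∃ f : V →ₗ[K] V,
    (∀ u v, c.1 u v = f (L.bracket u v) + L.bracket (f u) v + L.bracket u (f v)) ∧
    (∀ x : L.oddPart, c.2 x = f (L.sq x) + L.bracket x (f x))}
  zero_mem' := ⟨0, by simp, by simp⟩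
  add_mem' := by
    rintro c d ⟨f, f1, f2⟩ ⟨g, g1, g2⟩
    refine ⟨f + g, fun u v => ?_, fun x => ?_⟩
    · simp only [Prod.fst_add, LinearMap.add_apply, f1, g1, map_add]
      abel
    · simp only [Prod.snd_add, add_apply, LinearMap.add_apply, f2, g2, map_add]
      abel
  smul_mem' := by
    rintro a c ⟨f, f1, f2⟩
    exact ⟨a • f, fun u v => by simp [f1], fun x => by simp [f2]⟩

/-- `H²(L; L)`, as the image of the cocycles in the quotient by the coboundaries. -/
def SuperAlg.H2 (L : SuperAlg K V) : Submodule K (L.PreCochain ⧸ L.B2) := L.Z2.map L.B2.mkQ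

/-- The `c i` are cocycles whose classes form a basis of `H²(L; L)`. -/
structure SuperAlg.IsCohomologyBasis (L : SuperAlg K V) {ι : Type*} (c : ι → L.PreCochain) :
    Prop where
  cocycle : ∀ i, c i ∈ L.Z2
  linearIndependent : LinearIndependent K fun i => L.B2.mkQ (c i)
  span : Submodule.span K (Set.range fun i => L.B2.mkQ (c i)) = L.H2

/-- The deform of `L` by the cochain `c` with the value `t` of the parameter. -/
def SuperAlg.deform (L : SuperAlg K V) (c : L.PreCochain) (t : K) : SuperAlg K V where
  evenPart := L.evenPart
  oddPart := L.oddPart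
  bracket := L.bracket + t • c.1
  sq := L.sq + t • c.2

/-! ### Invariant forms -/

/-- `B` is a non-degenerate invariant symmetric bilinear form (NIS) for the bracket `br`. Neither
parity nor squaring enters the definition. -/
structure IsNIS (br : V →ₗ[K] V →ₗ[K] V) (B : LinearMap.BilinForm K V) : Prop where
  nondegenerate : B.Nondegenerate
  symm : ∀ u v, B u v = B v u
  invariant : ∀ u v w, B (br u w) v = B u (br w v)

end General

/-! ## The algebras `wk(4;α)` and `bgl(4;α)` -/

/-- The Chevalley basis: `x_1, …, x_15`, `h_1, …, h_4`, `y_1, …, y_15` (numbered from 0 here). -/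
inductive Gen
  | x (i : Fin 15)
  | h (i : Fin 4)
  | y (i : Fin 15)
  deriving DecidableEq, Fintype

/-- The elements `x_n`, numbered from 1. -/
abbrev X (n : ℕ) : Gen := .x (Fin.ofNat 15 (n - 1))
/-- The elements `h_n`, numbered from 1. -/
abbrev H (n : ℕ) : Gen := .h (Fin.ofNat 4 (n - 1))
/-- The elements `y_n`, numbered from 1. -/
abbrev Y (n : ℕ) : Gen := .y (Fin.ofNat 15 (n - 1))

/-- The underlying space, with its basis `e g`. -/
abbrev Vec (K : Type*) := Gen → K

/-- The basis vectors. -/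
abbrev e {K : Type*} [Field K] (g : Gen) : Vec K := Pi.single g 1

/-- The positive roots, in coordinates with respect to the simple roots. -/
def root : Fin 15 → Fin 4 → ℤ :=
  ![![1, 0, 0, 0], ![0, 1, 0, 0], ![0, 0, 1, 0], ![0, 0, 0, 1],
    ![1, 1, 0, 0], ![1, 0, 1, 0], ![0, 0, 1, 1],
    ![1, 1, 1, 0], ![1, 0, 1, 1],
    ![2, 1, 1, 0], ![1, 1, 1, 1],
    ![2, 1, 1, 1], ![2, 1, 2, 1], ![3, 1, 2, 1], ![3, 2, 2, 1]]

/-- The weights of the basis vectors. -/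
def wt : Gen → Fin 4 → ℤ
  | .x i => root i
  | .h _ => 0
  | .y i => -root i

/-- The first simple root is odd, the other simple roots are even. -/
def Gen.IsOdd (g : Gen) : Prop := wt g 0 % 2 = 1

/-- The vectors all of whose coordinates vanish at the `g` with `p g`. -/
def vanishing (K : Type*) [Field K] (p : Gen → Prop) : Submodule K (Vec K) where
  carrier := {u | ∀ g, p g → u g = 0}
  zero_mem' := by simp
  add_mem' := by
    intro u v hu hv g hg
    simp [hu g hg, hv g hg]
  smul_mem' := by
    intro a u hu g hg
    simp [hu g hg]

section Algebras

variable {K : Type*} [Field K]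

/-- The bilinear map `Σ s(a,b,k) e_k ⊗ â ⊗ b̂`, with `â`, `b̂` the dual basis. -/
def bilinOf (s : Gen → Gen → Gen → K) : Vec K →ₗ[K] Vec K →ₗ[K] Vec K :=
  LinearMap.mk₂ K (fun u v k => ∑ a, ∑ b, s a b k * (u a * v b))
    (by
      intro u u' v
      funext k
      simp only [Pi.add_apply, ← Finset.sum_add_distrib]
      exact Finset.sum_congr rfl fun a _ => Finset.sum_congr rfl fun b _ => by ring)
    (by
      intro c u v
      funext k
      simp only [Pi.smul_apply, smul_eq_mul, Finset.mul_sum]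
      exact Finset.sum_congr rfl fun a _ => Finset.sum_congr rfl fun b _ => by ring)
    (by
      intro u v v'
      funext k
      simp only [Pi.add_apply, ← Finset.sum_add_distrib]
      exact Finset.sum_congr rfl fun a _ => Finset.sum_congr rfl fun b _ => by ring)
    (by
      intro c u v
      funext k
      simp only [Pi.smul_apply, smul_eq_mul, Finset.mul_sum]
      exact Finset.sum_congr rfl fun a _ => Finset.sum_congr rfl fun b _ => by ring)

/-- `Σ s(a,b,k) e_k ⊗ (â ∧ b̂)` as a bilinear map: a term sends `(e_a, e_b)` and `(e_b, e_a)` to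
`s(a,b,k) e_k`. Each unordered pair `{a, b}` is listed in one order only. -/
def wedgeBracket (s : Gen → Gen → Gen → K) : Vec K →ₗ[K] Vec K →ₗ[K] Vec K :=
  bilinOf s + (bilinOf s).flip

/-- The squaring that goes with `wedgeBracket s` on a subspace `O`: the term of `a ≠ b` sends
`u = Σ u_a e_a` to `u_a u_b s(a,b,k) e_k`, so that the polarization is `wedgeBracket s` and the
basis vectors have square zero. -/
def wedgeSq (s : Gen → Gen → Gen → K) (O : Submodule K (Vec K)) :
    QuadraticMap K O (Vec K) :=
  LinearMap.BilinMap.toQuadraticMap ((bilinOf s).domRestrict₁₂ O O)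

/-- The Cartan matrix. -/
def cartan (α : K) : Matrix (Fin 4) (Fin 4) K :=
  !![0, α, 1, 0;
     α, 0, 0, 0;
     1, 0, 0, 1;
     0, 0, 1, 0]

/-- The numbers `ν_i` with `[x_i, y_i] = ν_i Σ_j root_{i,j} h_j`. -/
def nu (α : K) : Fin 15 → K :=
  ![1, 1, 1, 1, α, 1, 1, α, 1, α * (1 + α), α, α * (1 + α), α * (1 + α),
    α ^ 2 * (1 + α), α ^ 3 * (1 + α)]

/-- The value of the `i`-th positive root on `h_j`. -/
def rootVal (α : K) (i : Fin 15) (j : Fin 4) : K := ∑ l, cartan α j l * (root i l : K)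

/-- The structure constants in the Chevalley basis (each pair in one order):
`[x_i, x_j] = x_k` and `[y_i, y_j] = y_k` if the roots add up;
`[h_j, x_i] = rootVal i j • x_i`, and the same for `y_i`;
`[x_i, y_i] = ν_i Σ_j root_{i,j} h_j`; and for `i ≠ j` the bracket `[x_i, y_j]` is
`(ν_i / ν_k) x_k`, `(ν_j / ν_k) y_k`, or zero, as the difference of the roots
is a positive root, a negative root, or not a root. -/
def structConst (α : K) : Gen → Gen → Gen → K
  | .x i, .x j, .x k => if i < j ∧ root i + root j = root k then 1 else 0
  | .y i, .y j, .y k => if i < j ∧ root i + root j = root k then 1 else 0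
  | .x i, .h j, .x k => if i = k then rootVal α i j else 0
  | .h j, .y i, .y k => if i = k then rootVal α i j else 0
  | .x i, .y j, .h k => if i = j then nu α i * (root i k : K) else 0
  | .x i, .y j, .x k => if root i = root j + root k then nu α i / nu α k else 0
  | .x i, .y j, .y k => if root j = root i + root k then nu α j / nu α k else 0
  | _, _, _ => 0

/-- The bracket of the Weisfeiler-Kac Lie algebra `wk(4;α)`. -/
def wk4 (α : K) : Vec K →ₗ[K] Vec K →ₗ[K] Vec K := wedgeBracket (structConst α)

/-- The Lie superalgebra `bgl(4;α)`: the superization of `wk(4;α)` with the first simple root odd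
and with the squaring for which the root vectors have square zero. -/
def bgl4 (α : K) : SuperAlg K (Vec K) where
  evenPart := vanishing K fun g => g.IsOdd
  oddPart := vanishing K fun g => ¬ g.IsOdd
  bracket := wk4 α
  sq := wedgeSq (structConst α) _

/-- `br` is the bracket of the Lie algebra with Cartan matrix `A` and Chevalley generators
`x_i, h_i, y_i` (in characteristic 2): the relations of the Cartan matrix hold, the generators
generate, and no nonzero ideal meets the span of the linearly independent `h_i` trivially. -/
structure IsCartanAlgebra {V : Type*} [AddCommGroup V] [Module K V]
    (A : Matrix (Fin 4) (Fin 4) K) (br : V →ₗ[K] V →ₗ[K] V) (x h y : Fin 4 → V) : Prop where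
  linearIndependent : LinearIndependent K h
  h_h : ∀ i j, br (h i) (h j) = 0
  h_x : ∀ i j, br (h i) (x j) = A i j • x j
  h_y : ∀ i j, br (h i) (y j) = A i j • y j
  x_y : ∀ i j, br (x i) (y j) = if i = j then h i else 0
  generate : ∀ S : Submodule K V, (∀ i, x i ∈ S) → (∀ i, h i ∈ S) → (∀ i, y i ∈ S) →
    (∀ u ∈ S, ∀ v ∈ S, br u v ∈ S) → S = ⊤
  ideal : ∀ I : Submodule K V, (∀ u ∈ I, ∀ v, br u v ∈ I) →
    Disjoint I (Submodule.span K (Set.range h)) → I = ⊥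

/-- The expressions of `x_5, …, x_15` through the generators `x_1, …, x_4`. -/
def ChevalleyRelations {V : Type*} [AddCommGroup V] [Module K V]
    (br : V →ₗ[K] V →ₗ[K] V) (x : ℕ → V) : Prop :=
  x 5 = br (x 1) (x 2) ∧ x 6 = br (x 1) (x 3) ∧ x 7 = br (x 3) (x 4) ∧
  x 8 = br (x 3) (br (x 1) (x 2)) ∧ x 9 = br (x 4) (br (x 1) (x 3)) ∧
  x 10 = br (br (x 1) (x 2)) (br (x 1) (x 3)) ∧
  x 11 = br (br (x 1) (x 2)) (br (x 3) (x 4)) ∧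
  x 12 = br (br (x 1) (x 2)) (br (x 4) (br (x 1) (x 3))) ∧
  x 13 = br (br (x 3) (br (x 1) (x 2))) (br (x 4) (br (x 1) (x 3))) ∧
  x 14 = br (br (x 4) (br (x 1) (x 3))) (br (br (x 1) (x 2)) (br (x 1) (x 3))) ∧
  x 15 = br (br (br (x 1) (x 2)) (br (x 1) (x 3))) (br (br (x 1) (x 2)) (br (x 3) (x 4)))

/-- The span of the basis vectors of weight `w`. -/
def weightSpace (K : Type*) [Field K] (w : Fin 4 → ℤ) : Submodule K (Vec K) :=
  vanishing K fun g => wt g ≠ w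

/-- The cochain `c` is homogeneous of weight `w` with respect to the grading by the root lattice. -/
def HasWeight {α : K} (c : (bgl4 α).PreCochain) (w : Fin 4 → ℤ) : Prop :=
  (∀ a b, c.1 (e a) (e b) ∈ weightSpace K (wt a + wt b + w)) ∧
  (∀ (a : Gen) (x : (bgl4 α).oddPart), (x : Vec K) = e a →
    c.2 x ∈ weightSpace K (wt a + wt a + w))

/-- The cochain `c` is even: it respects parity. -/
def IsEvenCochain {α : K} (c : (bgl4 α).PreCochain) : Prop :=
  (∀ a b, c.1 (e a) (e b) ∈ vanishing K fun g => ¬ (wt g 0 % 2 = (wt a 0 + wt b 0) % 2)) ∧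
  (∀ x : (bgl4 α).oddPart, c.2 x ∈ (bgl4 α).evenPart)

/-- The roots `γ` such that `H²` has classes of weights `-2γ` and `2γ`, by their numbers: these are
the roots of the basis vectors `x_13, x_12, x_10, x_11, x_9, x_8, x_5, x_6, x_1`. -/
def specialRoot : Fin 9 → ℕ := ![13, 12, 10, 11, 9, 8, 5, 6, 1]

/-- The element `k` in the term `k ⊗ (x̂_i)^{∧2}` of the basis cocycle of weight `-2γ_i`, where
`i = specialRoot n`. For the even roots (the first three) there is no such term. -/
def squareTerm (α : K) : Fin 9 → Vec K :=
  ![0, 0, 0,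
    (α ^ 2 * (1 + α)) • e (H 3),
    (1 + α) • e (H 3),
    (α ^ 2 * (1 + α)) • (e (H 3) + e (H 4)),
    (α ^ 2 * (1 + α)) • e (H 4),
    (1 + α) • (e (H 3) + e (H 4)),
    (1 + α) • e (H 4)]

/-- The terms of the cocycle `c_0`: `(s, k, a, b)` stands for `s k ⊗ (â ∧ b̂)`. -/
def c0Terms (α : K) : List (K × Gen × Gen × Gen) :=
  [
    (1 + α, H 4, X 1, Y 1), (1 + α, Y 3, X 1, Y 6),
    (1 + α, Y 7, X 1, Y 9), (α * (1 + α), H 4, X 5, Y 5),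
    (α * (1 + α), Y 3, X 5, Y 8), (α * (1 + α), Y 7, X 5, Y 11),
    (1 + α, X 3, X 6, Y 1), (1 + α, H 3, X 6, Y 6),
    (1 + α, H 4, X 6, Y 6), (1 + α, Y 4, X 6, Y 9),
    (α * (1 + α), X 3, X 8, Y 5), (α * (1 + α), H 3, X 8, Y 8),
    (α * (1 + α), H 4, X 8, Y 8), (α * (1 + α), Y 4, X 8, Y 11),
    (1 + α, X 7, X 9, Y 1), (1 + α, X 4, X 9, Y 6),
    (1 + α, H 3, X 9, Y 9), (1 + α, X 8, X 10, Y 1),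
    (α * (1 + α), X 6, X 10, Y 5), (1 + α, X 5, X 10, Y 6),
    (α * (1 + α), X 1, X 10, Y 8), (α * (1 + α) ^ 2, H 3, X 10, Y 10),
    (α * (1 + α) ^ 2, Y 4, X 10, Y 12), (α * (1 + α) ^ 2, Y 7, X 10, Y 13),
    (α * (1 + α), X 7, X 11, Y 5), (α * (1 + α), X 4, X 11, Y 8),
    (α * (1 + α), H 3, X 11, Y 11), (1 + α, X 11, X 12, Y 1),
    (α * (1 + α), X 9, X 12, Y 5), (1 + α, X 5, X 12, Y 9),
    (α * (1 + α) ^ 2, X 4, X 12, Y 10), (α * (1 + α), X 1, X 12, Y 11),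
    (α * (1 + α) ^ 2, H 3, X 12, Y 12), (α * (1 + α) ^ 2, H 4, X 12, Y 12),
    (α * (1 + α) ^ 2, Y 3, X 12, Y 13), (1 + α, X 11, X 13, Y 6),
    (α * (1 + α), X 9, X 13, Y 8), (1 + α, X 8, X 13, Y 9),
    (α * (1 + α) ^ 2, X 7, X 13, Y 10), (α * (1 + α), X 6, X 13, Y 11),
    (α * (1 + α) ^ 2, X 3, X 13, Y 12), (α * (1 + α) ^ 2, H 4, X 13, Y 13),
    (1, Y 10, Y 1, Y 8), (1, Y 12, Y 1, Y 11),
    (1, Y 10, Y 5, Y 6), (1, Y 12, Y 5, Y 9),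
    (1, Y 13, Y 6, Y 11), (1, Y 13, Y 8, Y 9)]

/-- The coefficients of `c_0`. -/
def c0Coeff (α : K) (a b k : Gen) : K :=
  ((c0Terms α).map fun T => if T.2 = (k, a, b) then T.1 else 0).sum

/-- The cocycle `c_0` of the Lie algebra `wk(4;α)`. -/
def c0 (α : K) : Vec K →ₗ[K] Vec K →ₗ[K] Vec K := wedgeBracket (c0Coeff α)

/-- The corresponding cocycle of the Lie superalgebra `bgl(4;α)`: the image of `c_0` under the
embedding of alternating maps into the 2-cochains of the superalgebra. -/
def c0bar (α : K) : (bgl4 α).PreCochain := (c0 α, wedgeSq (c0Coeff α) _)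

/-- `Γ` is the Gram matrix, in the Chevalley basis, of some NIS for the bracket `br`. -/
def HasNISWithGram (br : Vec K →ₗ[K] Vec K →ₗ[K] Vec K) (Γ : Matrix Gen Gen K) : Prop :=
  ∃ B : LinearMap.BilinForm K (Vec K), IsNIS br B ∧ ∀ a b, B (e a) (e b) = Γ a b

/-- The Gram matrix of the NIS on `bgl(4;α)`. -/
def gram (α : K) : Matrix Gen Gen K
  | .x i, .y j => if i = j then nu α i else 0
  | .y i, .x j => if i = j then nu α i else 0
  | .h i, .h j => cartan α i j
  | _, _ => 0

/-- The Gram matrix of the NIS on the deform of `bgl(4;α)` by `c_0` with parameter `t`: the entries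
of `gram α` at `(h_1, h_2)` and at `(x_i, y_i)` with `i ≠ 3, 4, 7`, and the symmetric ones,
are multiplied by `1 + (1 + α) t`. -/
def gramC0 (α t : K) : Matrix Gen Gen K := fun a b =>
  if (a, b) ∈ [(H 1, H 3), (H 3, H 1), (H 3, H 4), (H 4, H 3),
      (X 3, Y 3), (X 4, Y 4), (X 7, Y 7), (Y 3, X 3), (Y 4, X 4), (Y 7, X 7)]
  then gram α a b else (1 + (1 + α) * t) * gram α a b

end Algebras

end Bgl

open Bgl

namespace Bgl

noncomputable section

/-! ## Polynomials over the prime field, as binary numerals -/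

section Engine

/-! The quotients `ν_i / ν_k` that occur as structure constants are products of powers of `α` and `1
+ α` (`nu_div`), so all coefficients of the bracket and of the cocycles lie in `𝔽₂[α]`. An identity
for all `α ≠ 0, 1` can therefore be verified once, between polynomials coded by binary numerals; the
hypotheses on `α` serve only to make `α` and `1 + α` invertible (`ev_ne_zero`). Passing from basis
vectors to arbitrary vectors is multilinearity for Jacobi identities (`jac_ext`). For `[x², v] = [x,
[x, v]]` it rests on the fact that the polarization of the defect is the Jacobi expression
(`sqDefect_add`), so only odd basis vectors remain.

Cohomology. The value of a weight on `h_j` depends only on the weight modulo twice the root lattice,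
and the Cartan matrix is invertible. Hence a weight outside twice the lattice is nonzero on some
`h_j`, and contraction with this `h_j`, divided by that value, is a homotopy: the components of a
cocycle in such weights are exact (`boundary_homotopy`). In the remaining weights a triangular
family of coboundaries makes many coordinates vanish (`exists_gauge`). If moreover nineteen linear
forms vanish, the cocycle identities eliminate all other coordinates one at a time, always with an
invertible pivot (`propagate_even`). The quadratic part of a cocycle carries no further information,
because the center is trivial (`eq_zero_of_fst_eq_zero`). The nineteen forms kill coboundaries and
are dual, up to nonzero factors, to nineteen explicit cocycles (`classForm_check`); so they detect
coboundaries (`mem_B2_of_classForm`) and the classes form a basis (`basis_mkQ_of_dual`).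

Deforms. In the identities of a deform the part linear in `t` is the cocycle condition, and only the
part quadratic in `t` is left. For a cocycle of weight `-2γ` the quadratic part has weight `-4γ`,
and there is nearly always no vector of the required weight (`jac_eq_zero_of_weight`). The one
surviving case, in the squaring identity, is governed by coordinates that vanish on coboundaries, so
the choice of representative is immaterial (`sq_bracket_of_weight`). The cocycle `c0` satisfies the
quadratic identities by itself (`jac_c0`, `c0bar_sq_bracket`).

Invariant forms. For a fixed form, the defect of invariance is linear in the cocycle. In weight
`-2γ` it vanishes on coboundaries and on the basic cocycle, so the form of the undeformed algebra
stays invariant (`invDefect_eq_zero_of_weight`). For `c0` both the bracket and the proposed form are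
affine in `t`, and the three coefficients of the defect vanish (`invariant_gramC0`). Conversely,
elimination with pivots free of `t` shows that an invariant symmetric form is determined by its
entry at `(x_3, y_3)`, for every `t` (`eq_zero_of_invariant`). The resulting form is nondegenerate
when `1 + (1 + α) t ≠ 0`; otherwise `x_1` lies in its radical. -/

/-- The value at `α` of the polynomial over `𝔽₂` whose coefficients are the binary digits of `n`. -/
def ev {K : Type*} [Field K] (α : K) (n : ℕ) : K :=
  if n = 0 then 0 else (n % 2 : ℕ) + α * ev α (n / 2)
decreasing_by omega

/-- The product of binary polynomials; the first argument is a bound for the recursion. -/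
def clmul : ℕ → ℕ → ℕ → ℕ
  | 0, _, _ => 0
  | n + 1, p, q => bif Nat.beq p 0 then 0 else
      Nat.xor (bif Nat.beq (Nat.mod p 2) 1 then q else 0) (clmul n (Nat.div p 2) (Nat.mul 2 q))

/-- The product of binary polynomials. -/
def pmul (p q : ℕ) : ℕ := bif Nat.beq p 1 then q else bif Nat.beq q 1 then p else clmul p p q

/-- The coefficient of `k` in a formal linear combination. -/
def coeffOf (k : ℕ) : List (ℕ × ℕ) → ℕ
  | [] => 0
  | t :: l => bif Nat.beq t.1 k then Nat.xor t.2 (coeffOf k l) else coeffOf k l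

/-- All coefficients of a formal linear combination vanish. -/
def isZero (l : List (ℕ × ℕ)) : Bool := l.all fun t => Nat.beq (coeffOf t.1 l) 0

/-- The product of a formal linear combination with a polynomial. -/
def scale (c : ℕ) (l : List (ℕ × ℕ)) : List (ℕ × ℕ) := l.map fun t => (t.1, pmul t.2 c)

/-- The extension by linearity of a table of brackets in the second argument. -/
def act (P : ℕ → ℕ → List (ℕ × ℕ)) (a : ℕ) (l : List (ℕ × ℕ)) : List (ℕ × ℕ) :=
  l.flatMap fun t => scale t.2 (P a t.1)

/-- The left-hand side of the Jacobi identity for two tables. -/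
def jacList (P Q : ℕ → ℕ → List (ℕ × ℕ)) (a b c : ℕ) : List (ℕ × ℕ) :=
  act P a (Q b c) ++ (act P b (Q c a) ++ act P c (Q a b))

end Engine

section Eval

variable {K : Type*} [Field K] (α : K)

@[simp] lemma ev_zero : ev α 0 = 0 := by rw [ev]; simp

lemma ev_eq (n : ℕ) : ev α n = (n % 2 : ℕ) + α * ev α (n / 2) := by
  by_cases h : n = 0
  · subst h; simp
  · rw [ev, if_neg h]

@[simp] lemma ev_one : ev α 1 = 1 := by rw [ev_eq]; simp

lemma ev_two_mul (n : ℕ) : ev α (2 * n) = α * ev α n := by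
  rw [ev_eq]; simp

variable [CharP K 2]

/-- Addition over `𝔽₂` has no carries, so it acts on each binary digit separately. The induction
strips the lowest digit of both numbers. -/
lemma ev_xor (m n : ℕ) : ev α (Nat.xor m n) = ev α m + ev α n := by
  change ev α (m ^^^ n) = _
  induction m using Nat.strong_induction_on generalizing n with
  | _ m ih =>
    by_cases hm : m = 0
    · subst hm; simp
    · rw [ev_eq α (m ^^^ n), ev_eq α m, ev_eq α n, Nat.xor_div_two, ih (m / 2) (by omega)]
      have h2 : (2 : K) = 0 := CharTwo.two_eq_zero
      have : (((m ^^^ n) % 2 : ℕ) : K) = (m % 2 : ℕ) + (n % 2 : ℕ) := by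
        rw [Nat.xor_mod_two_eq]
        rcases Nat.mod_two_eq_zero_or_one m with h | h <;>
          rcases Nat.mod_two_eq_zero_or_one n with h' | h' <;>
            simp [Nat.add_mod, h, h']
        rw [one_add_one_eq_two, h2]
      rw [this]; ring

lemma beq_eq_false {m n : ℕ} (h : m ≠ n) : Nat.beq m n = false :=
  Bool.eq_false_iff.mpr fun h' => h (Nat.eq_of_beq_eq_true h')

lemma nat_beq_self (n : ℕ) : Nat.beq n n = true := by rw [Nat.beq_eq]

/-- Each round consumes the lowest digit of `p`, halves `p` and multiplies `q` by the variable; any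
`n ≥ p` leaves enough rounds. -/
lemma ev_clmul : ∀ n p q : ℕ, p ≤ n → ev α (clmul n p q) = ev α p * ev α q
  | 0, p, q, h => by simp [clmul, Nat.le_zero.mp h]
  | n + 1, p, q, h => by
    by_cases hp : p = 0
    · simp [clmul, hp]
    · have hd : p / 2 ≤ n := by omega
      rw [clmul, beq_eq_false hp, cond_false, ev_xor]
      change _ + ev α (clmul n (p / 2) (2 * q)) = _
      rw [ev_clmul n _ _ hd, ev_two_mul, ev_eq α p]
      change ev α (bif Nat.beq (p % 2) 1 then q else 0) + _ = _
      have h01 : Nat.beq 0 1 = false := rfl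
      rcases Nat.mod_two_eq_zero_or_one p with h | h <;> simp [h, h01] <;> ring

lemma ev_pmul (p q : ℕ) : ev α (pmul p q) = ev α p * ev α q := by
  unfold pmul
  by_cases hp : p = 1
  · simp [hp]
  · by_cases hq : q = 1
    · simp [hq, beq_eq_false hp]
    · rw [beq_eq_false hp, beq_eq_false hq]
      exact ev_clmul α p p q le_rfl

end Eval

/-! ## Formal linear combinations of the basis vectors -/

/-- The numbering of the basis vectors. -/
def gen (a : ℕ) : Gen :=
  bif Nat.blt a 15 then .x (Fin.ofNat 15 a)
  else bif Nat.blt a 19 then .h (Fin.ofNat 4 (Nat.sub a 15)) else .y (Fin.ofNat 15 (a - 19))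

/-- The number of a basis vector. -/
def idx : Gen → ℕ
  | .x i => i
  | .h i => 15 + i
  | .y i => 19 + i

lemma gen_idx (g : Gen) : gen (idx g) = g := by
  rcases g with i | i | i <;> fin_cases i <;> rfl

lemma idx_lt (g : Gen) : idx g < 34 := by
  rcases g with i | i | i <;> simp only [idx] <;> omega

lemma idx_gen {a : ℕ} (h : a < 34) : idx (gen a) = a := by
  revert a; decide

/-- Turns statements about basis vectors into bounded statements about numbers, which can be decided
by computation. -/
lemma forall_gen {p : Gen → Prop} : (∀ g, p g) ↔ ∀ a < 34, p (gen a) :=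
  ⟨fun h _ _ => h _, fun h g => gen_idx g ▸ h _ (idx_lt g)⟩

/-- The predicate `p` holds for all numbers below `n`. -/
def allBelow (n : ℕ) (p : ℕ → Bool) : Bool := Nat.rec true (fun k r => p k && r) n

lemma allBelow_apply {p : ℕ → Bool} {n : ℕ} (h : allBelow n p = true) {a : ℕ} (ha : a < n) :
    p a = true := by
  induction n with
  | zero => omega
  | succ n ih =>
    have h' : (p n && allBelow n p) = true := h
    rw [Bool.and_eq_true] at h'
    rcases Nat.lt_succ_iff_lt_or_eq.mp ha with h1 | rfl
    · exact ih h'.2 h1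
    · exact h'.1

section Den

variable {K : Type*} [Field K] (α : K)

/-- The vector given by a formal linear combination of basis vectors. -/
def den (l : List (ℕ × ℕ)) : Vec K := (l.map fun t => ev α t.2 • e (gen t.1)).sum

@[simp] lemma den_nil : den α [] = 0 := rfl

@[simp] lemma den_cons (t : ℕ × ℕ) (l : List (ℕ × ℕ)) :
    den α (t :: l) = ev α t.2 • e (gen t.1) + den α l := by simp [den]

@[simp] lemma den_append (l m : List (ℕ × ℕ)) : den α (l ++ m) = den α l + den α m := by
  simp [den]

variable [CharP K 2]

/-- The same basis vector may occur several times in a list; collecting equal terms is what connects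
`coeffOf` with the vector. -/
lemma den_eq_sum (l : List (ℕ × ℕ)) (S : Finset ℕ) (h : ∀ t ∈ l, t.1 ∈ S) :
    den α l = ∑ k ∈ S, ev α (coeffOf k l) • e (gen k) := by
  induction l with
  | nil => simp [coeffOf]
  | cons t l ih =>
    rw [den_cons, ih fun s hs => h s (List.mem_cons_of_mem _ hs)]
    have h1 : ev α t.2 • (e (gen t.1) : Vec K) =
        ∑ k ∈ S, if t.1 = k then ev α t.2 • e (gen k) else 0 := by
      rw [Finset.sum_ite_eq, if_pos (h t List.mem_cons_self)]
    rw [h1, ← Finset.sum_add_distrib]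
    refine Finset.sum_congr rfl fun k _ => ?_
    by_cases hk : t.1 = k
    · simp only [hk, coeffOf, nat_beq_self, cond_true, ev_xor, add_smul, if_true]
    · simp [hk, coeffOf, beq_eq_false hk]

/-- The passage from computation to algebra: cancellation in `𝔽₂[α]` survives evaluation at any
element of `K`. -/
lemma den_eq_zero {l : List (ℕ × ℕ)} (h : isZero l = true) : den α l = 0 := by
  rw [den_eq_sum α l (l.map Prod.fst).toFinset
    fun t ht => List.mem_toFinset.mpr (List.mem_map_of_mem ht)]
  refine Finset.sum_eq_zero fun k hk => ?_
  obtain ⟨t, ht, rfl⟩ := List.mem_map.mp (List.mem_toFinset.mp hk)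
  have := List.all_eq_true.mp h t ht
  rw [Nat.eq_of_beq_eq_true this, ev_zero, zero_smul]

lemma den_scale (c : ℕ) (l : List (ℕ × ℕ)) : den α (scale c l) = ev α c • den α l := by
  induction l with
  | nil => simp [scale]
  | cons t l ih =>
    have : scale c (t :: l) = (t.1, pmul t.2 c) :: scale c l := rfl
    rw [this, den_cons, ih, den_cons, smul_add, smul_smul, ev_pmul, mul_comm]

/-- The table `P` gives the values of the bilinear map `br` on the basis vectors. -/
def IsTable (br : Vec K →ₗ[K] Vec K →ₗ[K] Vec K) (P : ℕ → ℕ → List (ℕ × ℕ)) : Prop :=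
  ∀ a < 34, ∀ b < 34, br (e (gen a)) (e (gen b)) = den α (P a b)

/-- The indices that occur in the table are numbers of basis vectors. -/
def InRange (P : ℕ → ℕ → List (ℕ × ℕ)) : Prop :=
  ∀ a < 34, ∀ b < 34, ∀ t ∈ P a b, t.1 < 34

variable {α} {br br' : Vec K →ₗ[K] Vec K →ₗ[K] Vec K} {P Q : ℕ → ℕ → List (ℕ × ℕ)}

lemma IsTable.act (hP : IsTable α br P) {a : ℕ} (ha : a < 34) {l : List (ℕ × ℕ)}
    (hl : ∀ t ∈ l, t.1 < 34) : br (e (gen a)) (den α l) = den α (act P a l) := by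
  induction l with
  | nil => simp [Bgl.act]
  | cons t l ih =>
    have : Bgl.act P a (t :: l) = scale t.2 (P a t.1) ++ Bgl.act P a l := rfl
    rw [this, den_cons, map_add, map_smul, hP a ha t.1 (hl t List.mem_cons_self),
      ih fun s hs => hl s (List.mem_cons_of_mem _ hs), den_append, den_scale]

lemma IsTable.jac (hP : IsTable α br P) (hQ : IsTable α br' Q) (hQr : InRange Q)
    {a b c : ℕ} (ha : a < 34) (hb : b < 34) (hc : c < 34) :
    br (e (gen a)) (br' (e (gen b)) (e (gen c))) + br (e (gen b)) (br' (e (gen c)) (e (gen a))) +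
      br (e (gen c)) (br' (e (gen a)) (e (gen b))) = den α (jacList P Q a b c) := by
  rw [hQ b hb c hc, hQ c hc a ha, hQ a ha b hb, hP.act ha (hQr b hb c hc),
    hP.act hb (hQr c hc a ha), hP.act hc (hQr a ha b hb), jacList, den_append, den_append,
    add_assoc]

end Den

/-! ## Table of the structure constants of `wk(4;α)` -/

section Table

/-- Whether the number is that of some `h_j`. -/
def isCartan (a : ℕ) : Bool := Nat.ble 15 a && Nat.blt a 19

/-- The number of the positive root proportional to the weight of a root vector. -/
def absIdx (a : ℕ) : ℕ := bif Nat.blt a 15 then a else Nat.sub a 19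

/-- The weights of the basis vectors are separated by the functional `(2, 3, 9, 15)`,
shifted by 46. -/
def wtCode (a : ℕ) : ℕ :=
  Nat.land (Nat.shiftRight 0x840c3c89e2880b23527d2ab58b972e5d6ec569b2df487919cb37add8b0 (Nat.mul 7 a)) 127

/-- The successor of the number of the root vector with the given weight code; 0 for other codes and
35 for the code of the zero weight. -/
def ofCode (s : ℕ) : ℕ := Nat.land (Nat.shiftRight
  0x3c000e00d0000000000003002c000900700000000000a1080001800c000014008102301454060000058064001b5dd00000000001a01c0007807c0000000000020021000880
  (Nat.mul 6 s)) 63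

/-- The code `p + 8 q` of the monomial `α ^ p (1 + α) ^ q` that is the value of `nu`. -/
def nuCode (i : ℕ) : ℕ := Nat.land (Nat.shiftRight 0x2d49485200800100000 (Nat.mul 5 i)) 31

/-- The polynomial `α ^ p (1 + α) ^ q` with the code `p + 8 q`, of degree at most 5. -/
def monomial (m : ℕ) : ℕ :=
  Nat.land (Nat.shiftRight 0xa1428500003060c183000810204081 (Nat.mul 6 m)) 63

/-- The values of the roots on the `h_j`. -/
def rootValCode (i j : ℕ) : ℕ :=
  Nat.land (Nat.shiftRight 0x80a12534b43495b51591a10410218 (2 * (4 * i + j))) 3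

/-- The coordinates of the roots modulo 2. -/
def rootParity (i j : ℕ) : ℕ := Nat.land (Nat.shiftRight 0x9baef6d7c538421 (4 * i + j)) 1

/-- Formal linear combination with one term, or empty if the coefficient vanishes. -/
def single (k c : ℕ) : List (ℕ × ℕ) := bif Nat.beq c 0 then [] else [(k, c)]

/-- The bracket of opposite root vectors. -/
def coroot (i : ℕ) : List (ℕ × ℕ) :=
  let m := monomial (nuCode i)
  single 15 (rootParity i 0 * m) ++ (single 16 (rootParity i 1 * m) ++
    (single 17 (rootParity i 2 * m) ++ single 18 (rootParity i 3 * m)))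

/-- The bracket of `wk(4;α)` on the basis vectors. -/
def wkTable (a b : ℕ) : List (ℕ × ℕ) :=
  bif isCartan a then
    bif isCartan b then [] else single b (rootValCode (absIdx b) (Nat.sub a 15))
  else bif isCartan b then single a (rootValCode (absIdx a) (Nat.sub b 15))
  else
    -- The code of a weight is its functional plus 46, so the code of a sum is the sum of the codes
    -- minus 46.
    let r := ofCode (Nat.sub (Nat.add (wtCode a) (wtCode b)) 46)
    bif Nat.beq r 0 then []
    else bif Nat.beq r 35 then coroot (absIdx a)
    else
      let i := absIdx a
      let j := absIdx b
      let k := absIdx (Nat.sub r 1)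
      -- The roots are numbered by nondecreasing height. If one of three roots is the sum of the
      -- other two, it has the largest number, and its `ν` is the numerator. Subtracting codes
      -- subtracts the exponents of `α` and `1 + α`.
      let ij := bif Nat.ble i j then j else i
      let m := bif Nat.ble ij k then k else ij
      [(Nat.sub r 1, monomial (Nat.sub (nuCode m) (nuCode k)))]

/-- All sorted triples satisfy the Jacobi identity for `P` and `Q`. -/
def jacCheck (P Q : ℕ → ℕ → List (ℕ × ℕ)) : Bool :=
  allBelow 34 fun a => allBelow a fun b => allBelow b fun c =>
    isZero (jacList P Q a b c)

end Table

-- The Jacobi identity of `wk4` as an identity in `𝔽₂[α]`. Strictly decreasing triples suffice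
-- because the bracket is alternating.
set_option maxRecDepth 10000 in
lemma jacCheck_wkTable : jacCheck wkTable wkTable = true := by decide +kernel


/-! ## The table describes `wk(4;α)` -/

section Coordinates

variable {K : Type*} [Field K]

lemma bilinOf_e (s : Gen → Gen → Gen → K) (a b : Gen) : bilinOf s (e a) (e b) = s a b := by
  funext k
  change ∑ a', ∑ b', s a' b' k * ((e a : Vec K) a' * (e b : Vec K) b') = _
  rw [Finset.sum_eq_single a, Finset.sum_eq_single b]
  · simp
  · intro b' _ h; simp [h]
  · simp
  · intro a' _ h; simp [h]
  · simp

lemma wedgeBracket_e (s : Gen → Gen → Gen → K) (a b : Gen) :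
    wedgeBracket s (e a) (e b) = s a b + s b a := by
  simp only [wedgeBracket, LinearMap.add_apply, LinearMap.flip_apply, bilinOf_e]

variable [CharP K 2] (α : K)

lemma den_apply {l : List (ℕ × ℕ)} (h : ∀ t ∈ l, t.1 < 34) (g : Gen) :
    den α l g = ev α (coeffOf (idx g) l) := by
  rw [den_eq_sum α l (Finset.range 34) fun t ht => Finset.mem_range.mpr (h t ht),
    Finset.sum_apply, Finset.sum_eq_single (idx g)]
  · simp [gen_idx]
  · intro k hk hne
    have : g ≠ gen k := fun h => hne (by rw [h, idx_gen (Finset.mem_range.mp hk)])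
    simp [this]
  · intro h
    exact absurd (Finset.mem_range.mpr (idx_lt g)) h

omit [CharP K 2] in
@[simp] lemma den_single (k c : ℕ) : den α (single k c) = ev α c • e (gen k) := by
  by_cases h : c = 0
  · simp [single, h]
  · simp [single, beq_eq_false h]

/-- A wedge bracket is given by a table if the coefficients agree. -/
lemma isTable_wedgeBracket {s : Gen → Gen → Gen → K} {P : ℕ → ℕ → List (ℕ × ℕ)}
    (hP : InRange P)
    (h : ∀ a b k, s a b k + s b a k = ev α (coeffOf (idx k) (P (idx a) (idx b)))) :
    IsTable α (wedgeBracket s) P := by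
  intro a ha b hb
  funext k
  rw [wedgeBracket_e, den_apply α (hP a ha b hb), Pi.add_apply, h, idx_gen ha, idx_gen hb]

end Coordinates

/-- `structConst` with binary polynomials as values. -/
def structCode : Gen → Gen → Gen → ℕ
  | .x i, .x j, .x k =>
      bif Nat.blt i j && (wtCode i + wtCode j == wtCode k + 46) then 1 else 0
  | .y i, .y j, .y k =>
      bif Nat.blt i j && (wtCode i + wtCode j == wtCode k + 46) then 1 else 0
  | .x i, .h j, .x k => bif Nat.beq i k then rootValCode i j else 0
  | .h j, .y i, .y k => bif Nat.beq i k then rootValCode i j else 0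
  | .x i, .y j, .h k => bif Nat.beq i j then rootParity i k * monomial (nuCode i) else 0
  | .x i, .y j, .x k =>
      bif wtCode j + wtCode k == wtCode i + 46 then monomial (nuCode i - nuCode k) else 0
  | .x i, .y j, .y k =>
      bif wtCode i + wtCode k == wtCode j + 46 then monomial (nuCode j - nuCode k) else 0
  | _, _, _ => 0

/-- The functional `(2, 3, 9, 15)` never confuses the sum of two positive roots with a different
positive root. -/
lemma root_add_iff : ∀ i j k : Fin 15,
    root i + root j = root k ↔ (wtCode i + wtCode j == wtCode k + 46) = true := by
  decide +kernel

/-- Divisibility of `ν_k` by `ν_j` when the difference of the roots is a positive root. This is why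
the structure constants need no denominators. -/
lemma monomial_nuCode : ∀ i j k : Fin 15, root i + root j = root k →
    pmul (monomial (nuCode k - nuCode j)) (monomial (nuCode j)) = monomial (nuCode k) := by
  decide +kernel

lemma root_parity : ∀ (i : Fin 15) (j : Fin 4), root i j % 2 = (rootParity i j : ℤ) := by
  decide +kernel

/-! ### Evaluation of the coded structure constants at `α`. -/

section Bridge

variable {K : Type*} [Field K] [CharP K 2] (α : K)

lemma intCast_mod_two (n : ℤ) : ((n % 2 : ℤ) : K) = (n : K) := by
  conv_rhs => rw [← Int.emod_add_mul_ediv n 2]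
  have h2 : (2 : K) = 0 := CharTwo.two_eq_zero
  push_cast
  rw [h2, zero_mul, add_zero]

lemma root_cast (i : Fin 15) (j : Fin 4) : (root i j : K) = (rootParity i j : ℕ) := by
  rw [← intCast_mod_two, root_parity, Int.cast_natCast]

omit [CharP K 2] in
lemma ev_two : ev α 2 = α := by rw [ev_eq]; simp
omit [CharP K 2] in
lemma ev_three : ev α 3 = 1 + α := by rw [ev_eq]; simp

lemma rootVal_eq (i : Fin 15) (j : Fin 4) : rootVal α i j = ev α (rootValCode i j) := by
  have h : rootVal α i j = ∑ l, cartan α j l * (rootParity i l : ℕ) :=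
    Finset.sum_congr rfl fun l _ => by rw [root_cast]
  rw [h, Fin.sum_univ_four]
  fin_cases i <;> fin_cases j <;>
    simp [cartan, rootParity, rootValCode, ev_two, ev_three,
      add_comm, CharTwo.add_self_eq_zero]

lemma nu_eq (i : Fin 15) : nu α i = ev α (monomial (nuCode i)) := by
  have h2 : (2 : K) = 0 := CharTwo.two_eq_zero
  have h6 : ev α 6 = α * (1 + α) := by rw [show 6 = 2 * 3 from rfl, ev_two_mul, ev_three]
  have h12 : ev α 12 = α ^ 2 * (1 + α) := by
    rw [show 12 = 2 * 6 from rfl, ev_two_mul, h6]; ring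
  have h24 : ev α 24 = α ^ 3 * (1 + α) := by
    rw [show 24 = 2 * 12 from rfl, ev_two_mul, h12]; ring
  fin_cases i <;> simp [nu, monomial, nuCode, ev_two, h6, h12, h24]

variable {α}

lemma one_add_ne_zero (hα1 : α ≠ 1) : 1 + α ≠ 0 := fun h =>
  hα1 (CharTwo.add_eq_zero.mp h).symm

lemma nu_ne_zero (hα0 : α ≠ 0) (hα1 : α ≠ 1) (i : Fin 15) : nu α i ≠ 0 := by
  have := one_add_ne_zero hα1
  fin_cases i <;> simp [nu, hα0, this]

lemma nu_div {i j k : Fin 15} (hα0 : α ≠ 0) (hα1 : α ≠ 1) (h : root i + root j = root k) :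
    nu α k / nu α j = ev α (monomial (nuCode k - nuCode j)) := by
  rw [div_eq_iff (nu_ne_zero hα0 hα1 j), nu_eq, nu_eq, ← ev_pmul, monomial_nuCode i j k h]

/-- The quotients of the `ν_i` become polynomials by `nu_div`; this is the point where `α ≠ 0, 1`
enters the description of the bracket. -/
lemma structConst_eq (hα0 : α ≠ 0) (hα1 : α ≠ 1) (a b k : Gen) :
    structConst α a b k = ev α (structCode a b k) := by
  have hblt : ∀ i j : Fin 15, Nat.blt i j = decide (i < j) := by decide +kernel
  have hbeq : ∀ i j : Fin 15, Nat.beq i j = decide (i = j) := by decide +kernel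
  have hbit : ∀ (i : Fin 15) (k : Fin 4), rootParity i k = 0 ∨ rootParity i k = 1 := by
    decide +kernel
  have h1 : ∀ i j k : Fin 15, (if i < j ∧ root i + root j = root k then (1 : K) else 0) =
      ev α (bif Nat.blt i j && (wtCode i + wtCode j == wtCode k + 46) then 1 else 0) := by
    intro i j k
    rw [hblt]
    by_cases hij : i < j
    · by_cases h : root i + root j = root k
      · simp [hij, h, (root_add_iff i j k).mp h]
      · have h' := mt (root_add_iff i j k).mpr h
        simp [h, h']
    · simp [hij]
  have h2 : ∀ (i k : Fin 15) (j : Fin 4), (if i = k then rootVal α i j else 0) =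
      ev α (bif Nat.beq i k then rootValCode i j else 0) := by
    intro i k j
    rw [hbeq]
    by_cases h : i = k
    · simp [h, rootVal_eq]
    · simp [h]
  have h3 : ∀ i j k : Fin 15, (if root i = root j + root k then nu α i / nu α k else 0) =
      ev α (bif wtCode j + wtCode k == wtCode i + 46 then monomial (nuCode i - nuCode k)
        else 0) := by
    intro i j k
    by_cases h : root j + root k = root i
    · simp [h, (root_add_iff j k i).mp h, nu_div hα0 hα1 h]
    · have h' := Bool.eq_false_iff.mpr (mt (root_add_iff j k i).mpr h)
      simp [h', Ne.symm h]
  rcases a with i | i | i <;> rcases b with j | j | j <;> rcases k with k | k | k <;>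
    simp only [structConst, structCode, h1, h2, h3, ev_zero]
  rw [hbeq]
  by_cases h : i = j
  · subst h
    rw [if_pos rfl, decide_eq_true rfl, cond_true, root_cast, nu_eq]
    rcases hbit i k with h | h <;> simp [h]
  · simp [h]

end Bridge

lemma structCode_check : (allBelow 34 fun a => allBelow 34 fun b =>
    allBelow 34 fun k =>
      Nat.xor (structCode (gen a) (gen b) (gen k)) (structCode (gen b) (gen a) (gen k)) ==
        coeffOf k (wkTable a b)) = true := by decide +kernel

lemma inRange_wkTable : InRange wkTable := by
  have h : (allBelow 34 fun a => allBelow 34 fun b =>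
      (wkTable a b).all fun t => Nat.blt t.1 34) = true := by decide +kernel
  intro a ha b hb t ht
  have := List.all_eq_true.mp (allBelow_apply (allBelow_apply h ha) hb) t ht
  simpa [Nat.blt_eq] using this

variable {K : Type*} [Field K] [CharP K 2] {α : K}

lemma isTable_wk4 (hα0 : α ≠ 0) (hα1 : α ≠ 1) : IsTable α (wk4 α) wkTable := by
  refine isTable_wedgeBracket α inRange_wkTable fun a b k => ?_
  have := allBelow_apply (allBelow_apply (allBelow_apply structCode_check (idx_lt a)) (idx_lt b)) (idx_lt k)
  rw [beq_iff_eq, gen_idx, gen_idx, gen_idx] at this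
  rw [structConst_eq hα0 hα1, structConst_eq hα0 hα1, ← ev_xor, this]


/-! ## Extension from the basis -/

section Extension

variable {K : Type*} [Field K]

lemma vec_eq_sum (u : Vec K) : u = ∑ g, u g • e g := by
  funext k
  simp [Finset.sum_apply, Pi.single_apply]

lemma vec_induction {p : Vec K → Prop} (hb : ∀ g, p (e g)) (h0 : p 0)
    (hadd : ∀ u v, p u → p v → p (u + v)) (hsmul : ∀ (c : K) u, p u → p (c • u)) (u : Vec K) :
    p u := by
  rw [vec_eq_sum u]
  exact Finset.sum_induction _ p hadd h0 fun g _ => hsmul _ _ (hb g)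

lemma bilin_expand (F : Vec K →ₗ[K] Vec K →ₗ[K] Vec K) (u v : Vec K) :
    F u v = ∑ a, ∑ b, (u a * v b) • F (e a) (e b) := by
  conv_lhs => rw [vec_eq_sum u, vec_eq_sum v]
  simp only [map_sum, map_smul, LinearMap.sum_apply, LinearMap.smul_apply, Finset.smul_sum,
    smul_smul]
  rw [Finset.sum_comm]
  exact Finset.sum_congr rfl fun a _ => Finset.sum_congr rfl fun b _ => by rw [mul_comm]

/-- The left-hand side of the Jacobi identity for a pair of brackets. -/
def jac (br br' : Vec K →ₗ[K] Vec K →ₗ[K] Vec K) (u v w : Vec K) : Vec K :=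
  br u (br' v w) + br v (br' w u) + br w (br' u v)

variable (br br' : Vec K →ₗ[K] Vec K →ₗ[K] Vec K)

lemma jac_rotate (u v w : Vec K) : jac br br' u v w = jac br br' v w u := by
  unfold jac; abel

lemma jac_add (u u' v w : Vec K) :
    jac br br' (u + u') v w = jac br br' u v w + jac br br' u' v w := by
  simp only [jac, map_add, LinearMap.add_apply]; abel

lemma jac_smul (c : K) (u v w : Vec K) : jac br br' (c • u) v w = c • jac br br' u v w := by
  simp only [jac, map_smul, LinearMap.smul_apply, smul_add]

/-- A symmetric bracket with `[u, u] = 0`. -/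
structure IsAlternating : Prop where
  symm : ∀ u v, br u v = br v u
  self : ∀ u, br u u = 0

variable {br br'}

lemma jac_swap (h : IsAlternating br') (u v w : Vec K) :
    jac br br' u v w = jac br br' v u w := by
  unfold jac
  rw [h.symm v w, h.symm w u, h.symm u v]; abel

variable [CharP K 2]

lemma vec_add_self (u : Vec K) : u + u = 0 := funext fun g => CharTwo.add_self_eq_zero (u g)

lemma vec_add_eq_zero {u v : Vec K} : u + v = 0 ↔ u = v :=
  ⟨fun h => funext fun g => CharTwo.add_eq_zero.mp (congrFun h g), fun h => h ▸ vec_add_self u⟩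

lemma jac_self (h : IsAlternating br') (u w : Vec K) : jac br br' u u w = 0 := by
  unfold jac
  rw [h.symm w u, h.self, map_zero, add_zero, vec_add_self]

/-- A sum of expressions `jac` vanishes if it vanishes on increasing triples of basis vectors. -/
lemma jac_ext {br₁ br₁' br₂ br₂' : Vec K →ₗ[K] Vec K →ₗ[K] Vec K} (h₁ : IsAlternating br₁')
    (h₂ : IsAlternating br₂')
    (h : ∀ a < 34, ∀ b < a, ∀ c < b, jac br₁ br₁' (e (gen a)) (e (gen b)) (e (gen c)) +
      jac br₂ br₂' (e (gen a)) (e (gen b)) (e (gen c)) = 0) (u v w : Vec K) :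
    jac br₁ br₁' u v w + jac br₂ br₂' u v w = 0 := by
  have hsw : ∀ u v w, jac br₁ br₁' u v w + jac br₂ br₂' u v w =
      jac br₁ br₁' v u w + jac br₂ br₂' v u w := fun u v w => by
    rw [jac_swap h₁, jac_swap h₂]
  have hrot : ∀ u v w, jac br₁ br₁' u v w + jac br₂ br₂' u v w =
      jac br₁ br₁' v w u + jac br₂ br₂' v w u := fun u v w => by
    rw [jac_rotate br₁, jac_rotate br₂]
  have hself : ∀ u w, jac br₁ br₁' u u w + jac br₂ br₂' u u w = 0 := fun u w => by
    rw [jac_self h₁, jac_self h₂, add_zero]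
  -- Triples with a repetition cost nothing, so weakly decreasing triples are covered too.
  have hord : ∀ a < 34, ∀ b < 34, ∀ c < 34, c ≤ b → b ≤ a →
      jac br₁ br₁' (e (gen a)) (e (gen b)) (e (gen c)) +
      jac br₂ br₂' (e (gen a)) (e (gen b)) (e (gen c)) = 0 := by
    intro a ha b _ c _ hcb hba
    rcases hba.eq_or_lt with rfl | hba
    · exact hself _ _
    rcases hcb.eq_or_lt with rfl | hcb
    · rw [hrot]; exact hself _ _
    exact h a ha b hba c hcb
  have hbasis : ∀ a < 34, ∀ b < 34, ∀ c < 34,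
      jac br₁ br₁' (e (gen a)) (e (gen b)) (e (gen c)) +
      jac br₂ br₂' (e (gen a)) (e (gen b)) (e (gen c)) = 0 := by
    intro a ha b hb c hc
    rcases le_total a b with hab | hab <;> rcases le_total b c with hbc | hbc <;>
      rcases le_total a c with hac | hac
    · rw [hsw, hrot, hrot]; exact hord c hc b hb a ha hab hbc
    · rw [hsw, hrot, hrot]; exact hord c hc b hb a ha hab hbc
    · rw [hrot]; exact hord b hb c hc a ha hac hbc
    · rw [hsw]; exact hord b hb a ha c hc hac hab
    · rw [hrot, hrot]; exact hord c hc a ha b hb hab hac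
    · rw [hsw, hrot]; exact hord a ha c hc b hb hbc hac
    · exact hord a ha b hb c hc hbc hab
    · exact hord a ha b hb c hc hbc hab
  -- Linearity is needed only in the first argument: rotation brings each of the others to that
  -- place.
  have step : ∀ v w, (∀ g, jac br₁ br₁' (e g) v w + jac br₂ br₂' (e g) v w = 0) →
      ∀ u, jac br₁ br₁' u v w + jac br₂ br₂' u v w = 0 := fun v w hg u => by
    refine vec_induction (p := fun u => jac br₁ br₁' u v w + jac br₂ br₂' u v w = 0) hg ?_ ?_ ?_ u
    · simp [jac]
    · intro u u' h h'
      rw [jac_add, jac_add, add_add_add_comm, h, h', add_zero]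
    · intro c u h
      rw [jac_smul, jac_smul, ← smul_add, h, smul_zero]
  refine step v w (fun g => ?_) u
  rw [hrot]
  refine step w (e g) (fun g' => ?_) v
  rw [hrot]
  refine step (e g) (e g') (fun g'' => ?_) w
  rw [← gen_idx g, ← gen_idx g', ← gen_idx g'']
  exact hbasis _ (idx_lt _) _ (idx_lt _) _ (idx_lt _)

lemma isAlternating_wedgeBracket (s : Gen → Gen → Gen → K) : IsAlternating (wedgeBracket s) where
  symm u v := by
    simp only [wedgeBracket, LinearMap.add_apply, LinearMap.flip_apply, add_comm]
  self u := by
    simp only [wedgeBracket, LinearMap.add_apply, LinearMap.flip_apply, vec_add_self]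

lemma jac_eq_zero (h : IsAlternating br') {α : K} {P Q : ℕ → ℕ → List (ℕ × ℕ)}
    (hP : IsTable α br P) (hQ : IsTable α br' Q) (hr : InRange Q) (hc : jacCheck P Q = true)
    (u v w : Vec K) : jac br br' u v w = 0 := by
  have h0 : IsAlternating (0 : Vec K →ₗ[K] Vec K →ₗ[K] Vec K) := ⟨by simp, by simp⟩
  have := jac_ext (br₁ := br) (br₂ := 0) h h0 (fun a ha b hb c hc' => ?_) u v w
  · simpa [jac] using this
  · have hl := allBelow_apply (allBelow_apply (allBelow_apply hc ha) hb) hc'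
    rw [jac, hP.jac hQ hr ha (hb.trans ha) ((hc'.trans hb).trans ha), den_eq_zero α hl]
    simp [jac]

end Extension

/-! ## Parity -/

section Parity

variable {K : Type*} [Field K]

/-- The homogeneous vectors of the given parity. -/
abbrev parityPart (K : Type*) [Field K] (i : ℤ) : Submodule K (Vec K) :=
  vanishing K fun g => ¬ (wt g 0 % 2 = i)

/-- A bilinear map that respects parity on the basis vectors. -/
def RespectsParity (F : Vec K →ₗ[K] Vec K →ₗ[K] Vec K) : Prop :=
  ∀ a b, F (e a) (e b) ∈ parityPart K ((wt a 0 + wt b 0) % 2)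

lemma RespectsParity.mem {F : Vec K →ₗ[K] Vec K →ₗ[K] Vec K} (hF : RespectsParity F)
    {i j : ℤ} {u v : Vec K} (hu : u ∈ parityPart K i) (hv : v ∈ parityPart K j) :
    F u v ∈ parityPart K ((i + j) % 2) := by
  rw [bilin_expand]
  refine Submodule.sum_mem _ fun a _ => Submodule.sum_mem _ fun b _ => ?_
  by_cases ha : wt a 0 % 2 = i
  · by_cases hb : wt b 0 % 2 = j
    · have h := hF a b
      rw [Int.add_emod, ha, hb] at h
      exact Submodule.smul_mem _ _ h
    · rw [hv b hb, mul_zero, zero_smul]; exact Submodule.zero_mem _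
  · rw [hu a ha, zero_mul, zero_smul]; exact Submodule.zero_mem _

variable (α : K)

lemma evenPart_eq : (bgl4 α).evenPart = parityPart K 0 := by
  ext u
  refine forall_congr' fun g => ?_
  dsimp only
  have : g.IsOdd ↔ ¬ (wt g 0 % 2 = 0) := by unfold Gen.IsOdd; omega
  rw [this]

lemma isCompl_parts : IsCompl (bgl4 α).evenPart (bgl4 α).oddPart := by
  classical
  constructor
  · rw [Submodule.disjoint_def]
    intro u hu hv
    funext g
    by_cases h : g.IsOdd
    · exact hu g h
    · exact hv g h
  · rw [codisjoint_iff, eq_top_iff]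
    intro u _
    rw [Submodule.mem_sup]
    refine ⟨fun g => if g.IsOdd then 0 else u g, fun g hg => if_pos hg,
      fun g => if g.IsOdd then u g else 0, fun g hg => if_neg hg, ?_⟩
    funext g
    by_cases h : g.IsOdd <;> simp [h]

variable {α}

lemma e_mem_oddPart {g : Gen} (h : g.IsOdd) : (e g : Vec K) ∈ (bgl4 α).oddPart := by
  intro g' hg'
  have : g' ≠ g := fun h' => hg' (h' ▸ h)
  simp [this]

/-- A map on the odd part that is additive, homogeneous of degree 2 and zero on the basis vectors
vanishes. -/
lemma sq_ext {G : (bgl4 α).oddPart → Vec K} (hadd : ∀ x y, G (x + y) = G x + G y)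
    (hsmul : ∀ (c : K) x, G (c • x) = (c * c) • G x)
    (hb : ∀ (x : (bgl4 α).oddPart) (g : Gen), (x : Vec K) = e g → G x = 0)
    (x : (bgl4 α).oddPart) : G x = 0 := by
  classical
  have hx : x = ∑ g, (x : Vec K) g • (if h : g.IsOdd then
      (⟨e g, e_mem_oddPart h⟩ : (bgl4 α).oddPart) else 0) := by
    apply Subtype.ext
    rw [AddSubmonoidClass.coe_finsetSum]
    conv_lhs => rw [vec_eq_sum (x : Vec K)]
    refine Finset.sum_congr rfl fun g _ => ?_
    by_cases h : g.IsOdd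
    · simp [h]
    · simp [h, x.2 g h]
  have h0 : G 0 = 0 := by simpa using hsmul 0 0
  let G' : (bgl4 α).oddPart →+ Vec K := { toFun := G, map_zero' := h0, map_add' := hadd }
  change G' x = 0
  rw [hx, map_sum]
  refine Finset.sum_eq_zero fun g _ => ?_
  change G _ = 0
  rw [hsmul]
  by_cases h : g.IsOdd
  · rw [dif_pos h, hb _ g rfl, smul_zero]
  · rw [dif_neg h, h0, smul_zero]

lemma wedgeSq_apply (s : Gen → Gen → Gen → K) (x : (bgl4 α).oddPart) :
    wedgeSq s _ x = bilinOf s x x := rfl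

lemma wedgeSq_add (s : Gen → Gen → Gen → K) (x y : (bgl4 α).oddPart) :
    wedgeSq s _ (x + y) = wedgeSq s _ x + wedgeSq s _ y + wedgeBracket s x y := by
  simp only [wedgeSq_apply, Submodule.coe_add, map_add, LinearMap.add_apply, wedgeBracket,
    LinearMap.flip_apply]
  abel

lemma wedgeSq_e (s : Gen → Gen → Gen → K) {x : (bgl4 α).oddPart} {g : Gen}
    (h : (x : Vec K) = e g) : wedgeSq s _ x = s g g := by
  rw [wedgeSq_apply, h, bilinOf_e]

lemma respectsParity_bilinOf {s : Gen → Gen → Gen → K}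
    (h : ∀ a b k, s a b k ≠ 0 → wt k 0 % 2 = (wt a 0 + wt b 0) % 2) :
    RespectsParity (bilinOf s) := by
  intro a b k hk
  rw [bilinOf_e]
  by_contra hne
  exact hk (h a b k hne)

lemma RespectsParity.wedge {s : Gen → Gen → Gen → K} (h : RespectsParity (bilinOf s)) :
    RespectsParity (wedgeBracket s) := by
  intro a b
  rw [wedgeBracket, LinearMap.add_apply, LinearMap.add_apply, LinearMap.flip_apply]
  refine Submodule.add_mem _ (h a b) ?_
  rw [add_comm]
  exact h b a

lemma RespectsParity.wedgeSq_mem {s : Gen → Gen → Gen → K} (h : RespectsParity (bilinOf s))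
    (x : (bgl4 α).oddPart) : wedgeSq s _ x ∈ (bgl4 α).evenPart := by
  rw [evenPart_eq, wedgeSq_apply]
  exact h.mem (i := 1) (j := 1) x.2 x.2

end Parity

/-! ### Assembling the axioms of a Lie superalgebra. -/

section Superalgebra

variable {K : Type*} [Field K] [CharP K 2] {α : K}

omit [CharP K 2] in
lemma isLieBracket_of_jac {br : Vec K →ₗ[K] Vec K →ₗ[K] Vec K} (h : IsAlternating br)
    (hj : ∀ u v w, jac br br u v w = 0) : IsLieBracket br where
  alternating := h.self
  jacobi := hj

lemma IsLieBracket.lie_lie {br : Vec K →ₗ[K] Vec K →ₗ[K] Vec K} (h : IsAlternating br)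
    (hb : IsLieBracket br) (u v w : Vec K) :
    br (br u v) w = br u (br v w) + br v (br u w) := by
  rw [h.symm (br u v) w, h.symm u w, ← vec_add_eq_zero, add_comm]
  exact hb.jacobi u v w

/-- A bracket and a squaring on the superspace of `bgl4`. -/
lemma isLieSuperalgebra_of {L : SuperAlg K (Vec K)} (he : L.evenPart = (bgl4 α).evenPart)
    (ho : L.oddPart = (bgl4 α).oddPart) (halt : IsAlternating L.bracket)
    (hlie : IsLieBracket L.bracket) (hpar : RespectsParity L.bracket)
    (hsq : ∀ x, L.sq x ∈ L.evenPart)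
    (hadd : ∀ x y : L.oddPart, L.sq (x + y) = L.sq x + L.sq y + L.bracket x y)
    (hbr : ∀ (x : L.oddPart) (v : Vec K), L.bracket (L.sq x) v = L.bracket x (L.bracket x v)) :
    L.IsLieSuperalgebra := by
  have hee : L.evenPart = parityPart K 0 := he.trans (evenPart_eq α)
  have hoo : L.oddPart = parityPart K 1 := ho
  refine ⟨he ▸ ho ▸ isCompl_parts α, ?_, ?_, ?_, halt.symm, fun u _ => halt.self u,
    fun u _ v _ w => hlie.lie_lie halt u v w, hsq, hadd, hbr⟩
  · rw [hee]; exact fun u hu v hv => hpar.mem hu hv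
  · rw [hee, hoo]; exact fun u hu v hv => hpar.mem hu hv
  · rw [hee, hoo]; exact fun u hu v hv => hpar.mem hu hv

lemma isAlternating_wk4 : IsAlternating (wk4 α) := isAlternating_wedgeBracket _

variable (hα0 : α ≠ 0) (hα1 : α ≠ 1)
include hα0 hα1

lemma isLieBracket_wk4 : IsLieBracket (wk4 α) :=
  have hT := isTable_wk4 hα0 hα1
  isLieBracket_of_jac isAlternating_wk4
    (jac_eq_zero isAlternating_wk4 hT hT inRange_wkTable jacCheck_wkTable)

end Superalgebra

/-! ## Squarings -/

section Squaring

/-- Whether the basis vector with the given number is odd. -/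
def oddCode (a : ℕ) : Bool := !isCartan a && rootParity (absIdx a) 0 == 1

lemma oddCode_iff : ∀ a < 34, (gen a).IsOdd ↔ oddCode a = true := by
  unfold Gen.IsOdd
  decide +kernel

variable {K : Type*} [Field K] {α : K}

/-- The defect of the identity `[x², v] = [x, [x, v]]`, linearized. -/
def sqDefect (s t : Gen → Gen → Gen → K) (x : (bgl4 α).oddPart) (v : Vec K) :
    Vec K :=
  wedgeBracket s (wedgeSq t _ x) v + wedgeBracket s x (wedgeBracket t x v)

lemma sqDefect_smul (s t : Gen → Gen → Gen → K) (c : K) (x : (bgl4 α).oddPart) (v : Vec K) :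
    sqDefect s t (c • x) v = (c * c) • sqDefect s t x v := by
  simp only [sqDefect, wedgeSq_apply, Submodule.coe_smul, map_smul, LinearMap.smul_apply, smul_smul,
    smul_add]

variable [CharP K 2]

/-- The polarization of the squaring identity is the Jacobi identity. Once the latter is known, the
defect is additive in the odd argument. -/
lemma sqDefect_add (s t : Gen → Gen → Gen → K) (x y : (bgl4 α).oddPart) (v : Vec K) :
    sqDefect s t (x + y) v = sqDefect s t x v + sqDefect s t y v +
      jac (wedgeBracket s) (wedgeBracket t) x y v := by
  rw [jac, (isAlternating_wedgeBracket t).symm v x,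
    (isAlternating_wedgeBracket s).symm v]
  simp only [sqDefect, wedgeSq_add, Submodule.coe_add, map_add, LinearMap.add_apply]
  abel

/-- Two pairs of coefficients occur so that one lemma serves both a single bracket, with the second
pair zero, and the linearized identity, in which bracket and cocycle exchange roles. -/
lemma sqDefect_eq_zero {s₁ t₁ s₂ t₂ : Gen → Gen → Gen → K}
    (hj : ∀ u v w, jac (wedgeBracket s₁) (wedgeBracket t₁) u v w +
      jac (wedgeBracket s₂) (wedgeBracket t₂) u v w = 0)
    (hb : ∀ a < 34, oddCode a = true → ∀ b < 34,
      wedgeBracket s₁ (t₁ (gen a) (gen a)) (e (gen b)) +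
        wedgeBracket s₁ (e (gen a)) (wedgeBracket t₁ (e (gen a)) (e (gen b))) +
      (wedgeBracket s₂ (t₂ (gen a) (gen a)) (e (gen b)) +
        wedgeBracket s₂ (e (gen a)) (wedgeBracket t₂ (e (gen a)) (e (gen b)))) = 0)
    (x : (bgl4 α).oddPart) (v : Vec K) : sqDefect s₁ t₁ x v + sqDefect s₂ t₂ x v = 0 := by
  refine sq_ext (G := fun x => sqDefect s₁ t₁ x v + sqDefect s₂ t₂ x v) ?_ ?_ ?_ x
  · intro x y
    rw [sqDefect_add, sqDefect_add, add_add_add_comm, hj, add_zero]; abel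
  · intro c x
    rw [sqDefect_smul, sqDefect_smul, smul_add]
  · intro x g hx
    have hodd : g.IsOdd := by
      by_contra hne
      simpa [hx] using x.2 g hne
    refine vec_induction (p := fun v => sqDefect s₁ t₁ x v + sqDefect s₂ t₂ x v = 0)
      ?_ ?_ ?_ ?_ v
    · intro g'
      have := hb (idx g) (idx_lt g) ((oddCode_iff _ (idx_lt g)).mp (by rwa [gen_idx]))
        (idx g') (idx_lt g')
      rw [gen_idx, gen_idx] at this
      rw [← this, sqDefect, sqDefect, wedgeSq_e _ hx, wedgeSq_e _ hx, hx]
    · simp [sqDefect]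
    · intro u u' h h'
      have : sqDefect s₁ t₁ x (u + u') + sqDefect s₂ t₂ x (u + u') =
          sqDefect s₁ t₁ x u + sqDefect s₂ t₂ x u +
            (sqDefect s₁ t₁ x u' + sqDefect s₂ t₂ x u') := by
        simp only [sqDefect, map_add]; abel
      rw [this, h, h', add_zero]
    · intro c u h
      have : sqDefect s₁ t₁ x (c • u) + sqDefect s₂ t₂ x (c • u) =
          c • (sqDefect s₁ t₁ x u + sqDefect s₂ t₂ x u) := by
        simp only [sqDefect, map_smul, smul_add]
      rw [this, h, smul_zero]

/-- The formal version of `sqDefect` on basis vectors; `d` is the square of the odd one. -/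
def sqList (P Q : ℕ → ℕ → List (ℕ × ℕ)) (d : List (ℕ × ℕ)) (a b : ℕ) : List (ℕ × ℕ) :=
  act P b d ++ act P a (Q a b)

lemma sqList_eq {s t : Gen → Gen → Gen → K} {P Q : ℕ → ℕ → List (ℕ × ℕ)} {d : List (ℕ × ℕ)}
    (hP : IsTable α (wedgeBracket s) P) (hQ : IsTable α (wedgeBracket t) Q) (hr : InRange Q)
    (hd : ∀ t ∈ d, t.1 < 34) {a b : ℕ} (ha : a < 34) (hb : b < 34)
    (h : t (gen a) (gen a) = den α d) :
    wedgeBracket s (t (gen a) (gen a)) (e (gen b)) +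
      wedgeBracket s (e (gen a)) (wedgeBracket t (e (gen a)) (e (gen b))) =
      den α (sqList P Q d a b) := by
  rw [h, (isAlternating_wedgeBracket s).symm, hP.act hb hd, hQ a ha b hb,
    hP.act ha (hr a ha b hb), sqList, den_append]

end Squaring

/-- Odd root vectors are to have square zero, so their adjoint maps must square to zero. -/
lemma wk4_sq_check : (allBelow 34 fun a => !oddCode a || allBelow 34 fun b =>
    isZero (act wkTable a (wkTable a b))) = true := by
  decide +kernel

lemma respectsParity_structCode : (allBelow 34 fun a => allBelow 34 fun b =>
    allBelow 34 fun k => structCode (gen a) (gen b) (gen k) == 0 ||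
      oddCode k == Bool.xor (oddCode a) (oddCode b)) = true := by decide +kernel

/-! ### The Lie superalgebra `bgl4`. -/

section Superalgebra

variable {K : Type*} [Field K] [CharP K 2] {α : K} (hα0 : α ≠ 0) (hα1 : α ≠ 1)

lemma parity_of_oddCode : ∀ g : Gen, wt g 0 % 2 = bif oddCode (idx g) then 1 else 0 := by
  rw [forall_gen]
  decide +kernel

lemma parity_add {a b k : Gen}
    (h : oddCode (idx k) = Bool.xor (oddCode (idx a)) (oddCode (idx b))) :
    wt k 0 % 2 = (wt a 0 + wt b 0) % 2 := by
  rw [Int.add_emod, parity_of_oddCode, parity_of_oddCode a, parity_of_oddCode b, h]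
  cases oddCode (idx a) <;> cases oddCode (idx b) <;> rfl

include hα0 hα1

lemma respectsParity_structConst : RespectsParity (bilinOf (structConst α)) := by
  refine respectsParity_bilinOf fun a b k hne => ?_
  have := allBelow_apply (allBelow_apply (allBelow_apply respectsParity_structCode (idx_lt a)) (idx_lt b)) (idx_lt k)
  rw [gen_idx, gen_idx, gen_idx, Bool.or_eq_true, beq_iff_eq, beq_iff_eq] at this
  rcases this with h | h
  · rw [structConst_eq hα0 hα1, h, ev_zero] at hne
    exact absurd rfl hne
  · exact parity_add h

lemma structConst_self (a : Gen) : structConst α a a = 0 := by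
  funext k
  rw [structConst_eq hα0 hα1]
  have : ∀ a : Gen, ∀ k : Gen, structCode a a k = 0 := by
    rw [forall_gen]
    intro a ha
    rw [forall_gen]
    revert a
    decide +kernel
  rw [this, ev_zero]; rfl

lemma jac_wk4 (u v w : Vec K) : jac (wk4 α) (wk4 α) u v w = 0 :=
  (isLieBracket_wk4 hα0 hα1).jacobi u v w

lemma sqDefect_structConst (x : (bgl4 α).oddPart) (v : Vec K) :
    sqDefect (structConst α) (structConst α) x v = 0 := by
  have h0 : wedgeBracket (0 : Gen → Gen → Gen → K) = 0 := by
    ext a b k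
    simp [wedgeBracket_e]
  have hT := isTable_wk4 hα0 hα1
  have := sqDefect_eq_zero (α := α) (s₁ := structConst α) (t₁ := structConst α) (s₂ := 0) (t₂ := 0)
    ?_ ?_ x v
  · simpa [sqDefect, h0] using this
  · intro u v w
    rw [h0]
    have hz : jac 0 0 u v w = 0 := by simp [jac]
    rw [hz, add_zero]
    exact jac_wk4 hα0 hα1 u v w
  · intro a ha hodd b hb
    rw [h0, structConst_self hα0 hα1]
    have hc := allBelow_apply (wk4_sq_check) ha
    rw [hodd, Bool.not_true, Bool.false_or] at hc
    change wk4 α _ _ + wk4 α _ (wk4 α _ _) + _ = _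
    rw [hT a ha b hb, hT.act ha (inRange_wkTable a ha b hb), den_eq_zero α (allBelow_apply hc hb)]
    simp

lemma isLieSuperalgebra_bgl4 : (bgl4 α).IsLieSuperalgebra := by
  have hpar := respectsParity_structConst hα0 hα1
  refine isLieSuperalgebra_of (α := α) rfl rfl isAlternating_wk4 (isLieBracket_wk4 hα0 hα1)
    hpar.wedge hpar.wedgeSq_mem (wedgeSq_add _) fun x v => ?_
  exact vec_add_eq_zero.mp (sqDefect_structConst hα0 hα1 x v)

end Superalgebra

/-! ## The Cartan matrix -/

/-- The indices of two root vectors whose bracket is the given one. -/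
def parents (k : ℕ) : ℕ × ℕ :=
  [(0, 0), (0, 0), (0, 0), (0, 0), (0, 1), (0, 2), (2, 3), (2, 4), (3, 5), (4, 5), (4, 6), (4, 8),
    (7, 8), (8, 9), (9, 10)].getD k (0, 0)

lemma parents_check : (allBelow 15 fun k => Nat.blt k 4 ||
    (Nat.blt (parents k).1 k && Nat.blt (parents k).2 k &&
      (wkTable (parents k).1 (parents k).2 == [(k, 1)] &&
      wkTable ((parents k).1 + 19) ((parents k).2 + 19) == [(k + 19, 1)]))) = true := by
  decide +kernel

section Cartan

variable {K : Type*} [Field K] [CharP K 2] {α : K} (hα0 : α ≠ 0) (hα1 : α ≠ 1)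
include hα0 hα1

lemma wk4_eq_single {a b k : ℕ} (ha : a < 34) (hb : b < 34) (h : wkTable a b = [(k, 1)]) :
    wk4 α (e (gen a)) (e (gen b)) = e (gen k) := by
  rw [isTable_wk4 hα0 hα1 a ha b hb, h]
  simp

lemma parents_spec {k : ℕ} (hk : k < 15) (hk' : 4 ≤ k) :
    (parents k).1 < k ∧ (parents k).2 < k ∧
    wk4 α (e (gen (parents k).1)) (e (gen (parents k).2)) = e (gen k) ∧
    wk4 α (e (gen ((parents k).1 + 19))) (e (gen ((parents k).2 + 19))) = e (gen (k + 19)) := by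
  have h := allBelow_apply parents_check hk
  have h4 : Nat.blt k 4 = false := by
    rw [Bool.eq_false_iff, ne_eq, Nat.blt_eq]; omega
  rw [h4, Bool.false_or, Bool.and_eq_true, Bool.and_eq_true, Bool.and_eq_true, beq_iff_eq,
    beq_iff_eq, Nat.blt_eq, Nat.blt_eq] at h
  obtain ⟨⟨h1, h2⟩, h3, h4⟩ := h
  exact ⟨h1, h2, wk4_eq_single hα0 hα1 (by omega) (by omega) h3,
    wk4_eq_single hα0 hα1 (by omega) (by omega) h4⟩

omit [CharP K 2] hα0 hα1 in
lemma chevalleyRelations_of {V : Type*} [AddCommGroup V] [Module K V] {br : V →ₗ[K] V →ₗ[K] V}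
    {x : ℕ → V} (h5 : br (x 1) (x 2) = x 5) (h6 : br (x 1) (x 3) = x 6) (h7 : br (x 3) (x 4) = x 7)
    (h8 : br (x 3) (x 5) = x 8) (h9 : br (x 4) (x 6) = x 9) (h10 : br (x 5) (x 6) = x 10)
    (h11 : br (x 5) (x 7) = x 11) (h12 : br (x 5) (x 9) = x 12) (h13 : br (x 8) (x 9) = x 13)
    (h14 : br (x 9) (x 10) = x 14) (h15 : br (x 10) (x 11) = x 15) : ChevalleyRelations br x := by
  unfold ChevalleyRelations
  rw [h5, h6, h7, h8, h9, h10, h11, h12, h13, h14, h15]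
  simp only [and_self]

lemma chevalleyRelations_x : ChevalleyRelations (wk4 α) fun n => e (X n) := by
  have h : ∀ k, k < 15 → 4 ≤ k → _ := fun k hk hk' => (parents_spec hα0 hα1 hk hk').2.2.1
  exact chevalleyRelations_of (h 4 (by omega) (by omega)) (h 5 (by omega) (by omega))
    (h 6 (by omega) (by omega)) (h 7 (by omega) (by omega)) (h 8 (by omega) (by omega))
    (h 9 (by omega) (by omega)) (h 10 (by omega) (by omega)) (h 11 (by omega) (by omega))
    (h 12 (by omega) (by omega)) (h 13 (by omega) (by omega)) (h 14 (by omega) (by omega))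

lemma chevalleyRelations_y : ChevalleyRelations (wk4 α) fun n => e (Y n) := by
  have h : ∀ k, k < 15 → 4 ≤ k → _ := fun k hk hk' => (parents_spec hα0 hα1 hk hk').2.2.2
  exact chevalleyRelations_of (h 4 (by omega) (by omega)) (h 5 (by omega) (by omega))
    (h 6 (by omega) (by omega)) (h 7 (by omega) (by omega)) (h 8 (by omega) (by omega))
    (h 9 (by omega) (by omega)) (h 10 (by omega) (by omega)) (h 11 (by omega) (by omega))
    (h 12 (by omega) (by omega)) (h 13 (by omega) (by omega)) (h 14 (by omega) (by omega))

/-- A subspace closed under the bracket that contains the generators is everything. -/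
lemma generate_wk4 (S : Submodule K (Vec K)) (hx : ∀ i : Fin 4, e (X (i + 1)) ∈ S)
    (hh : ∀ i : Fin 4, e (.h i) ∈ S) (hy : ∀ i : Fin 4, e (Y (i + 1)) ∈ S)
    (hS : ∀ u ∈ S, ∀ v ∈ S, wk4 α u v ∈ S) : S = ⊤ := by
  have key : ∀ k < 15, e (gen k) ∈ S ∧ e (gen (k + 19)) ∈ S := by
    intro k
    induction k using Nat.strong_induction_on with
    | _ k ih =>
      intro hk
      by_cases h4 : k < 4
      · have h1 : ∀ k < 4, gen k = X (k + 1) ∧ gen (k + 19) = Y (k + 1) := by decide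
        rw [(h1 k h4).1, (h1 k h4).2]
        exact ⟨hx ⟨k, h4⟩, hy ⟨k, h4⟩⟩
      · obtain ⟨h1, h2, h3, h4⟩ := parents_spec hα0 hα1 hk (not_lt.mp h4)
        have hi := ih _ h1 (h1.trans hk)
        have hj := ih _ h2 (h2.trans hk)
        exact ⟨h3 ▸ hS _ hi.1 _ hj.1, h4 ▸ hS _ hi.2 _ hj.2⟩
  rw [eq_top_iff]
  intro u _
  refine vec_induction (p := fun u => u ∈ S) ?_ S.zero_mem (fun _ _ => S.add_mem)
    (fun c _ => S.smul_mem c) u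
  rintro (i | i | i)
  · have : gen i = .x i := gen_idx (.x i)
    exact this ▸ (key i i.2).1
  · exact hh i
  · have : gen (i + 19) = .y i := by rw [add_comm]; exact gen_idx (.y i)
    exact this ▸ (key i i.2).2

omit hα0 hα1 in
-- Only the coordinate `g` of `u` can contribute, since no other basis vector has a bracket with `e
-- (gen b)` that involves `gen r`. The lemma serves to transfer vanishing from the coordinate of a
-- bracket to the coordinate of `u`.
lemma wk4_apply_root {P : ℕ → ℕ → List (ℕ × ℕ)} {br : Vec K →ₗ[K] Vec K →ₗ[K] Vec K}
    (hP : IsTable α br P) (hr : InRange P) {g b r : ℕ} (hb : b < 34) (hg : g < 34) (hrr : r < 34)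
    (h : (allBelow 34 fun l => l == g || coeffOf r (P l b) == 0) = true) (u : Vec K) :
    br u (e (gen b)) (gen r) = u (gen g) * ev α (coeffOf r (P g b)) := by
  conv_lhs => rw [vec_eq_sum u]
  rw [map_sum, LinearMap.sum_apply, Finset.sum_apply, Finset.sum_eq_single (gen g)]
  · rw [map_smul, LinearMap.smul_apply, Pi.smul_apply, hP g hg b hb,
      den_apply α (hr g hg b hb), idx_gen hrr, smul_eq_mul]
  · intro l _ hl
    have := allBelow_apply h (idx_lt l)
    rw [Bool.or_eq_true, beq_iff_eq, beq_iff_eq] at this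
    rcases this with h' | h'
    · exact absurd (by rw [← h', gen_idx]) hl
    · rw [← gen_idx l, map_smul, LinearMap.smul_apply, Pi.smul_apply, hP _ (idx_lt l) b hb,
        den_apply α (hr _ (idx_lt l) b hb), idx_gen hrr, h', ev_zero, smul_zero]
  · simp

end Cartan

/-- The polynomials `α^i (1 + α)^j` of low degree. -/
def isUnit (c : ℕ) : Bool :=
  c == 1 || c == 2 || c == 3 || c == 4 || c == 5 || c == 6 || c == 8 || c == 10 || c == 12 ||
    c == 15 || c == 20 || c == 24 || c == 30 || c == 40 || c == 48

/-- The source of invertibility for all eliminations below: every admissible pivot is a product of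
powers of `α` and `1 + α`. -/
lemma ev_ne_zero {K : Type*} [Field K] [CharP K 2] {α : K} (hα0 : α ≠ 0) (hα1 : α ≠ 1) {c : ℕ}
    (h : isUnit c = true) : ev α c ≠ 0 := by
  have h2 : ev α 2 ≠ 0 := by rwa [ev_two]
  have h3 : ev α 3 ≠ 0 := by rw [ev_three]; exact one_add_ne_zero hα1
  have h4 := mul_ne_zero h2 h2
  have h5 := mul_ne_zero h3 h3
  have h6 := mul_ne_zero h2 h3
  have h8 := mul_ne_zero h4 h2
  have h10 := mul_ne_zero h2 h5
  have h12 := mul_ne_zero h4 h3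
  have h15 := mul_ne_zero h5 h3
  have h20 := mul_ne_zero h4 h5
  have h24 := mul_ne_zero h8 h3
  have h30 := mul_ne_zero h2 h15
  have h40 := mul_ne_zero h8 h5
  have h48 := mul_ne_zero (mul_ne_zero h8 h2) h3
  simp only [← ev_pmul] at *
  simp only [isUnit, Bool.or_eq_true, beq_iff_eq] at h
  rcases h with (((((((((((((h | h) | h) | h) | h) | h) | h) | h) | h) | h) | h) | h) | h) | h) | h <;>
    subst h <;> first | (rw [ev_one]; exact one_ne_zero) | assumption

/-- Steps `(g, b, r)`: the coordinate `r` of `[u, e_b]` is a unit times the coordinate `g`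
of `u`. -/
def idealSteps : List (ℕ × ℕ × ℕ) :=
  [(32, 20, 33), (31, 23, 33), (30, 26, 33), (29, 28, 33), (28, 29, 33), (26, 30, 33),
    (23, 31, 33), (20, 32, 33), (27, 28, 32), (24, 30, 32), (19, 31, 32), (1, 33, 32),
    (25, 28, 31), (21, 30, 31), (0, 32, 31), (4, 33, 31), (22, 28, 30), (2, 31, 30), (5, 32, 30),
    (7, 33, 30), (9, 33, 29), (3, 30, 28), (6, 31, 28), (8, 32, 28), (10, 33, 28), (11, 33, 26),
    (12, 33, 23), (13, 33, 20), (14, 32, 1)]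

/-- Each step starts from a coordinate that is known to vanish. -/
def idealCheck : List ℕ → List (ℕ × ℕ × ℕ) → Bool
  | done, [] => allBelow 34 fun a => isCartan a || done.contains a
  | done, t :: l => done.contains t.2.2 && (Nat.blt t.1 34 && (Nat.blt t.2.1 34 &&
      (Nat.blt t.2.2 34 && (isUnit (coeffOf t.2.2 (wkTable t.1 t.2.1)) &&
      ((allBelow 34 fun l => l == t.1 || coeffOf t.2.2 (wkTable l t.2.1) == 0) &&
        idealCheck (t.1 :: done) l)))))

lemma idealCheck_idealSteps : idealCheck [33] idealSteps = true := by decide +kernel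

/-- The number 48 codes `α⁴(1 + α)`: here `[x_15, y_15] = α³(1 + α)(h_1 + h_4)`, the bracket of this
with `x_2` contributes a factor `α`, and `[x_1, x_2] = x_5`. All basis vectors other than `y_15` are
annihilated. -/
lemma ideal_head_check : (allBelow 34 fun g =>
    isZero (act wkTable 0 (act wkTable 1 (wkTable 14 g)) ++ single 4 (bif g == 33 then 48 else 0)))
    = true := by decide +kernel

/-! ### Ideals that meet the span of the `h_i` trivially. -/

section Ideal

variable {K : Type*} [Field K] [CharP K 2] {α : K} (hα0 : α ≠ 0) (hα1 : α ≠ 1)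
include hα0 hα1

/-- An ideal contains the brackets of its elements with basis vectors. If a coordinate vanishes on
the ideal, each step of the list thus forces one more coordinate to vanish. -/
lemma ideal_coord {I : Submodule K (Vec K)} (hI : ∀ u ∈ I, ∀ v, wk4 α u v ∈ I) :
    ∀ (l : List (ℕ × ℕ × ℕ)) (done : List ℕ), (∀ r ∈ done, ∀ u ∈ I, u (gen r) = 0) →
      idealCheck done l = true → ∀ a < 34, isCartan a = false → ∀ u ∈ I, u (gen a) = 0
  | [], done, hd, h, a, ha, hc, u, hu => by
    have := allBelow_apply h ha
    rw [hc, Bool.false_or, List.contains_iff_mem] at this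
    exact hd a this u hu
  | t :: l, done, hd, h, a, ha, hc, u, hu => by
    rw [idealCheck] at h
    simp only [Bool.and_eq_true, List.contains_iff_mem, Nat.blt_eq] at h
    obtain ⟨h1, h2, h3, h4, h5, h6, h7⟩ := h
    refine ideal_coord hI l (t.1 :: done) (fun r hr v hv => ?_) h7 a ha hc u hu
    rcases List.mem_cons.mp hr with rfl | hr
    · have := wk4_apply_root (isTable_wk4 hα0 hα1) inRange_wkTable h3 h2 h4 h6 v
      rw [hd _ h1 _ (hI v hv _)] at this
      exact (mul_eq_zero.mp this.symm).resolve_right (ev_ne_zero hα0 hα1 h5)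
    · exact hd r hr v hv

lemma ideal_head (u : Vec K) : wk4 α (e (gen 0)) (wk4 α (e (gen 1)) (wk4 α (e (gen 14)) u)) =
    (u (gen 33) * ev α 48) • e (gen 4) := by
  have hT := isTable_wk4 hα0 hα1
  refine vec_induction (p := fun u => wk4 α (e (gen 0)) (wk4 α (e (gen 1))
    (wk4 α (e (gen 14)) u)) = (u (gen 33) * ev α 48) • e (gen 4)) ?_ ?_ ?_ ?_ u
  · rw [forall_gen]
    intro g hg
    have h1 : ∀ t ∈ wkTable 14 g, t.1 < 34 := inRange_wkTable 14 (by omega) g hg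
    have h2 : ∀ t ∈ act wkTable 1 (wkTable 14 g), t.1 < 34 := by
      have : (allBelow 34 fun g => (act wkTable 1 (wkTable 14 g)).all
        fun t => Nat.blt t.1 34) = true := by decide +kernel
      intro t ht
      simpa [Nat.blt_eq] using List.all_eq_true.mp (allBelow_apply this hg) t ht
    rw [hT 14 (by omega) g hg, hT.act (by omega) h1, hT.act (by omega) h2]
    have := den_eq_zero α (allBelow_apply ideal_head_check hg)
    rw [den_append, vec_add_eq_zero] at this
    rw [this]
    have h3 : ∀ g < 34, (gen 33 = gen g) ↔ g = 33 := by decide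
    by_cases h : g = 33
    · subst h; simp
    · have : gen 33 ≠ gen g := fun h' => h ((h3 g hg).mp h')
      simp [beq_false_of_ne h, this]
  · simp
  · intro u v hu hv
    simp only [map_add, hu, hv, Pi.add_apply, add_mul, add_smul]
  · intro c u hu
    simp only [map_smul, hu, Pi.smul_apply, smul_eq_mul, smul_smul, mul_assoc]

/-- If some element of the ideal had a nonzero `y_15`-coordinate, the ideal would contain `x_5`,
hence `[x_5, y_5] = α(h_1 + h_2)`, a nonzero element of the span of the `h_i`. So this coordinate
vanishes, the vanishing spreads to all root coordinates, and the ideal lies in that span. -/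
lemma ideal_wk4 (I : Submodule K (Vec K)) (hI : ∀ u ∈ I, ∀ v, wk4 α u v ∈ I)
    (hd : Disjoint I (Submodule.span K (Set.range fun i => (e (.h i) : Vec K)))) : I = ⊥ := by
  have hI' : ∀ u ∈ I, ∀ v, wk4 α v u ∈ I := fun u hu v => by
    rw [isAlternating_wk4.symm]; exact hI u hu v
  rw [Submodule.disjoint_def] at hd
  have h33 : ∀ u ∈ I, u (gen 33) = 0 := by
    intro u hu
    by_contra hne
    have h4 : (e (gen 4) : Vec K) ∈ I := by
      have := hI' _ (hI' _ (hI' u hu (e (gen 14))) (e (gen 1))) (e (gen 0))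
      rw [ideal_head hα0 hα1] at this
      exact (Submodule.smul_mem_iff I (mul_ne_zero hne (ev_ne_zero hα0 hα1 rfl))).mp this
    have h5 := hI _ h4 (e (gen 23))
    have hl : wkTable 4 23 = [(15, 2), (16, 2)] := by decide +kernel
    have h6 := isTable_wk4 hα0 hα1 4 (by omega) 23 (by omega)
    rw [hl] at h6
    have h7 : wk4 α (e (gen 4)) (e (gen 23)) = 0 := by
      refine hd _ h5 ?_
      rw [h6]
      simp only [den_cons, den_nil, add_zero]
      exact Submodule.add_mem _ (Submodule.smul_mem _ _ (Submodule.subset_span ⟨0, rfl⟩))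
        (Submodule.smul_mem _ _ (Submodule.subset_span ⟨1, rfl⟩))
    have h8 := congrFun h7 (.h 0)
    rw [h6] at h8
    have h15 : gen 15 = .h 0 := rfl
    have h16 : gen 16 = .h 1 := rfl
    simp [ev_two, h15, h16, hα0] at h8
  have hroot := ideal_coord hα0 hα1 hI idealSteps [33] (fun r hr => by
    rw [List.mem_singleton] at hr; exact hr ▸ h33) idealCheck_idealSteps
  rw [Submodule.eq_bot_iff]
  intro u hu
  refine hd u hu ?_
  rw [vec_eq_sum u]
  refine Submodule.sum_mem _ fun g _ => ?_
  rcases g with i | i | i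
  · have := hroot i (by omega) (by revert i; decide) u hu
    rw [show gen i = .x i from gen_idx (.x i)] at this
    rw [this, zero_smul]; exact Submodule.zero_mem _
  · exact Submodule.smul_mem _ _ (Submodule.subset_span ⟨i, rfl⟩)
  · have := hroot (19 + i) (by omega) (by revert i; decide) u hu
    rw [show gen (19 + i) = .y i from gen_idx (.y i)] at this
    rw [this, zero_smul]; exact Submodule.zero_mem _

lemma isCartanAlgebra_wk4 : IsCartanAlgebra (cartan α) (wk4 α)
    (fun i => e (X (i + 1))) (fun i => e (.h i)) (fun i => e (Y (i + 1))) := by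
  have hT := isTable_wk4 hα0 hα1
  have hval : ∀ i j : Fin 4, ev α (rootValCode j i) = cartan α i j := by
    intro i j
    fin_cases i <;> fin_cases j <;> simp [rootValCode, cartan, ev_two]
  have hgx : ∀ j : Fin 4, X (j + 1) = gen j := by decide
  have hgy : ∀ j : Fin 4, Y (j + 1) = gen (19 + j) := by decide
  have hgh : ∀ j : Fin 4, (.h j : Gen) = gen (15 + j) := by decide
  constructor
  · have h : (fun g => (e g : Vec K)) = Pi.basisFun K Gen :=
      funext fun g => (Pi.basisFun_apply K Gen g).symm
    have : LinearIndependent K fun g => (e g : Vec K) := h ▸ (Pi.basisFun K Gen).linearIndependent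
    exact this.comp _ fun i j h => by simpa using h
  · intro i j
    have h : ∀ i j : Fin 4, wkTable (15 + i) (15 + j) = [] := by decide +kernel
    rw [hgh, hgh, hT _ (by omega) _ (by omega), h, den_nil]
  · intro i j
    have h : ∀ i j : Fin 4, wkTable (15 + i) j = single j (rootValCode j i) := by decide +kernel
    rw [hgh, hgx, hT _ (by omega) _ (by omega), h, den_single, hval]
  · intro i j
    have h : ∀ i j : Fin 4, wkTable (15 + i) (19 + j) = single (19 + j) (rootValCode j i) := by
      decide +kernel
    rw [hgh, hgy, hT _ (by omega) _ (by omega), h, den_single, hval]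
  · intro i j
    have h : ∀ i j : Fin 4, wkTable i (19 + j) = bif i == j then [(15 + i.1, 1)] else [] := by
      decide +kernel
    rw [hgh, hgx, hgy, hT _ (by omega) _ (by omega), h]
    by_cases hij : i = j
    · simp [hij]
    · simp [hij, beq_false_of_ne hij]
  · exact generate_wk4 hα0 hα1
  · exact ideal_wk4 hα0 hα1

end Ideal


/-! ## Tables of the cocycles -/

section Tables

/-- The Chevalley involution on the numbers of the basis vectors. -/
def bar (a : ℕ) : ℕ := bif Nat.blt a 15 then Nat.add a 19 else bif Nat.blt a 19 then a else Nat.sub a 19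

/-- The cocycle of weight `-2γ`, where `γ` is the root of `x_{i+1}`, is a trilinear form once its
values are lowered by the invariant form. This form is supported on 8 triples of basis vectors.
The bit `j` of the byte `a` tells whether the triple number `j` contains the basis vector `a`. -/
def tripleMask (i : ℕ) : ℕ :=
  bif Nat.beq i 12 then 0x8000000040000000008552e8000a002130140c0000030000
  else bif Nat.beq i 11 then 0x800040000038000000000000895220e41004080000000207000001
  else bif Nat.beq i 9 then 0x800040002c00001300000000000000854a201000f0000800040200000001
  else bif Nat.beq i 10 then 0xa000000000480000000028008142d40000043200100d000300
  else bif Nat.beq i 8 then 0xa00000480000140000000000002884500000c3003102000e000001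
  else bif Nat.beq i 7 then 0x4800000000a2000090000000008800420020110074000004000d0300
  else bif Nat.beq i 4 then 0x60009288000045000000000000c00000221009000400003c00000300
  else bif Nat.beq i 5 then 0x24000000000090c800420000000000008460000012080000390000070001
  else 0x48000084a20000005130000000000000c00028001402000001000000000f

/-- The codes of the values of the trilinear form on the 8 triples, with 5 bits each. -/
def tripleValue (i : ℕ) : ℕ :=
  bif Nat.beq i 12 then 0xa4d6b5ad6b
  else bif Nat.beq i 11 then 0x62d6b5ad6b
  else bif Nat.beq i 9 then 0x62d6b5ad6b
  else bif Nat.beq i 10 then 0x5296a5a94a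
  else bif Nat.beq i 8 then 0x4a54952508
  else bif Nat.beq i 7 then 0x5a94a5a94a
  else bif Nat.beq i 4 then 0x5ad4a5294a
  else bif Nat.beq i 5 then 0x5252942928
  else 0x529294a508

/-- The cocycle of weight `-2γ`, where `γ` is the weight of the root vector `g`, on the
basis vectors. -/
def cocycleTable (g a b : ℕ) : List (ℕ × ℕ) :=
  bif Nat.beq a b then [] else
    -- The weight of the value leaves a single basis vector: the supporting triples contain root
    -- vectors only.
    let k := Nat.sub (ofCode (Nat.sub (Nat.add (Nat.add (wtCode a) (wtCode b)) 46)
      (Nat.mul 2 (wtCode g)))) 1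
    let M := tripleMask (absIdx g)
    -- Cocycles of positive weight are obtained from those of negative weight by the Chevalley
    -- involution.
    let a' := bif Nat.blt g 15 then a else bar a
    let b' := bif Nat.blt g 15 then b else bar b
    let m := Nat.land (Nat.land (Nat.shiftRight M (Nat.mul 8 a')) (Nat.shiftRight M (Nat.mul 8 b'))) 255
    bif Nat.beq m 0 then [] else
      -- The logarithm finds the triple that contains both arguments. Subtracting the code of `ν`
      -- divides by the Gram entry, which turns the trilinear form back into a bilinear map.
      [(k, monomial (Nat.sub (Nat.land (Nat.shiftRight (tripleValue (absIdx g))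
        (Nat.mul 5 (Nat.log2 m))) 31) (nuCode (absIdx k))))]

/-- The quadratic term of the cocycle of weight `-2γ`, where `γ` is the root of `x_{i+1}`. -/
def squareList (i : ℕ) : List (ℕ × ℕ) :=
  bif Nat.beq i 10 then [(17, 12)] else bif Nat.beq i 8 then [(17, 3)]
  else bif Nat.beq i 7 then [(17, 12), (18, 12)] else bif Nat.beq i 4 then [(18, 12)]
  else bif Nat.beq i 5 then [(17, 3), (18, 3)] else bif Nat.beq i 0 then [(18, 3)] else []

/-- The square of the basis vector `a` in the cocycle number `g`. -/
def squareTable (g a : ℕ) : List (ℕ × ℕ) := bif a == g then squareList (absIdx g) else []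

/-- The coefficients of an alternating map given by the table `P`, with each pair in one order only,
and with the quadratic terms given by `d`. -/
def wedgeCode (P : ℕ → ℕ → List (ℕ × ℕ)) (d : ℕ → List (ℕ × ℕ)) (a b k : ℕ) : ℕ :=
  bif Nat.blt a b then coeffOf k (P a b) else bif a == b then coeffOf k (d a) else 0

/-- The terms `(s, k, a, b)` of `c0Terms`. -/
def c0List : List (ℕ × ℕ × ℕ × ℕ) :=
  [(3, 18, 0, 19), (3, 21, 0, 24), (3, 25, 0, 27), (6, 18, 4, 23), (6, 21, 4, 26), (6, 25, 4, 29),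
    (3, 2, 5, 19), (3, 17, 5, 24), (3, 18, 5, 24), (3, 22, 5, 27), (6, 2, 7, 23), (6, 17, 7, 26),
    (6, 18, 7, 26), (6, 22, 7, 29), (3, 6, 8, 19), (3, 3, 8, 24), (3, 17, 8, 27), (3, 7, 9, 19),
    (6, 5, 9, 23), (3, 4, 9, 24), (6, 0, 9, 26), (10, 17, 9, 28), (10, 22, 9, 30),
    (10, 25, 9, 31), (6, 6, 10, 23), (6, 3, 10, 26), (6, 17, 10, 29), (3, 10, 11, 19),
    (6, 8, 11, 23), (3, 4, 11, 27), (10, 3, 11, 28), (6, 0, 11, 29), (10, 17, 11, 30),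
    (10, 18, 11, 30), (10, 21, 11, 31), (3, 10, 12, 24), (6, 8, 12, 26), (3, 7, 12, 27),
    (10, 6, 12, 28), (6, 5, 12, 29), (10, 2, 12, 30), (10, 18, 12, 31), (1, 28, 19, 26),
    (1, 30, 19, 29), (1, 28, 23, 24), (1, 30, 23, 27), (1, 31, 24, 29), (1, 31, 26, 27)]

/-- The terms of the list with the given second and third vector. -/
def findTerms (a b : ℕ) : List (ℕ × ℕ × ℕ × ℕ) → List (ℕ × ℕ)
  | [] => []
  | t :: l => bif Nat.beq t.2.2.1 a && Nat.beq t.2.2.2 b then (t.2.1, t.1) :: findTerms a b l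
      else findTerms a b l

/-- The bit `i` of `n`. -/
def bit (n i : ℕ) : Bool := Nat.beq (Nat.land (Nat.shiftRight n i) 1) 1

/-- The cocycle `c0` on the basis vectors. It is supported on the root vectors
`x_i`, `y_i` with `i = 1, 5, 6, 8, …, 13`. -/
def c0Table (a b : ℕ) : List (ℕ × ℕ) :=
  bif !(bit 0xfd881fb1 a && bit 0xfd881fb1 b) then [] else
    let r := ofCode (Nat.sub (Nat.add (wtCode a) (wtCode b)) 46)
    bif Nat.beq r 0 then []
    else bif Nat.beq r 35 then
      let m := monomial (Nat.add (nuCode (absIdx a)) 8)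
      single 17 (bif bit 0xfa0 (absIdx a) then m else 0) ++
        single 18 (bif bit 0x18b1 (absIdx a) then m else 0)
    -- On the nine vectors `x_10, x_12, x_13, y_1, y_5, y_6, y_8, y_9, y_11` the cocycle agrees with
    -- the bracket. Otherwise it is `1 + α` times the part of the bracket with values in the root
    -- vectors numbered 3, 4, 7, and in the Cartan part it has the values given above.
    else bif bit 0x2d881a00 a && bit 0x2d881a00 b then wkTable a b
    else bif bit 0x260004c (Nat.sub r 1) then scale 3 (wkTable a b)
    else []

/-- The numbers of the root vectors `g` such that there is a cocycle of weight `-2γ_g`. -/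
def specialIdx : List ℕ :=
  [12, 11, 9, 10, 8, 7, 4, 5, 0, 31, 30, 28, 29, 27, 26, 23, 24, 19]

end Tables

/-! ### Finite verifications for the tables of the cocycles. -/

section Check

/-- The properties of the table of an alternating map of weight `w`, and of a table of squares. -/
def tableCheck (P : ℕ → ℕ → List (ℕ × ℕ)) (d : ℕ → List (ℕ × ℕ)) (w : Fin 4 → ℤ) : Bool :=
  allBelow 34 fun a =>
    (P a a == [] && ((d a).all fun t => Nat.blt t.1 34 &&
      decide (wt (gen t.1) = wt (gen a) + wt (gen a) + w))) &&
    allBelow 34 fun b => P a b == P b a &&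
      (P a b).all fun t => Nat.blt t.1 34 && decide (wt (gen t.1) = wt (gen a) + wt (gen b) + w)

/-- The linearized form of `[x², v] = [x, [x, v]]` on the basis vectors. -/
def squareCheck (P : ℕ → ℕ → List (ℕ × ℕ)) (d : ℕ → List (ℕ × ℕ)) : Bool :=
  allBelow 34 fun a => !oddCode a || allBelow 34 fun b =>
      isZero (act P a (wkTable a b) ++ sqList wkTable P (d a) a b)

/-- The values of the functional `(74, 53, 64, 70)` on the weights, plus 530. It also separates sums of
several weights. -/
def wideCode (a : ℕ) : ℕ := Nat.land (Nat.shiftRight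
  0x203910630c8690928454cc6188326730e91dd39084909212425081f5ba16c2c5d8dae25a2a614e2914b094923a5c
  (Nat.mul 11 a)) 2047

/-- The set of the values of `wideCode`. -/
def wideMask : ℕ :=
  0x1000000000000080000000000000000020000000000000002000000000000000008800000000000040002000000000000110200000000000011040080000000000004000000000000200411000000000000081100000000000008000400000000000022000000000000000008000000000000000800000000000000000200000000000010

/-- The linearized Jacobi identity on the sorted triples of basis vectors, if there are vectors of
the weight of the left-hand side. -/
def cocycleCheck (P Q : ℕ → ℕ → List (ℕ × ℕ)) (o : ℕ) : Bool :=
  allBelow 34 fun a => allBelow a fun b => allBelow b fun c =>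
    !(bit wideMask (Nat.sub (Nat.add (Nat.add (wideCode a) (wideCode b)) (wideCode c)) o)) ||
      isZero (jacList P Q a b c ++ jacList Q P a b c)

lemma c0Table_check : (allBelow 34 fun a => findTerms a a c0List == [] &&
    allBelow 34 fun b =>
      isZero (findTerms a b c0List ++ (findTerms b a c0List ++ c0Table a b))) = true := by
  decide +kernel

lemma tableCheck_wkTable : tableCheck wkTable (fun _ => []) 0 = true := by decide +kernel

lemma tableCheck_cocycleTable : (specialIdx.all fun g =>
    tableCheck (cocycleTable g) (squareTable g) (-(wt (gen g) + wt (gen g)))) = true := by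
  decide +kernel

lemma tableCheck_c0Table : tableCheck c0Table (fun _ => []) 0 = true := by decide +kernel

lemma squareCheck_cocycleTable :
    (specialIdx.all fun g => squareCheck (cocycleTable g) (squareTable g)) = true := by
  decide +kernel

lemma squareCheck_c0Table : squareCheck c0Table (fun _ => []) = true := by decide +kernel

lemma cocycleCheck_cocycleTable :
    (specialIdx.all fun g => cocycleCheck wkTable (cocycleTable g) (2 * wideCode g)) = true := by
  decide +kernel

lemma cocycleCheck_c0Table : cocycleCheck wkTable c0Table 1060 = true := by decide +kernel

/-- This yields the vanishing of the coefficient of `t²` in the Jacobi identity of the deform by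
`c0`. -/
lemma jacCheck_c0Table : jacCheck c0Table c0Table = true := by decide +kernel

/-- The coefficient of `t²` in the squaring identity. The quadratic term is zero on basis vectors,
so the iterated application of `c0` must vanish. -/
lemma c0Table_sq_check : (allBelow 34 fun a => !oddCode a || allBelow 34 fun b =>
    isZero (act c0Table a (c0Table a b))) = true := by decide +kernel

end Check

/-! ## Homogeneous maps -/

section Homogeneous

variable {K : Type*} [Field K]

/-- A bilinear map that is homogeneous of weight `w` with respect to the root lattice. -/
def IsHomogeneous (br : Vec K →ₗ[K] Vec K →ₗ[K] Vec K) (w : Fin 4 → ℤ) : Prop :=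
  ∀ a b, br (e a) (e b) ∈ weightSpace K (wt a + wt b + w)

variable {br br' : Vec K →ₗ[K] Vec K →ₗ[K] Vec K} {w w' : Fin 4 → ℤ}

lemma IsHomogeneous.apply_mem (h : IsHomogeneous br w) (a : Gen) {u : Vec K} {v : Fin 4 → ℤ}
    (hu : u ∈ weightSpace K v) : br (e a) u ∈ weightSpace K (wt a + v + w) := by
  rw [vec_eq_sum u, map_sum]
  refine Submodule.sum_mem _ fun g _ => ?_
  rw [map_smul]
  by_cases hg : wt g = v
  · exact Submodule.smul_mem _ _ (hg ▸ h a g)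
  · rw [hu g hg, zero_smul]; exact Submodule.zero_mem _

lemma IsHomogeneous.jac_mem (h : IsHomogeneous br w) (h' : IsHomogeneous br' w') (a b c : Gen) :
    jac br br' (e a) (e b) (e c) ∈ weightSpace K (wt a + wt b + wt c + (w + w')) := by
  have h1 := h.apply_mem a (h' b c)
  have h2 := h.apply_mem b (h' c a)
  have h3 := h.apply_mem c (h' a b)
  have e1 : wt a + (wt b + wt c + w') + w = wt a + wt b + wt c + (w + w') := by abel
  have e2 : wt b + (wt c + wt a + w') + w = wt a + wt b + wt c + (w + w') := by abel
  have e3 : wt c + (wt a + wt b + w') + w = wt a + wt b + wt c + (w + w') := by abel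
  rw [e1] at h1; rw [e2] at h2; rw [e3] at h3
  exact Submodule.add_mem _ (Submodule.add_mem _ h1 h2) h3

lemma eq_zero_of_mem_weightSpace {u : Vec K} (h : u ∈ weightSpace K w) (hw : ∀ k, wt k ≠ w) :
    u = 0 := funext fun k => h k (hw k)

lemma IsHomogeneous.respectsParity (h : IsHomogeneous br w) (hw : w 0 % 2 = 0) :
    RespectsParity br := by
  intro a b k hk
  refine h a b k fun hne => hk ?_
  rw [hne, Pi.add_apply, Pi.add_apply]
  omega

/-- The functional on the root lattice that separates the weights. -/
def wtForm (w : Fin 4 → ℤ) : ℤ := 2 * w 0 + 3 * w 1 + 9 * w 2 + 15 * w 3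

lemma wtForm_add (v w : Fin 4 → ℤ) : wtForm (v + w) = wtForm v + wtForm w := by
  simp only [wtForm, Pi.add_apply]; ring

lemma wtCode_eq (g : Gen) : (wtCode (idx g) : ℤ) = 46 + wtForm (wt g) := by
  revert g
  rw [forall_gen]
  decide +kernel

lemma ofCode_wtCode (g : Gen) : ofCode (wtCode (idx g)) ≠ 0 := by
  revert g
  rw [forall_gen]
  decide +kernel

/-- A linear form on weights that also separates sums of several weights. -/
def wideForm (w : Fin 4 → ℤ) : ℤ := 74 * w 0 + 53 * w 1 + 64 * w 2 + 70 * w 3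

lemma wideForm_add (v w : Fin 4 → ℤ) : wideForm (v + w) = wideForm v + wideForm w := by
  simp only [wideForm, Pi.add_apply]; ring

lemma wideForm_neg (w : Fin 4 → ℤ) : wideForm (-w) = -wideForm w := by
  simp only [wideForm, Pi.neg_apply]; ring

lemma wideCode_eq (g : Gen) : (wideCode (idx g) : ℤ) = 530 + wideForm (wt g) := by
  revert g
  rw [forall_gen]
  decide +kernel

lemma bit_wideCode (g : Gen) : bit wideMask (wideCode (idx g)) ≠ false := by
  revert g
  rw [forall_gen]
  decide +kernel

variable {α : K}

lemma den_mem_weightSpace {l : List (ℕ × ℕ)} (h : ∀ t ∈ l, wt (gen t.1) = w) :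
    den α l ∈ weightSpace K w := by
  induction l with
  | nil => exact Submodule.zero_mem _
  | cons t l ih =>
    rw [den_cons]
    refine Submodule.add_mem _ (Submodule.smul_mem _ _ fun g hg => ?_)
      (ih fun s hs => h s (List.mem_cons_of_mem _ hs))
    have : g ≠ gen t.1 := fun h' => hg (h' ▸ h t List.mem_cons_self)
    simp [this]

variable [CharP K 2]

/-- Both mixed Jacobi expressions are homogeneous. On triples for which no basis vector has the
resulting weight they vanish without computation, and only the other triples need the tables. -/
lemma jac_add_jac_of_check {P Q : ℕ → ℕ → List (ℕ × ℕ)} {o : ℕ} (ha : IsAlternating br)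
    (ha' : IsAlternating br') (hP : IsTable α br P) (hQ : IsTable α br' Q) (hPr : InRange P)
    (hQr : InRange Q) (hh : IsHomogeneous br w) (hh' : IsHomogeneous br' w')
    (ho : (o : ℤ) = 1060 - wideForm (w + w')) (hc : cocycleCheck P Q o = true) (u v x : Vec K) :
    jac br br' u v x + jac br' br u v x = 0 := by
  refine jac_ext ha' ha (fun a haa b hb c hcc => ?_) u v x
  have hl := allBelow_apply (allBelow_apply (allBelow_apply hc haa) hb) hcc
  rw [Bool.or_eq_true] at hl
  have hb' := hb.trans haa
  have hc' := hcc.trans hb'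
  rcases hl with hl | hl
  · have hz := (Bool.not_eq_true' _).mp hl
    have h1 := hh.jac_mem hh' (gen a) (gen b) (gen c)
    have h2 := hh'.jac_mem hh (gen a) (gen b) (gen c)
    rw [add_comm w' w] at h2
    refine eq_zero_of_mem_weightSpace (Submodule.add_mem _ h1 h2) fun k hk => ?_
    refine bit_wideCode k ?_
    -- The truncated subtraction is exact here: over the integers the difference is the code of an
    -- existing vector, hence nonnegative.
    have hk' : wideCode (idx k) = wideCode a + wideCode b + wideCode c - o := by
      have e1 := wideCode_eq k
      have e2 := wideCode_eq (gen a)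
      have e3 := wideCode_eq (gen b)
      have e4 := wideCode_eq (gen c)
      rw [idx_gen haa] at e2
      rw [idx_gen hb'] at e3
      rw [idx_gen hc'] at e4
      rw [hk, wideForm_add, wideForm_add, wideForm_add] at e1
      omega
    rw [hk']
    exact hz
  · rw [jac, jac, hP.jac hQ hQr haa hb' hc', hQ.jac hP hPr haa hb' hc', ← den_append,
      den_eq_zero α hl]

end Homogeneous

/-! ## Cochains given by tables -/

section Cochain

variable {K : Type*} [Field K]

/-- The 2-cochain of `bgl4` with the given coefficients. -/
def wedgeCochain (α : K) (s : Gen → Gen → Gen → K) : (bgl4 α).PreCochain :=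
  (wedgeBracket s, wedgeSq s _)

/-- The properties of a table of an alternating map of weight `w` and of a table of squares. -/
structure IsGradedTable (P : ℕ → ℕ → List (ℕ × ℕ)) (d : ℕ → List (ℕ × ℕ)) (w : Fin 4 → ℤ) :
    Prop where
  range : InRange P
  self : ∀ a < 34, P a a = []
  symm : ∀ a < 34, ∀ b < 34, P a b = P b a
  weight : ∀ a < 34, ∀ b < 34, ∀ t ∈ P a b, wt (gen t.1) = wt (gen a) + wt (gen b) + w
  sq_range : ∀ a < 34, ∀ t ∈ d a, t.1 < 34
  sq_weight : ∀ a < 34, ∀ t ∈ d a, wt (gen t.1) = wt (gen a) + wt (gen a) + w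

lemma isGradedTable_of_check {P : ℕ → ℕ → List (ℕ × ℕ)} {d : ℕ → List (ℕ × ℕ)} {w : Fin 4 → ℤ}
    (h : tableCheck P d w = true) : IsGradedTable P d w := by
  have h1 : ∀ a < 34, (P a a = [] ∧ ∀ t ∈ d a, t.1 < 34 ∧
      wt (gen t.1) = wt (gen a) + wt (gen a) + w) ∧ ∀ b < 34, P a b = P b a ∧
      ∀ t ∈ P a b, t.1 < 34 ∧ wt (gen t.1) = wt (gen a) + wt (gen b) + w := by
    intro a ha
    have h2 := allBelow_apply h ha
    rw [Bool.and_eq_true, Bool.and_eq_true, beq_iff_eq, List.all_eq_true] at h2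
    refine ⟨⟨h2.1.1, fun t ht => ?_⟩, fun b hb => ?_⟩
    · simpa [Nat.blt_eq] using h2.1.2 t ht
    · have h3 := allBelow_apply h2.2 hb
      rw [Bool.and_eq_true, beq_iff_eq, List.all_eq_true] at h3
      exact ⟨h3.1, fun t ht => by simpa [Nat.blt_eq] using h3.2 t ht⟩
  exact ⟨fun a ha b hb t ht => (((h1 a ha).2 b hb).2 t ht).1, fun a ha => (h1 a ha).1.1,
    fun a ha b hb => ((h1 a ha).2 b hb).1, fun a ha b hb t ht => (((h1 a ha).2 b hb).2 t ht).2,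
    fun a ha t ht => ((h1 a ha).1.2 t ht).1, fun a ha t ht => ((h1 a ha).1.2 t ht).2⟩

/-- The coefficients given by tables. -/
def codeCoeff (α : K) (P : ℕ → ℕ → List (ℕ × ℕ)) (d : ℕ → List (ℕ × ℕ)) (a b k : Gen) : K :=
  ev α (wedgeCode P d (idx a) (idx b) (idx k))

variable {P : ℕ → ℕ → List (ℕ × ℕ)} {d : ℕ → List (ℕ × ℕ)} {w : Fin 4 → ℤ} {α : K}
  {s : Gen → Gen → Gen → K}

lemma IsGradedTable.isHomogeneous {br : Vec K →ₗ[K] Vec K →ₗ[K] Vec K}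
    (h : IsGradedTable P d w) (hP : IsTable α br P) : IsHomogeneous br w := by
  intro a b
  have := hP (idx a) (idx_lt a) (idx b) (idx_lt b)
  rw [gen_idx, gen_idx] at this
  rw [this]
  refine den_mem_weightSpace fun t ht => ?_
  have := h.weight _ (idx_lt a) _ (idx_lt b) t ht
  rwa [gen_idx, gen_idx] at this

variable [CharP K 2]

lemma IsGradedTable.isTable_codeCoeff (h : IsGradedTable P d w) :
    IsTable α (wedgeBracket (codeCoeff α P d)) P := by
  refine isTable_wedgeBracket α h.range fun a b k => ?_
  unfold codeCoeff wedgeCode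
  have hlt : ∀ m n : ℕ, ¬ m < n → Nat.blt m n = false := fun m n hmn => by
    rw [Bool.eq_false_iff, ne_eq, Nat.blt_eq]; exact hmn
  rcases lt_trichotomy (idx a) (idx b) with hab | hab | hab
  · rw [hlt _ _ hab.not_gt, Nat.blt_eq.mpr hab, beq_false_of_ne hab.ne']
    simp
  · rw [hab, hlt _ _ (lt_irrefl _), h.self _ (idx_lt b)]
    simp [CharTwo.add_self_eq_zero, coeffOf]
  · rw [hlt _ _ hab.not_gt, Nat.blt_eq.mpr hab, beq_false_of_ne hab.ne',
      h.symm _ (idx_lt a) _ (idx_lt b)]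
    simp

lemma codeCoeff_self (h : IsGradedTable P d w) {a : ℕ} (ha : a < 34) :
    codeCoeff α P d (gen a) (gen a) = den α (d a) := by
  funext k
  rw [den_apply α (h.sq_range a ha)]
  unfold codeCoeff wedgeCode
  have : Nat.blt (idx (gen a)) (idx (gen a)) = false := by
    rw [Bool.eq_false_iff, ne_eq, Nat.blt_eq]; exact lt_irrefl _
  rw [this, idx_gen ha]
  simp

omit [CharP K 2] in
/-- A homogeneous cochain of even weight is even. -/
lemma isEvenCochain_of_hasWeight {c : (bgl4 α).PreCochain} (hc : HasWeight c w) (hw : w 0 % 2 = 0)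
    (hadd : ∀ x y : (bgl4 α).oddPart, c.2 (x + y) = c.2 x + c.2 y + c.1 x y) :
    IsEvenCochain c := by
  classical
  have hpar : RespectsParity c.1 := IsHomogeneous.respectsParity hc.1 hw
  refine ⟨hpar, fun x => ?_⟩
  -- The map `p` extracts the odd coordinates. The polarization of the quadratic term is even on odd
  -- vectors, so the quadratic term becomes additive after `p` and may be tested on basis vectors.
  let p : Vec K →ₗ[K] Vec K := LinearMap.pi fun g =>
    if g.IsOdd then LinearMap.proj g else 0
  have hp : ∀ u, p u = 0 ↔ u ∈ (bgl4 α).evenPart := by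
    intro u
    rw [funext_iff]
    refine forall_congr' fun g => ?_
    by_cases hg : g.IsOdd <;> simp [p, hg]
  rw [← hp]
  refine sq_ext (G := fun x => p (c.2 x)) ?_ ?_ ?_ x
  · intro x y
    have h0 : p (c.1 x y) = 0 := by
      rw [hp, evenPart_eq]
      exact hpar.mem (i := 1) (j := 1) x.2 y.2
    rw [hadd, map_add, map_add, h0, add_zero]
  · intro r x
    rw [QuadraticMap.map_smul, map_smul]
  · intro x g hx
    rw [hp, evenPart_eq]
    intro k hk
    refine hc.2 g x hx k fun hne => hk ?_
    rw [hne, Pi.add_apply, Pi.add_apply]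
    omega

omit [CharP K 2] in
lemma wedgeCochain_hasWeight (h : IsGradedTable P d w) (hP : IsTable α (wedgeBracket s) P)
    (hd : ∀ a < 34, s (gen a) (gen a) = den α (d a)) : HasWeight (wedgeCochain α s) w := by
  refine ⟨h.isHomogeneous hP, fun a x hx => ?_⟩
  change wedgeSq s _ x ∈ _
  rw [wedgeSq_e s hx, ← gen_idx a, hd _ (idx_lt a)]
  exact den_mem_weightSpace (h.sq_weight _ (idx_lt a))

omit [CharP K 2] in
lemma wedgeCochain_isEven (h : IsGradedTable P d w) (hP : IsTable α (wedgeBracket s) P)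
    (hd : ∀ a < 34, s (gen a) (gen a) = den α (d a)) (hw : w 0 % 2 = 0) :
    IsEvenCochain (wedgeCochain α s) :=
  isEvenCochain_of_hasWeight (wedgeCochain_hasWeight h hP hd) hw (wedgeSq_add s)

variable (hα0 : α ≠ 0) (hα1 : α ≠ 1)
include hα0 hα1

lemma isHomogeneous_wk4 : IsHomogeneous (wk4 α) 0 :=
  (isGradedTable_of_check tableCheck_wkTable).isHomogeneous (isTable_wk4 hα0 hα1)

/-- In characteristic 2 the cocycle identities are the sums of the two mixed Jacobi expressions and
of the two mixed squaring defects, to which the finite tests apply. -/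
lemma wedgeCochain_mem_Z2 {o : ℕ} (h : IsGradedTable P d w) (hP : IsTable α (wedgeBracket s) P)
    (hd : ∀ a < 34, s (gen a) (gen a) = den α (d a)) (ho : (o : ℤ) = 1060 - wideForm w)
    (hc : cocycleCheck wkTable P o = true) (hsq : squareCheck P d = true) :
    wedgeCochain α s ∈ (bgl4 α).Z2 := by
  have halt := isAlternating_wedgeBracket s
  have hwk : IsAlternating (wk4 α) := isAlternating_wk4
  have hj := jac_add_jac_of_check hwk halt (isTable_wk4 hα0 hα1) hP inRange_wkTable h.range
    (isHomogeneous_wk4 hα0 hα1) (h.isHomogeneous hP) (by rw [zero_add]; exact ho) hc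
  refine ⟨halt.symm, fun u _ => halt.self u, wedgeSq_add s, fun u v x => ?_, fun x v => ?_⟩
  · change wedgeBracket s (wk4 α u v) x + wedgeBracket s (wk4 α v x) u +
      wedgeBracket s (wk4 α x u) v + (wk4 α (wedgeBracket s u v) x + wk4 α (wedgeBracket s v x) u +
      wk4 α (wedgeBracket s x u) v) = 0
    rw [← hj u v x, jac, jac, halt.symm (wk4 α u v) x, halt.symm (wk4 α v x) u,
      halt.symm (wk4 α x u) v, hwk.symm (wedgeBracket s u v) x, hwk.symm (wedgeBracket s v x) u,
      hwk.symm (wedgeBracket s x u) v]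
    abel
  · have := sqDefect_eq_zero (α := α) (s₁ := s) (t₁ := structConst α) (s₂ := structConst α)
      (t₂ := s) (fun u v x => by rw [add_comm]; exact hj u v x) (fun a ha hodd b hb => ?_) x v
    · rw [← vec_add_eq_zero, ← this, sqDefect, sqDefect]
      change wedgeBracket s (wedgeSq (structConst α) _ x) v + wk4 α (wedgeSq s _ x) v +
        (wedgeBracket s x (wk4 α x v) + wk4 α x (wedgeBracket s x v)) =
        wedgeBracket s (wedgeSq (structConst α) _ x) v + wedgeBracket s x (wk4 α x v) +
        (wk4 α (wedgeSq s _ x) v + wk4 α x (wedgeBracket s x v))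
      abel
    · have hl := allBelow_apply hsq ha
      rw [hodd, Bool.not_true, Bool.false_or] at hl
      have hl := den_eq_zero α (allBelow_apply hl hb)
      have hT := isTable_wk4 hα0 hα1
      rw [sqList_eq hT hP h.range (h.sq_range a ha) ha hb (hd a ha), structConst_self hα0 hα1,
        map_zero, LinearMap.zero_apply, zero_add]
      change wedgeBracket s _ (wk4 α _ _) + _ = 0
      rw [hT a ha b hb, hP.act ha (inRange_wkTable a ha b hb), ← den_append, hl]

end Cochain

/-! ## The cocycles -/

section Cocycles

variable {K : Type*} [Field K] [CharP K 2] (α : K)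

/-- The cocycle of weight `-2γ`, where `γ` is the weight of the root vector number `g`. -/
def rootCocycle (g : ℕ) : (bgl4 α).PreCochain :=
  wedgeCochain α (codeCoeff α (cocycleTable g) (squareTable g))

lemma isGradedTable_cocycleTable {g : ℕ} (hg : g ∈ specialIdx) :
    IsGradedTable (cocycleTable g) (squareTable g) (-(wt (gen g) + wt (gen g))) :=
  isGradedTable_of_check (List.all_eq_true.mp tableCheck_cocycleTable g hg)

lemma isTable_rootCocycle {g : ℕ} (hg : g ∈ specialIdx) :
    IsTable α (rootCocycle α g).1 (cocycleTable g) :=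
  (isGradedTable_cocycleTable hg).isTable_codeCoeff

lemma hasWeight_rootCocycle {g : ℕ} (hg : g ∈ specialIdx) :
    HasWeight (rootCocycle α g) (-(wt (gen g) + wt (gen g))) :=
  have h := isGradedTable_cocycleTable hg
  wedgeCochain_hasWeight h h.isTable_codeCoeff fun _ ha => codeCoeff_self h ha

lemma isEvenCochain_rootCocycle {g : ℕ} (hg : g ∈ specialIdx) :
    IsEvenCochain (rootCocycle α g) :=
  have h := isGradedTable_cocycleTable hg
  wedgeCochain_isEven h h.isTable_codeCoeff (fun _ ha => codeCoeff_self h ha) (by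
    simp only [Pi.neg_apply, Pi.add_apply]; omega)

lemma rootCocycle_sq {g : ℕ} (hg : g ∈ specialIdx) (hg' : g < 34) {x : (bgl4 α).oddPart}
    (hx : (x : Vec K) = e (gen g)) : (rootCocycle α g).2 x = den α (squareList (absIdx g)) := by
  change wedgeSq _ _ x = _
  rw [wedgeSq_e _ hx, codeCoeff_self (isGradedTable_cocycleTable hg) hg', squareTable,
    beq_self_eq_true, cond_true]

variable {α} (hα0 : α ≠ 0) (hα1 : α ≠ 1)

include hα0 hα1 in
lemma rootCocycle_mem_Z2 {g : ℕ} (hg : g ∈ specialIdx) : rootCocycle α g ∈ (bgl4 α).Z2 := by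
  have hlt : ∀ g ∈ specialIdx, g < 34 := by decide
  have h := isGradedTable_cocycleTable hg
  refine wedgeCochain_mem_Z2 hα0 hα1 h h.isTable_codeCoeff (fun _ ha => codeCoeff_self h ha) ?_
    (List.all_eq_true.mp cocycleCheck_cocycleTable g hg)
    (List.all_eq_true.mp squareCheck_cocycleTable g hg)
  have hg' := hlt g hg
  have := wideCode_eq (gen g)
  rw [idx_gen hg'] at this
  rw [wideForm_neg, wideForm_add]
  push_cast
  omega

variable (α)

lemma c0Terms_eq : c0Terms α =
    c0List.map fun t => (ev α t.1, gen t.2.1, gen t.2.2.1, gen t.2.2.2) := by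
  have h6 : ev α 6 = α * (1 + α) := by rw [show 6 = 2 * 3 from rfl, ev_two_mul, ev_three]
  have h10 : ev α 10 = α * (1 + α) ^ 2 := by
    have h5 : ev α 5 = (1 + α) * (1 + α) := by
      rw [show 5 = pmul 3 3 from rfl, ev_pmul, ev_three]
    rw [show 10 = 2 * 5 from rfl, ev_two_mul, h5, sq]
  simp only [c0List, List.map_cons, List.map_nil, h6, h10, ev_three, ev_one]
  rfl

lemma sum_findTerms {l : List (ℕ × ℕ × ℕ × ℕ)}
    (hl : ∀ t ∈ l, t.2.1 < 34 ∧ t.2.2.1 < 34 ∧ t.2.2.2 < 34) (a b k : Gen) :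
    ((l.map fun t => (ev α t.1, gen t.2.1, gen t.2.2.1, gen t.2.2.2)).map fun T =>
      if T.2 = (k, a, b) then T.1 else 0).sum =
      ev α (coeffOf (idx k) (findTerms (idx a) (idx b) l)) := by
  induction l with
  | nil => simp [findTerms, coeffOf]
  | cons t l ih =>
    obtain ⟨h1, h2, h3⟩ := hl t List.mem_cons_self
    have hn : ∀ (n : ℕ) (g : Gen), n < 34 → (gen n = g ↔ Nat.beq n (idx g) = true) := by
      intro n g hn
      rw [Nat.beq_eq]
      exact ⟨fun h => by rw [← h, idx_gen hn], fun h => by rw [h, gen_idx]⟩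
    rw [List.map_cons, List.map_cons, List.sum_cons, ih fun s hs => hl s (List.mem_cons_of_mem _ hs)]
    simp only [Prod.mk.injEq, hn _ _ h1, hn _ _ h2, hn _ _ h3, findTerms]
    cases hk : Nat.beq t.2.1 (idx k) <;> cases ha : Nat.beq t.2.2.1 (idx a) <;>
      cases hb : Nat.beq t.2.2.2 (idx b) <;>
      simp only [coeffOf, hk, ← ev_xor, Bool.false_eq_true, Bool.true_and, Bool.false_and,
        Bool.and_false, and_false, false_and, and_self, if_true, if_false, zero_add, cond_true, cond_false]

lemma c0Coeff_eq (a b k : Gen) :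
    c0Coeff α a b k = ev α (coeffOf (idx k) (findTerms (idx a) (idx b) c0List)) := by
  rw [c0Coeff, c0Terms_eq]
  exact sum_findTerms α (by decide) a b k

lemma c0Coeff_self {a : ℕ} (ha : a < 34) : c0Coeff α (gen a) (gen a) = den α [] := by
  have h := allBelow_apply c0Table_check ha
  rw [Bool.and_eq_true, beq_iff_eq] at h
  funext k
  rw [c0Coeff_eq, idx_gen ha, h.1]
  simp [coeffOf]

lemma isGradedTable_c0Table : IsGradedTable c0Table (fun _ => []) 0 :=
  isGradedTable_of_check tableCheck_c0Table

lemma findTerms_lt (a b : ℕ) : ∀ t ∈ findTerms a b c0List, t.1 < 34 := by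
  have : ∀ l : List (ℕ × ℕ × ℕ × ℕ), (∀ t ∈ l, t.2.1 < 34) → ∀ t ∈ findTerms a b l, t.1 < 34 := by
    intro l hl
    induction l with
    | nil => simp [findTerms]
    | cons t l ih =>
      have ih' := ih fun s hs => hl s (List.mem_cons_of_mem _ hs)
      intro s hs
      rw [findTerms] at hs
      cases hb : (Nat.beq t.2.2.1 a && Nat.beq t.2.2.2 b)
      · rw [hb, cond_false] at hs
        exact ih' s hs
      · rw [hb, cond_true, List.mem_cons] at hs
        rcases hs with rfl | hs
        · exact hl t List.mem_cons_self
        · exact ih' s hs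
  exact this c0List (by decide)

lemma isTable_c0 : IsTable α (c0 α) c0Table := by
  intro a ha b hb
  have h := allBelow_apply c0Table_check ha
  rw [Bool.and_eq_true] at h
  have h' := den_eq_zero α (allBelow_apply h.2 hb)
  rw [den_append, den_append, ← add_assoc, vec_add_eq_zero] at h'
  have hc : ∀ a < 34, ∀ b < 34, c0Coeff α (gen a) (gen b) = den α (findTerms a b c0List) := by
    intro a ha b hb
    funext k
    rw [c0Coeff_eq, idx_gen ha, idx_gen hb, den_apply α (findTerms_lt a b)]
  rw [c0, wedgeBracket_e, hc a ha b hb, hc b hb a ha, h']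

lemma c0bar_hasWeight : HasWeight (c0bar α) 0 :=
  wedgeCochain_hasWeight isGradedTable_c0Table (isTable_c0 α) fun _ => c0Coeff_self α

lemma c0bar_isEvenCochain : IsEvenCochain (c0bar α) :=
  wedgeCochain_isEven isGradedTable_c0Table (isTable_c0 α) (fun _ => c0Coeff_self α) rfl

lemma isAlternating_c0 : IsAlternating (c0 α) := isAlternating_wedgeBracket _

lemma jac_c0 (u v w : Vec K) : jac (c0 α) (c0 α) u v w = 0 :=
  jac_eq_zero (isAlternating_c0 α) (isTable_c0 α) (isTable_c0 α) isGradedTable_c0Table.range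
    jacCheck_c0Table u v w

lemma c0bar_sq_bracket (x : (bgl4 α).oddPart) (v : Vec K) :
    c0 α ((c0bar α).2 x) v = c0 α x (c0 α x v) := by
  have h0 : wedgeBracket (0 : Gen → Gen → Gen → K) = 0 := by
    ext a b k
    simp [wedgeBracket_e]
  have hT := isTable_c0 α
  have := sqDefect_eq_zero (α := α) (s₁ := c0Coeff α) (t₁ := c0Coeff α) (s₂ := 0) (t₂ := 0)
    ?_ ?_ x v
  · rw [← vec_add_eq_zero]
    simp only [sqDefect, h0, LinearMap.zero_apply, add_zero] at this
    exact this
  · intro u v w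
    rw [h0]
    have hz : jac 0 0 u v w = 0 := by simp [jac]
    rw [hz, add_zero]
    exact jac_c0 α u v w
  · intro a ha hodd b hb
    rw [h0, c0Coeff_self α ha]
    have hc := allBelow_apply c0Table_sq_check ha
    rw [hodd, Bool.not_true, Bool.false_or] at hc
    change c0 α _ _ + c0 α _ (c0 α _ _) + _ = _
    rw [hT a ha b hb, hT.act ha (isGradedTable_c0Table.range a ha b hb),
      den_eq_zero α (allBelow_apply hc hb)]
    simp

variable {α}

include hα0 hα1 in
lemma c0bar_mem_Z2 : c0bar α ∈ (bgl4 α).Z2 :=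
  wedgeCochain_mem_Z2 hα0 hα1 isGradedTable_c0Table (isTable_c0 α) (fun _ => c0Coeff_self α)
    (by simp [wideForm]) cocycleCheck_c0Table squareCheck_c0Table

omit [CharP K 2] in
lemma squareTerm_eq (n : Fin 9) :
    squareTerm α n = den α (squareList (specialRoot n - 1)) := by
  have h12 : ev α 12 = α ^ 2 * (1 + α) := by
    rw [show 12 = 2 * (2 * 3) from rfl, ev_two_mul, ev_two_mul, ev_three]; ring
  have h : ∀ n : Fin 9, squareList (specialRoot n - 1) = (![[], [], [], [(17, 12)], [(17, 3)],
      [(17, 12), (18, 12)], [(18, 12)], [(17, 3), (18, 3)], [(18, 3)]] : Fin 9 → _) n := by decide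
  have g17 : gen 17 = H 3 := rfl
  have g18 : gen 18 = H 4 := rfl
  rw [h]
  fin_cases n <;> simp [squareTerm, h12, ev_three, g17, g18]

end Cocycles


/-! ## Propagation of vanishing through linear equations -/

section Propagation

/-- `f n`, with `n` evaluated first. -/
def force {β : Type*} (n : ℕ) (f : ℕ → β) : β := Nat.rec (f 0) (fun k _ => f (Nat.succ k)) n

lemma force_eq {β : Type*} (n : ℕ) (f : ℕ → β) : force n f = f n := by cases n <;> rfl

/-- The terms of a linear form whose coefficients do not cancel. -/
def cancel (l : List (ℕ × ℕ)) : List (ℕ × ℕ) := l.filter fun t => !Nat.beq (coeffOf t.1 l) 0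

/-- The terms of a linear equation whose unknowns are neither in the bit set `known` nor
satisfy `z`. -/
def unknowns (z : ℕ → Bool) (known : ℕ) (l : List (ℕ × ℕ)) : List (ℕ × ℕ) :=
  cancel (l.filter fun t => !(bit known t.1 || z t.1))

/-- If a linear equation has only one unknown, and its coefficient is a unit, then this unknown is
added to the bit set. -/
def pivot (known : ℕ) : List (ℕ × ℕ) → ℕ
  | [] => known
  | t :: l => bif (l.all fun s => Nat.beq s.1 t.1) && isUnit (coeffOf t.1 (t :: l)) then
      Nat.lor known (Nat.shiftLeft 1 t.1) else known

/-- Propagation through the equations `eqn c`, for `c` in the list, and a final check. -/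
def propagate (z : ℕ → Bool) (eqn : ℕ → List (ℕ × ℕ)) (es : List ℕ) (fin : ℕ → Bool) :
    ℕ → Bool :=
  es.foldr (fun c r known => force (pivot known (unknowns z known (eqn c))) r) fin

/-- The bit set with the given elements. -/
def bitSet (l : List ℕ) : ℕ := l.foldr (fun u n => Nat.lor n (Nat.shiftLeft 1 u)) 0

lemma bit_eq_testBit (n i : ℕ) : bit n i = n.testBit i := by
  have h : Nat.land (Nat.shiftRight n i) 1 = (n.testBit i).toNat := by
    change (n >>> i) &&& 1 = _
    rw [Nat.and_one_is_mod, Nat.toNat_testBit, Nat.shiftRight_eq_div_pow]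
  rw [bit, h]
  cases n.testBit i <;> rfl

lemma bit_lor {n u i : ℕ} (h : bit (Nat.lor n (Nat.shiftLeft 1 u)) i = true) :
    bit n i = true ∨ i = u := by
  rw [bit_eq_testBit] at h ⊢
  change (n ||| 1 <<< u).testBit i = true at h
  rw [Nat.testBit_or, Bool.or_eq_true, Nat.one_shiftLeft, Nat.testBit_two_pow] at h
  exact h.imp_right fun h => (of_decide_eq_true h).symm

lemma bit_zero (i : ℕ) : bit 0 i = false := by rw [bit_eq_testBit, Nat.zero_testBit]

lemma mem_of_bit_bitSet {l : List ℕ} {i : ℕ} (h : bit (bitSet l) i = true) : i ∈ l := by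
  induction l with
  | nil => rw [bitSet, List.foldr_nil, bit_zero] at h; simp at h
  | cons u l ih =>
    rcases bit_lor (n := bitSet l) h with h | rfl
    · exact List.mem_cons_of_mem _ (ih h)
    · exact List.mem_cons_self

variable {K : Type*} [Field K]

/-- The value of a linear form at `φ`, with the coefficients evaluated by `v`. -/
def lin (v φ : ℕ → K) (l : List (ℕ × ℕ)) : K := (l.map fun t => v t.2 * φ t.1).sum

variable (v φ : ℕ → K)

@[simp] lemma lin_nil : lin v φ [] = 0 := rfl

@[simp] lemma lin_cons (t : ℕ × ℕ) (l : List (ℕ × ℕ)) :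
    lin v φ (t :: l) = v t.2 * φ t.1 + lin v φ l := by simp [lin]

@[simp] lemma lin_append (l m : List (ℕ × ℕ)) : lin v φ (l ++ m) = lin v φ l + lin v φ m := by
  simp [lin]

lemma lin_map (f : ℕ → ℕ) (l : List (ℕ × ℕ)) :
    lin v φ (l.map fun t => (f t.1, t.2)) = lin v (fun n => φ (f n)) l := by
  simp [lin, Function.comp_def]

lemma lin_eq_zero_of_forall {l : List (ℕ × ℕ)} (h : ∀ t ∈ l, φ t.1 = 0) : lin v φ l = 0 :=
  List.sum_eq_zero fun x hx => by
    obtain ⟨t, ht, rfl⟩ := List.mem_map.mp hx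
    rw [h t ht, mul_zero]

lemma lin_congr {φ' : ℕ → K} {l : List (ℕ × ℕ)} (h : ∀ t ∈ l, φ t.1 = φ' t.1) :
    lin v φ l = lin v φ' l := by
  unfold lin
  congr 1
  exact List.map_congr_left fun t ht => by rw [h t ht]

lemma lin_filter (p : ℕ × ℕ → Bool) {l : List (ℕ × ℕ)}
    (h : ∀ t ∈ l, p t = false → φ t.1 = 0) : lin v φ (l.filter p) = lin v φ l := by
  induction l with
  | nil => rfl
  | cons t l ih =>
    have ih' := ih fun s hs => h s (List.mem_cons_of_mem _ hs)
    cases ht : p t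
    · rw [List.filter_cons_of_neg (by simp [ht]), ih', lin_cons, h t List.mem_cons_self ht,
        mul_zero, zero_add]
    · rw [List.filter_cons_of_pos ht, lin_cons, lin_cons, ih']

variable {v φ} (hadd : ∀ m n, v (Nat.xor m n) = v m + v n) (h0 : v 0 = 0)

include hadd h0

lemma lin_eq_coeffOf {l : List (ℕ × ℕ)} {u : ℕ} (h : ∀ t ∈ l, t.1 = u) :
    lin v φ l = v (coeffOf u l) * φ u := by
  induction l with
  | nil => simp [coeffOf, h0]
  | cons t l ih =>
    have ht := h t List.mem_cons_self
    rw [lin_cons, ih fun s hs => h s (List.mem_cons_of_mem _ hs), coeffOf, ht, nat_beq_self,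
      cond_true, hadd, add_mul]

lemma lin_eq_sum (l : List (ℕ × ℕ)) (S : Finset ℕ) (h : ∀ t ∈ l, t.1 ∈ S) :
    lin v φ l = ∑ k ∈ S, v (coeffOf k l) * φ k := by
  induction l with
  | nil => simp [coeffOf, h0]
  | cons t l ih =>
    rw [lin_cons, ih fun s hs => h s (List.mem_cons_of_mem _ hs)]
    have h1 : v t.2 * φ t.1 = ∑ k ∈ S, if t.1 = k then v t.2 * φ k else 0 := by
      rw [Finset.sum_ite_eq, if_pos (h t List.mem_cons_self)]
    rw [h1, ← Finset.sum_add_distrib]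
    refine Finset.sum_congr rfl fun k _ => ?_
    by_cases hk : t.1 = k
    · simp only [hk, coeffOf, nat_beq_self, cond_true, hadd, add_mul, if_true]
    · simp [hk, coeffOf, beq_eq_false hk]

lemma lin_eq_zero {l : List (ℕ × ℕ)} (h : isZero l = true) : lin v φ l = 0 := by
  rw [lin_eq_sum hadd h0 l (l.map Prod.fst).toFinset
    fun t ht => List.mem_toFinset.mpr (List.mem_map_of_mem ht)]
  refine Finset.sum_eq_zero fun k hk => ?_
  obtain ⟨t, ht, rfl⟩ := List.mem_map.mp (List.mem_toFinset.mp hk)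
  have := List.all_eq_true.mp h t ht
  rw [Nat.eq_of_beq_eq_true this, h0, zero_mul]

omit hadd h0 in
lemma coeffOf_filter (p : ℕ → Bool) (k : ℕ) (l : List (ℕ × ℕ)) :
    coeffOf k (l.filter fun t => p t.1) = bif p k then coeffOf k l else 0 := by
  induction l with
  | nil => cases p k <;> rfl
  | cons t l ih =>
    by_cases hk : t.1 = k
    · subst hk
      cases ht : p t.1
      · rw [List.filter_cons_of_neg (by simp [ht]), ih, ht]; rfl
      · rw [List.filter_cons_of_pos (by simp [ht]), coeffOf, ih, ht]
        simp only [nat_beq_self, cond_true, coeffOf]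
    · cases ht : p t.1
      · rw [List.filter_cons_of_neg (by simp [ht]), ih, coeffOf, beq_eq_false hk, cond_false]
      · rw [List.filter_cons_of_pos (by simp [ht]), coeffOf, ih, coeffOf, beq_eq_false hk,
          cond_false, cond_false]

lemma lin_cancel (l : List (ℕ × ℕ)) : lin v φ (cancel l) = lin v φ l := by
  have hS : ∀ t ∈ l, t.1 ∈ (l.map Prod.fst).toFinset :=
    fun t ht => List.mem_toFinset.mpr (List.mem_map_of_mem ht)
  rw [lin_eq_sum hadd h0 l _ hS, lin_eq_sum hadd h0 (cancel l) _
    fun t ht => hS t (List.mem_of_mem_filter ht)]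
  refine Finset.sum_congr rfl fun k _ => ?_
  rw [cancel, coeffOf_filter (fun u => !Nat.beq (coeffOf u l) 0)]
  cases h : Nat.beq (coeffOf k l) 0
  · rfl
  · rw [Nat.eq_of_beq_eq_true h]; rfl

/-- An equation with one unknown and an invertible coefficient forces this unknown to vanish; in all
other cases the set of known zeros is unchanged. The evaluation `v` of coefficients is left abstract
because coefficients involving the deformation parameter are needed as well. -/
lemma pivot_sound (hu : ∀ n, isUnit n = true → v n ≠ 0) {known : ℕ}
    (hk : ∀ u, bit known u = true → φ u = 0) {l : List (ℕ × ℕ)} (hl : lin v φ l = 0) :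
    ∀ u, bit (pivot known l) u = true → φ u = 0 := by
  intro u h
  cases l with
  | nil => exact hk u h
  | cons t l =>
    cases hc : (l.all fun s => Nat.beq s.1 t.1) && isUnit (coeffOf t.1 (t :: l))
    · rw [pivot, hc, cond_false] at h
      exact hk u h
    · rw [pivot, hc, cond_true] at h
      rcases bit_lor h with h | rfl
      · exact hk u h
      · rw [Bool.and_eq_true, List.all_eq_true] at hc
        rw [lin_eq_coeffOf hadd h0 (u := t.1)] at hl
        · exact (mul_eq_zero.mp hl).resolve_left (hu _ hc.2)
        · intro s hs
          rcases List.mem_cons.mp hs with rfl | hs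
          · rfl
          · exact Nat.eq_of_beq_eq_true (hc.1 s hs)

/-- Nothing is assumed about the list of equations or its order. Equations that determine nothing
are harmless, and the final test decides whether enough coordinates have been reached. -/
lemma propagate_sound (hu : ∀ n, isUnit n = true → v n ≠ 0) {z : ℕ → Bool}
    {eqn : ℕ → List (ℕ × ℕ)} (hz : ∀ u, z u = true → φ u = 0) (heq : ∀ c, lin v φ (eqn c) = 0)
    {fin : ℕ → Bool} (es : List ℕ) :
    ∀ known, (∀ u, bit known u = true → φ u = 0) → propagate z eqn es fin known = true →
      ∃ known', (∀ u, bit known' u = true → φ u = 0) ∧ fin known' = true := by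
  induction es with
  | nil => exact fun known hk h => ⟨known, hk, h⟩
  | cons c es ih =>
    intro known hk h
    rw [propagate, List.foldr_cons, force_eq] at h
    refine ih _ (pivot_sound hadd h0 hu hk ?_) h
    rw [unknowns, lin_cancel hadd h0, lin_filter, heq]
    intro t _ ht
    rw [Bool.not_eq_false', Bool.or_eq_true] at ht
    exact ht.elim (hk _) (hz _)

end Propagation

/-! ## The equations of cocycles in coordinates -/

section Equations

/-- The basis vectors with the given code of the weight. -/
def cand (s : ℕ) : List ℕ :=
  bif Nat.beq (ofCode s) 0 then [] else bif Nat.beq (ofCode s) 35 then [15, 16, 17, 18]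
  else [Nat.sub (ofCode s) 1]

/-- The coefficients of the coordinates of `u` in the coordinate `k` of `[u, e_r]`. -/
def rowList (r k : ℕ) : List (ℕ × ℕ) :=
  (cand (Nat.sub (Nat.add (wtCode k) 46) (wtCode r))).map fun l => (l, coeffOf k (wkTable l r))

/-- The number of a coordinate of an alternating map. -/
def uid (a b k : ℕ) : ℕ :=
  Nat.add (Nat.mul 34 (bif Nat.ble a b then Nat.add (Nat.mul 34 a) b else Nat.add (Nat.mul 34 b) a)) k

/-- The number of a coordinate `c(e_a, e_a)`. -/
def diagUid (u : ℕ) : Bool := Nat.beq (Nat.div u 1156) (Nat.mod (Nat.div u 34) 34)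

/-- The coordinate `k` of `c([e_p, e_q], e_s) + [c(e_p, e_q), e_s]`. -/
def cocyclePart (p q s k : ℕ) : List (ℕ × ℕ) :=
  ((wkTable p q).map fun t => (uid t.1 s k, t.2)) ++
    (rowList s k).map fun t => (uid p q t.1, t.2)

/-- The coordinate `k` of the cocycle identity on a triple of basis vectors. -/
def cocycleList (a b d k : ℕ) : List (ℕ × ℕ) :=
  cocyclePart a b d k ++ (cocyclePart b d a k ++ cocyclePart d a b k)

/-- The equation with the given code. -/
def cocycleEqn (c : ℕ) : List (ℕ × ℕ) :=
  cocycleList (Nat.mod (Nat.div c 39304) 34) (Nat.mod (Nat.div c 1156) 34)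
    (Nat.mod (Nat.div c 34) 34) (Nat.mod c 34)

/-- The coordinate number `p` for the matrix of `f`, where `p = 34 a + k` stands for the coordinate
`k` of `f e_a`, in the coordinate `k` of `f[e_a, e_b] + [f e_a, e_b] + [e_a, f e_b]`. -/
def boundaryList (a b k : ℕ) : List (ℕ × ℕ) :=
  ((wkTable a b).map fun t => (Nat.add (Nat.mul 34 t.1) k, t.2)) ++
    (((rowList b k).map fun t => (Nat.add (Nat.mul 34 a) t.1, t.2)) ++
      (rowList a k).map fun t => (Nat.add (Nat.mul 34 b) t.1, t.2))

lemma uid_comm (a b k : ℕ) : uid a b k = uid b a k := by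
  rcases lt_trichotomy a b with h | rfl | h
  · have h1 : Nat.ble a b = true := Nat.ble_eq.mpr h.le
    have h2 : Nat.ble b a = false := by
      rw [Bool.eq_false_iff, ne_eq, Nat.ble_eq]; omega
    rw [uid, uid, h1, h2, cond_true, cond_false]
  · rfl
  · have h1 : Nat.ble b a = true := Nat.ble_eq.mpr h.le
    have h2 : Nat.ble a b = false := by
      rw [Bool.eq_false_iff, ne_eq, Nat.ble_eq]; omega
    rw [uid, uid, h1, h2, cond_true, cond_false]

lemma uid_of_le {a b : ℕ} (h : a ≤ b) (k : ℕ) : uid a b k = 34 * (34 * a + b) + k := by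
  rw [uid, Nat.ble_eq.mpr h]; rfl

lemma cand_nodup (s : ℕ) : (cand s).Nodup := by
  unfold cand
  cases Nat.beq (ofCode s) 0 <;> cases Nat.beq (ofCode s) 35 <;> simp

lemma mem_cand : ∀ l < 34, l ∈ cand (wtCode l) := by decide +kernel

-- The numeral in `ofCode` has at most 128 entries of six bits. Larger arguments shift it to zero,
-- which leaves finitely many cases.
set_option exponentiation.threshold 800 in
lemma ofCode_lt (s : ℕ) : Nat.beq (ofCode s) 0 = false → Nat.beq (ofCode s) 35 = false →
    Nat.sub (ofCode s) 1 < 34 := by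
  intro h1 h2
  by_cases hs : s < 128
  · have : ∀ s < 128, Nat.beq (ofCode s) 0 = false → Nat.beq (ofCode s) 35 = false →
      Nat.sub (ofCode s) 1 < 34 := by decide +kernel
    exact this s hs h1 h2
  · exfalso
    have : ofCode s = 0 := by
      unfold ofCode
      have h3 : ∀ n : ℕ, n < 2 ^ 768 → Nat.shiftRight n (Nat.mul 6 s) = 0 := by
        intro n hn
        change n >>> (6 * s) = 0
        rw [Nat.shiftRight_eq_div_pow]
        exact Nat.div_eq_of_lt (hn.trans_le (Nat.pow_le_pow_right (by omega) (by omega)))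
      rw [h3 _ (by norm_num)]
      rfl
    rw [this] at h1
    exact absurd h1 (by decide)

lemma cand_lt {s l : ℕ} (h : l ∈ cand s) : l < 34 := by
  unfold cand at h
  cases h1 : Nat.beq (ofCode s) 0
  · cases h2 : Nat.beq (ofCode s) 35
    · rw [h1, h2, cond_false, cond_false, List.mem_singleton] at h
      exact h ▸ ofCode_lt s h1 h2
    · rw [h1, h2, cond_false, cond_true] at h
      revert l; decide
  · rw [h1, cond_true] at h
    simp at h

lemma rowList_lt {r k : ℕ} {t : ℕ × ℕ} (h : t ∈ rowList r k) : t.1 < 34 := by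
  obtain ⟨l, hl, rfl⟩ := List.mem_map.mp h
  exact cand_lt hl

variable {K : Type*} [Field K]

/-- The coordinates of a bilinear map. -/
def coord (F : Vec K →ₗ[K] Vec K →ₗ[K] Vec K) (n : ℕ) : K :=
  F (e (gen (n / 1156))) (e (gen (n / 34 % 34))) (gen (n % 34))

/-- The entries of the matrix of a linear map. -/
def entry (f : Vec K →ₗ[K] Vec K) (n : ℕ) : K := f (e (gen (n / 34))) (gen (n % 34))

lemma entry_apply (f : Vec K →ₗ[K] Vec K) {a k : ℕ} (hk : k < 34) :
    entry f (34 * a + k) = f (e (gen a)) (gen k) := by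
  have h1 : (34 * a + k) / 34 = a := by omega
  have h2 : (34 * a + k) % 34 = k := by omega
  rw [entry, h1, h2]

variable {F : Vec K →ₗ[K] Vec K →ₗ[K] Vec K}

lemma coord_uid (hF : IsAlternating F) {a b k : ℕ} (ha : a < 34) (hb : b < 34) (hk : k < 34) :
    coord F (uid a b k) = F (e (gen a)) (e (gen b)) (gen k) := by
  wlog hab : a ≤ b generalizing a b
  · rw [uid_comm, this hb ha (not_le.mp hab).le, hF.symm]
  · rw [uid_of_le hab, coord]
    have h1 : (34 * (34 * a + b) + k) / 1156 = a := by omega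
    have h2 : (34 * (34 * a + b) + k) / 34 % 34 = b := by omega
    have h3 : (34 * (34 * a + b) + k) % 34 = k := by omega
    rw [h1, h2, h3]

lemma coord_diagUid (hF : IsAlternating F) {u : ℕ} (h : diagUid u = true) : coord F u = 0 := by
  have h' : u / 1156 = u / 34 % 34 := Nat.eq_of_beq_eq_true h
  rw [coord, h', hF.self]; rfl

variable [CharP K 2] {α : K} 

lemma lin_ev_eq_zero {φ : ℕ → K} {l : List (ℕ × ℕ)} (h : isZero l = true) :
    lin (ev α) φ l = 0 := lin_eq_zero (ev_xor α) (ev_zero α) h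

omit [CharP K 2] in
lemma den_apply_lin {f : Vec K →ₗ[K] Vec K} (l : List (ℕ × ℕ)) (k : Gen) :
    f (den α l) k = lin (ev α) (fun n => f (e (gen n)) k) l := by
  induction l with
  | nil => simp
  | cons t l ih => rw [den_cons, map_add, map_smul, lin_cons, ← ih]; simp

variable (hα0 : α ≠ 0) (hα1 : α ≠ 1)
include hα0 hα1

/-- A coordinate of `[u, e_r]` in terms of the coordinates of `u`. -/
lemma wk4_row (u : Vec K) {r k : ℕ} (hr : r < 34) (hk : k < 34) :
    wk4 α u (e (gen r)) (gen k) = lin (ev α) (fun n => u (gen n)) (rowList r k) := by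
  have hT := isTable_wk4 hα0 hα1
  set s := Nat.sub (Nat.add (wtCode k) 46) (wtCode r)
  have h1 : wk4 α u (e (gen r)) (gen k) = ∑ g, u g * wk4 α (e g) (e (gen r)) (gen k) := by
    conv_lhs => rw [vec_eq_sum u]
    rw [map_sum, LinearMap.sum_apply, Finset.sum_apply]
    exact Finset.sum_congr rfl fun g _ => by
      rw [map_smul, LinearMap.smul_apply, Pi.smul_apply, smul_eq_mul]
  have hnd : ((cand s).map gen).Nodup := by
    refine (List.nodup_map_iff_inj_on (cand_nodup s)).mpr fun x hx y hy h => ?_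
    rw [← idx_gen (cand_lt hx), h, idx_gen (cand_lt hy)]
  -- Homogeneity discards every basis vector outside the few whose weight is the difference of the
  -- weights of `gen k` and `gen r`.
  have h2 : ∑ g, u g * wk4 α (e g) (e (gen r)) (gen k) =
      ∑ g ∈ ((cand s).map gen).toFinset, u g * wk4 α (e g) (e (gen r)) (gen k) := by
    symm
    refine Finset.sum_subset (Finset.subset_univ _) fun g _ hg => ?_
    rw [isHomogeneous_wk4 hα0 hα1 g (gen r) (gen k) ?_, mul_zero]
    intro hw
    refine hg (List.mem_toFinset.mpr (List.mem_map.mpr ⟨idx g, ?_, gen_idx g⟩))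
    have hs : s = wtCode (idx g) := by
      have e1 := wtCode_eq (gen k)
      have e2 := wtCode_eq (gen r)
      have e3 := wtCode_eq g
      rw [hw, add_zero, wtForm_add, idx_gen hk] at e1
      rw [idx_gen hr] at e2
      change wtCode k + 46 - wtCode r = _
      omega
    rw [hs]
    exact mem_cand _ (idx_lt g)
  rw [h1, h2, List.sum_toFinset _ hnd, lin, rowList, List.map_map, List.map_map]
  congr 1
  refine List.map_congr_left fun l hl => ?_
  have hl' := cand_lt hl
  simp only [Function.comp_apply]
  rw [hT l hl' r hr, den_apply α (inRange_wkTable l hl' r hr), idx_gen hk, mul_comm]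

lemma cocyclePart_eq (hF : IsAlternating F) {p q s k : ℕ} (hp : p < 34) (hq : q < 34)
    (hs : s < 34) (hk : k < 34) :
    lin (ev α) (coord F) (cocyclePart p q s k) =
      (F (wk4 α (e (gen p)) (e (gen q))) (e (gen s)) +
        wk4 α (F (e (gen p)) (e (gen q))) (e (gen s))) (gen k) := by
  rw [cocyclePart, lin_append, lin_map (f := fun n => uid n s k),
    lin_map (f := fun n => uid p q n), Pi.add_apply, wk4_row hα0 hα1 _ hs hk,
    isTable_wk4 hα0 hα1 p hp q hq, ← LinearMap.flip_apply F, den_apply_lin]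
  congr 1
  · exact lin_congr _ _ fun t ht =>
      coord_uid hF (inRange_wkTable p hp q hq t ht) hs hk
  · exact lin_congr _ _ fun t ht => coord_uid hF hp hq (rowList_lt ht)

/-- The base 34 digits of `n` are three basis vectors and a coordinate. Since the digits are reduced
modulo 34, every number codes a valid equation, and no condition on the certificate is required. -/
lemma cocycleEqn_eq_zero {c : (bgl4 α).PreCochain} (hc : c ∈ (bgl4 α).Z2)
    (hF : IsAlternating c.1) (n : ℕ) : lin (ev α) (coord c.1) (cocycleEqn n) = 0 := by
  have hm : ∀ m : ℕ, Nat.mod m 34 < 34 := fun m => Nat.mod_lt m (by omega)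
  rw [cocycleEqn, cocycleList, lin_append, lin_append, cocyclePart_eq hα0 hα1 hF (hm _) (hm _)
    (hm _) (hm _), cocyclePart_eq hα0 hα1 hF (hm _) (hm _) (hm _) (hm _),
    cocyclePart_eq hα0 hα1 hF (hm _) (hm _) (hm _) (hm _)]
  generalize gen (Nat.mod (Nat.div n 39304) 34) = a
  generalize gen (Nat.mod (Nat.div n 1156) 34) = b
  generalize gen (Nat.mod (Nat.div n 34) 34) = d
  have h4 : c.1 (wk4 α (e a) (e b)) (e d) + c.1 (wk4 α (e b) (e d)) (e a) +
    c.1 (wk4 α (e d) (e a)) (e b) + (wk4 α (c.1 (e a) (e b)) (e d) +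
    wk4 α (c.1 (e b) (e d)) (e a) + wk4 α (c.1 (e d) (e a)) (e b)) = 0 :=
    hc.2.2.2.1 (e a) (e b) (e d)
  have h5 := congrFun h4 (gen (Nat.mod n 34))
  simp only [Pi.add_apply, Pi.zero_apply] at h5 ⊢
  rw [← h5]
  ring

/-- The differential in coordinates. -/
lemma boundaryList_eq {f : Vec K →ₗ[K] Vec K}
    (h : ∀ u v, F u v = f (wk4 α u v) + wk4 α (f u) v + wk4 α u (f v))
    {a b k : ℕ} (ha : a < 34) (hb : b < 34) (hk : k < 34) :
    F (e (gen a)) (e (gen b)) (gen k) = lin (ev α) (entry f) (boundaryList a b k) := by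
  rw [boundaryList, lin_append, lin_append, lin_map (f := fun n => Nat.add (Nat.mul 34 n) k),
    lin_map (f := fun n => Nat.add (Nat.mul 34 a) n),
    lin_map (f := fun n => Nat.add (Nat.mul 34 b) n), h,
    isAlternating_wk4.symm (e (gen a)) (f _), Pi.add_apply, Pi.add_apply, wk4_row hα0 hα1 _ hb hk,
    wk4_row hα0 hα1 _ ha hk, isTable_wk4 hα0 hα1 a ha b hb, den_apply_lin, add_assoc]
  congr 1
  · exact lin_congr _ _ fun t _ => (entry_apply f hk).symm
  · congr 1
    · exact lin_congr _ _ fun t ht => (entry_apply f (rowList_lt ht)).symm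
    · exact lin_congr _ _ fun t ht => (entry_apply f (rowList_lt ht)).symm

end Equations


/-! ## The coordinates of even weight -/

section Certificate

/-- Coordinates `(a, b, k)` of alternating maps and matrix units, mapping `e_p` to `e_r`, such that
the matrix of the values of the coordinates on the differentials of the matrix units is
triangular. -/
def gaugeList : List (ℕ × ℕ × ℕ × ℕ × ℕ) :=
  [(1, 15, 1, 15, 15), (3, 15, 3, 15, 17), (2, 15, 2, 15, 18), (0, 15, 0, 15, 16),
    (1, 16, 1, 16, 15), (3, 16, 3, 16, 17), (2, 16, 2, 16, 18), (0, 16, 0, 16, 16),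
    (1, 17, 1, 17, 15), (3, 17, 3, 17, 17), (2, 17, 2, 17, 18), (0, 17, 0, 17, 16),
    (1, 18, 1, 18, 15), (3, 18, 3, 18, 17), (2, 18, 2, 18, 18), (0, 18, 0, 18, 16),
    (0, 19, 15, 19, 19), (1, 20, 16, 20, 20), (2, 21, 17, 21, 21), (3, 22, 18, 22, 22),
    (0, 1, 4, 4, 4), (19, 20, 23, 23, 23), (0, 2, 5, 5, 5), (19, 21, 24, 24, 24),
    (2, 3, 6, 6, 6), (21, 22, 25, 25, 25), (2, 4, 7, 7, 7), (21, 23, 26, 26, 26),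
    (3, 5, 8, 8, 8), (22, 24, 27, 27, 27), (4, 5, 9, 9, 9), (23, 24, 28, 28, 28),
    (4, 6, 10, 10, 10), (23, 25, 29, 29, 29), (4, 8, 11, 11, 11), (23, 27, 30, 30, 30),
    (7, 8, 12, 12, 12), (26, 27, 31, 31, 31), (8, 9, 13, 13, 13), (27, 28, 32, 32, 32),
    (9, 10, 14, 14, 14), (28, 29, 33, 33, 33), (1, 13, 33, 14, 33), (0, 12, 32, 13, 32),
    (2, 11, 31, 12, 31), (0, 10, 30, 11, 30), (0, 7, 28, 9, 28), (1, 8, 29, 10, 29),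
    (1, 5, 26, 7, 26), (0, 1, 23, 4, 23), (0, 6, 27, 8, 27), (0, 2, 24, 5, 24),
    (0, 4, 1, 0, 19), (1, 4, 0, 1, 20), (2, 3, 25, 6, 25), (2, 5, 0, 2, 21), (3, 6, 2, 3, 22),
    (2, 22, 6, 22, 3), (0, 21, 5, 21, 2), (0, 25, 8, 25, 6), (0, 20, 4, 20, 1),
    (1, 19, 4, 19, 0), (1, 24, 7, 24, 5), (1, 27, 10, 27, 8), (2, 23, 7, 23, 4),
    (0, 26, 9, 26, 7), (0, 29, 11, 29, 10), (3, 28, 11, 28, 9), (2, 30, 12, 30, 11),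
    (0, 31, 13, 31, 12), (1, 32, 14, 32, 13), (20, 32, 14, 33, 14)]

/-- For each root vector `g` with a cocycle of weight `-2γ_g`, a coordinate `(a, b, k)` of this weight
that vanishes on coboundaries. -/
def classList : List (ℕ × ℕ × ℕ × ℕ) :=
  [(12, 2, 8, 33), (11, 0, 3, 33), (9, 0, 14, 3), (10, 1, 3, 31), (8, 3, 12, 1), (7, 1, 2, 28),
    (4, 1, 9, 2), (5, 2, 9, 1), (0, 9, 20, 2), (31, 21, 27, 14), (30, 2, 27, 14),
    (28, 3, 19, 14), (29, 0, 22, 14), (27, 1, 22, 12), (26, 0, 3, 14), (23, 2, 8, 14),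
    (24, 1, 3, 12), (19, 1, 2, 9)]

/-- Triples of basis vectors and coordinates, in the order in which the cocycle identities determine
the coordinates of a cocycle. -/
def stepList : List ℕ :=
  [1231, 1335, 1670, 1704, 1738, 1772, 1803, 2422, 2827, 2861, 2895, 2929, 2960, 4117, 4839,
    5274, 7186, 7255, 8446, 16844, 18001, 19158, 19159, 19160, 20314, 20315, 20316, 21470,
    21471, 21472, 22734, 23119, 42331, 43455, 43521, 45601, 45635, 45669, 45703, 47091, 50661,
    53041, 54231, 54856, 57189, 57223, 57257, 57340, 57445, 57798, 58379, 58413, 58496, 59569,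
    59653, 59654, 60809, 60810, 63194, 82222, 82592, 82626, 82660, 82694, 82793, 82826, 83516,
    83620, 86264, 89735, 89966, 96679, 96783, 96820, 96855, 97834, 97835, 97976, 98874, 98991,
    100146, 102462, 103864, 122717, 123321, 123942, 124011, 124210, 124244, 124278, 124312,
    124344, 125602, 126524, 126558, 126592, 126626, 128905, 132544, 132841, 134031, 135221,
    136194, 136264, 137172, 138179, 138330, 138435, 138612, 139486, 141800, 144429, 163515,
    163549, 163617, 163649, 164907, 166985, 167019, 167087, 171612, 171714, 175532, 175603,
    175709, 176359, 176509, 176617, 176723, 177515, 177665, 177773, 177844, 177879, 177915,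
    178671, 178821, 179177, 179876, 179981, 204178, 205335, 208636, 208670, 208805, 209793,
    209827, 209861, 215847, 215956, 215991, 216099, 217255, 217290, 218042, 218159, 218232,
    218268, 218303, 218411, 219213, 219215, 219216, 221633, 222790, 225209, 225244, 225419,
    249300, 251715, 252872, 257499, 260865, 260866, 260971, 262128, 263285, 265774, 265844,
    288402, 297807, 325494, 326752, 331548, 333971, 334044, 337113, 339456, 340695, 340696,
    340697, 340698, 341961, 343118, 344275, 344381, 345432, 346624, 367112, 373383, 376418,
    376602, 381156, 381158, 385927, 387119, 418068, 419289, 420494, 427684, 427719, 455227,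
    455309, 458891, 459782, 459865, 459866, 459867, 459868, 461132, 464567, 464603, 494336,
    496681, 496714, 496846, 496910, 496961, 497036, 497969, 499091, 499156, 500279, 500395,
    500542, 501432, 501590, 501663, 502637, 502639, 502640, 502784, 502820, 503868, 503941,
    504012, 505025, 505098, 506255, 507412, 508604, 508639, 533641, 533775, 533808, 533938,
    533986, 533988, 534061, 536337, 537341, 539651, 541926, 543133, 543243, 543315, 544326,
    544400, 546750, 547907, 549099, 573361, 770636, 770844, 772104, 775538, 776591, 777851,
    1370, 1578, 1836, 1953, 1954, 1956, 2167, 3026, 3143, 3287, 6752, 7869, 8879, 8976, 9059,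
    12595, 12598, 12672, 12708, 13825, 42519, 43782, 46236, 49240, 49340, 55025, 55126, 55227,
    55294, 55327, 55359, 55390, 55421, 55469, 55472, 83158, 84133, 84203, 84384, 1597, 16863,
    44368, 44401, 45491, 45590, 48891, 49056, 50179, 52488, 53641, 54824, 54909, 54943, 54977,
    2718, 6185, 6218, 7274, 7406, 8561, 12026, 14329, 14349, 14414, 14448, 14482, 14516, 14585,
    16895, 2549, 41920, 45320, 53887, 82413, 83535, 85880, 85946, 88191, 88256, 88347, 88349,
    89411, 90566, 90627, 91749, 91766, 91804, 91865, 91933, 91967, 92002, 92139, 94312, 95604,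
    123961, 124126, 124189, 126436, 126467, 164584, 164615, 1290, 1458, 3736, 3803, 3836, 3899,
    3959, 3962, 4991, 5054, 7333, 7414, 7683, 8488, 11949, 12043, 12100, 12134, 12168, 12202,
    12477, 16923, 17097, 48996, 49298, 52469, 52936, 55073, 55246, 128726, 129061, 132526, 1354,
    1601, 2794, 4820, 4886, 6041, 8413, 8469, 8578, 8630, 8664, 8698, 8732, 16950, 17055, 17196,
    45532, 50160, 55206, 55346, 89392, 94509, 95661, 171855, 171962, 208958, 210007, 247106,
    285254, 286618, 325607, 366310, 41748, 42971, 43037, 43070, 43103, 43196, 43198, 43214,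
    43450, 44159, 44225, 45446, 46535, 46630, 46687, 47088, 48908, 48926, 48965, 49037, 49091,
    49125, 49159, 49193, 49228, 49399, 49537, 52693, 54019, 55000, 55173, 55313, 1250, 41776,
    41809, 41938, 41939, 41993, 42066, 42394, 42566, 44119, 45338, 45390, 45427, 45500, 45571,
    45620, 45654, 45688, 45722, 45758, 45861, 46033, 46137, 49326, 50378, 53940, 54118, 54981,
    55080, 55271, 55378, 62048, 1307, 1308, 1396, 1467, 1644, 1689, 1723, 1757, 1791, 2243,
    17258, 43084, 44206, 44312, 50439, 50543, 50580, 51733, 52886, 52957, 55054, 55154, 55187,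
    55252, 64530, 67930, 126877, 129186, 163730, 163835, 165025, 166392, 2441, 3663, 3696, 3880,
    6006, 7223, 7473, 7507, 7541, 7575, 82451, 82525, 124033, 124070, 124107, 124143, 132480,
    132482, 132585, 132692, 133740, 133845, 133916, 208782, 210040, 210145, 246930, 247139,
    285078, 285287, 325640, 325815, 2497, 2499, 2551, 2587, 2622, 2846, 2880, 2914, 2948, 3087,
    7708, 88172, 89708, 89709, 89813, 90025, 92007, 92073, 92334, 94391, 94424, 94639, 94675,
    102506, 104956, 163697, 163802, 203772, 204470, 205068, 205307, 205766, 4235, 5080, 5135,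
    5169, 5203, 5320, 5425, 5778, 8774, 9998, 10115, 10185, 10257, 10330, 11089, 11221, 11303,
    12246, 12411, 12565, 13404, 13794, 14596, 14729, 14762, 14860, 14945, 23860, 23999, 25293,
    29815, 124561, 41757, 42350, 43018, 43540, 44349, 44438, 44472, 44589, 44590, 44765, 44871,
    45047, 45920, 49490, 55440, 46945, 82297, 82298, 82348, 82420, 82493, 82611, 82679, 82713,
    82749, 82887, 83059, 88524, 90972, 92301, 41790, 42317, 84600, 84739, 84898, 84966, 85000,
    85049, 85051, 85190, 85331, 85437, 86309, 87499, 92365, 3677, 4136, 43051, 43474, 122817,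
    125428, 125462, 125579, 125580, 125683, 125755, 125932, 126910, 127994, 129290, 3068, 22715,
    45842, 63175, 85246, 85312, 87692, 89772, 90038, 99014, 100170, 104907, 104977, 105049,
    105122, 1877, 4190, 4290, 4323, 5513, 12286, 12616, 18059, 19215, 20371, 21527, 25107,
    25180, 25216, 25359, 2016, 5552, 5618, 8954, 9152, 18198, 19354, 20510, 21666, 25032, 25197,
    26287, 29833, 29906, 29980, 2999, 6569, 6668, 7626, 7923, 14566, 14995, 18024, 19180, 20336,
    21492, 23917, 24025, 24131, 24273, 41729, 41901, 42269, 42403, 42436, 42584, 42585, 42658,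
    42731, 45301, 45739, 46036, 46197, 46896, 47162, 47276, 47352, 49209, 49572, 49661, 53836,
    54268, 57294, 58450, 59606, 60762, 62066, 62173, 62244, 62279, 62315, 62421, 1271, 43497,
    43598, 43664, 43697, 43730, 43842, 43844, 43879, 44821, 44887, 45072, 49279, 49380, 49611,
    49642, 52850, 53115, 57467, 58623, 59779, 60935, 61989, 62154, 64400, 64548, 64695, 67948,
    68019, 68056, 68129, 68200, 1917, 42478, 45947, 46014, 48394, 50640, 50740, 50773, 50806,
    57572, 58728, 59884, 61040, 62128, 62260, 65562, 65661, 65806, 65843, 68037, 69126, 69240,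
    69316, 71518, 71555, 71594, 71666, 84162, 166340, 166373, 168719, 286632, 2530, 82868,
    86438, 86537, 88549, 88650, 88818, 88883, 88993, 88995, 92120, 92450, 96737, 97893, 99049,
    100205, 101259, 101457, 102515, 102697, 102770, 106097, 106167, 106204, 106277, 106348,
    124485, 124716, 124835, 204149, 204483, 204593, 4161, 4363, 4430, 4463, 4526, 4605, 4608,
    7664, 7832, 7997, 8060, 12458, 12689, 18233, 19389, 20545, 21701, 24230, 25423, 31023,
    31098, 31135, 31207, 141757, 141858, 141924, 141990, 142980, 143178, 143209, 145390, 146643,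
    3176, 3310, 6812, 6845, 9092, 18337, 19493, 20649, 21805, 23881, 26327, 26427, 26490, 26569,
    26572, 27645, 30043, 31079, 34559, 34599, 34672, 102590, 102788, 108402, 108501, 108563,
    109656, 181333, 181366, 191761, 220734, 377954, 43568, 63385, 82906, 82973, 83040, 103845,
    124657, 125880, 125913, 126970, 132886, 132919, 136215, 139683, 140771, 140838, 141016,
    145327, 145460, 145606, 146680, 146799, 148988, 149077, 151318, 151355, 151392, 151428,
    249642, 249675, 327094, 327127, 42616, 63455, 84266, 87768, 90114, 90147, 96980, 99292,
    100448, 101436, 101570, 101636, 101700, 104937, 105004, 105103, 105135, 105167, 106126,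
    106258, 106290, 110847, 110959, 112002, 113157, 113237, 114359, 114395, 114433, 205714,
    219483, 298224, 2224, 5726, 5759, 18407, 19563, 20719, 21875, 28676, 36939, 36978, 64580,
    69102, 182526, 185960, 187082, 188204, 221863, 221896, 225330, 265790, 300538, 306250,
    344432, 346710, 382614, 384892, 387170, 423074, 427630, 464690, 466968, 468090, 57746,
    58902, 60058, 61214, 62336, 63525, 66992, 68082, 68181, 71482, 71647, 72770, 75079, 76232,
    77434, 23100, 27690, 104020, 109732, 144480, 152470, 653086, 813735, 813768, 814957, 818423,
    819546, 821855, 823008, 824210]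

/-- The coordinates of a root modulo 2, as bits. -/
def nibble (a : ℕ) : ℕ := bif isCartan a then 0 else
  Nat.land (Nat.shiftRight 0x9baef6d7c538421 (Nat.mul 4 (absIdx a))) 15

/-- Whether a coordinate has a weight in twice the root lattice. -/
def evenCoord (a b k : ℕ) : Bool :=
  Nat.beq (Nat.xor (Nat.xor (nibble a) (nibble b)) (nibble k)) 0

/-- The coordinates that may be assumed to vanish. -/
def startList : List ℕ :=
  (gaugeList.map fun t => uid t.1 t.2.1 t.2.2.1) ++
    ((classList.map fun t => uid t.2.1 t.2.2.1 t.2.2.2) ++ [uid 0 19 18])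

/-- All coordinates of even weight are in the bit set. -/
def evenKnown (known : ℕ) : Bool :=
  allBelow 34 fun a => allBelow a fun b => allBelow 34 fun k =>
    !evenCoord b a k || bit known (uid b a k)

-- The elimination behind the upper bound for the cohomology. Its pivots are units for every
-- admissible `α`, so no value of `α` needs separate treatment.
set_option maxRecDepth 100000 in
lemma propagate_even :
    force (bitSet startList) (propagate diagUid cocycleEqn stepList evenKnown) = true := by
  decide +kernel

end Certificate

/-! ## Coboundaries -/

section Boundary

variable {K : Type*} [Field K]

/-- The differential of a linear map. -/
def boundary (α : K) (f : Vec K →ₗ[K] Vec K) : (bgl4 α).PreCochain :=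
  ((wk4 α).compr₂ f + ((wk4 α).comp f + (wk4 α).compl₂ f),
    f.compQuadraticMap (bgl4 α).sq + LinearMap.BilinMap.toQuadraticMap
      (((wk4 α).compl₂ f).domRestrict₁₂ (bgl4 α).oddPart (bgl4 α).oddPart))

lemma boundary_mem_B2 (α : K) (f : Vec K →ₗ[K] Vec K) : boundary α f ∈ (bgl4 α).B2 :=
  ⟨f, fun _ _ => (add_assoc _ _ _).symm, fun _ => rfl⟩

variable [CharP K 2] {α : K}

/-- For odd `x` the polarization gives `0 = q(x + x) = 2 q(x) + c(x, x)`, hence `c(x, x) = 0`. For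
mixed vectors the two cross terms are equal and cancel. -/
lemma isAlternating_of_mem_Z2 {c : (bgl4 α).PreCochain} (hc : c ∈ (bgl4 α).Z2) :
    IsAlternating c.1 := by
  obtain ⟨h1, h2, h3, -, -⟩ := hc
  refine ⟨h1, fun u => ?_⟩
  have hodd : ∀ x : (bgl4 α).oddPart, c.1 x x = 0 := fun x => by
    have h := h3 x x
    have hx : x + x = 0 := Subtype.ext (vec_add_self (x : Vec K))
    rwa [hx, QuadraticMap.map_zero, vec_add_self, zero_add, eq_comm] at h
  obtain ⟨u₀, h0, u₁, hu1, rfl⟩ : ∃ u₀ ∈ (bgl4 α).evenPart, ∃ u₁ ∈ (bgl4 α).oddPart,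
      u₀ + u₁ = u := by
    have := (isCompl_parts α).sup_eq_top ▸ Submodule.mem_top (x := u)
    exact Submodule.mem_sup.mp this
  have := hodd ⟨u₁, hu1⟩
  simp only [map_add, LinearMap.add_apply] at this ⊢
  rw [h2 u₀ h0, this, h1 u₁ u₀, zero_add, add_zero, vec_add_self]

/-- Coboundaries are cocycles. -/
lemma SuperAlg.IsLieSuperalgebra.B2_le_Z2 {L : SuperAlg K (Vec K)} (hL : L.IsLieSuperalgebra)
    (halt : IsAlternating L.bracket) (hlie : IsLieBracket L.bracket) : L.B2 ≤ L.Z2 := by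
  rintro c ⟨f, h1, h2⟩
  have hs := halt.symm
  have hz := halt.self
  have hj := hlie.lie_lie halt
  have hj' : ∀ u v w, L.bracket (L.bracket u v) w +
      L.bracket (L.bracket v w) u + L.bracket (L.bracket w u) v = 0 := by
    intro u v w
    rw [hs (L.bracket u v) w, hs (L.bracket v w) u, hs (L.bracket w u) v, ← hlie.jacobi u v w]
    abel
  refine ⟨fun u v => ?_, fun u _ => ?_, fun x y => ?_, fun u v w => ?_, fun x v => ?_⟩
  · rw [h1, h1, hs v u, hs (f v) u, hs v (f u)]
    abel
  · rw [h1, hz, map_zero, zero_add, hs u, vec_add_self]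
  · simp only [h2, h1, hL.sq_add, Submodule.coe_add, map_add, LinearMap.add_apply, hs (f x) y]
    abel
  · have e1 : f (L.bracket (L.bracket u v) w) + f (L.bracket (L.bracket v w) u) +
        f (L.bracket (L.bracket w u) v) = 0 := by
      rw [← map_add, ← map_add, hj', map_zero]
    have e2 := hj' (f u) v w
    have e3 := hj' u (f v) w
    have e4 := hj' u v (f w)
    -- Each of these terms occurs twice in the expanded identity; adding them in pairs makes the two
    -- sides agree term by term.
    have e5 := vec_add_self (L.bracket (f (L.bracket u v)) w + L.bracket (f (L.bracket v w)) u +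
      L.bracket (f (L.bracket w u)) v)
    have e6 := congrArg₂ (· + ·) e1 (congrArg₂ (· + ·) e2 (congrArg₂ (· + ·) e3
      (congrArg₂ (· + ·) e4 e5)))
    simp only [add_zero] at e6
    rw [← e6]
    simp only [h1, map_add, LinearMap.add_apply]
    abel
  · have e1 := hL.sq_bracket x v
    have e2 := hL.sq_bracket x (f v)
    have e3 := hj x (f x) v
    refine vec_add_eq_zero.mp ?_
    simp only [h1, h2, e1, e2, map_add, LinearMap.add_apply, e3]
    have := vec_add_self (f (L.bracket x (L.bracket x v)) + L.bracket (f (L.sq x)) v +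
      L.bracket x (L.bracket x (f v)) + L.bracket x (L.bracket (f x) v) +
      L.bracket (f x) (L.bracket x v) + L.bracket x (f (L.bracket x v)))
    rw [← this]
    abel

variable (hα0 : α ≠ 0) (hα1 : α ≠ 1)
include hα0 hα1

lemma B2_le_Z2 : (bgl4 α).B2 ≤ (bgl4 α).Z2 :=
  (isLieSuperalgebra_bgl4 hα0 hα1).B2_le_Z2 isAlternating_wk4 (isLieBracket_wk4 hα0 hα1)

end Boundary

/-! ## Linear forms in the coordinates -/

section Forms

variable {K : Type*} [Field K]

/-- A linear form in the coordinates of cochains. -/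
def linForm (α : K) (l : List (ℕ × ℕ)) : (bgl4 α).PreCochain →ₗ[K] K where
  toFun c := lin (ev α) (coord c.1) l
  map_add' c d := by
    induction l with
    | nil => simp
    | cons t l ih =>
      rw [lin_cons, lin_cons, lin_cons, ih]
      simp only [coord, Prod.fst_add, LinearMap.add_apply, Pi.add_apply]
      ring
  map_smul' r c := by
    induction l with
    | nil => simp
    | cons t l ih =>
      rw [lin_cons, lin_cons, ih]
      simp only [coord, Prod.smul_fst, LinearMap.smul_apply, Pi.smul_apply, smul_eq_mul,
        RingHom.id_apply]
      ring

/-- The composition of a linear form with the differential. -/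
def substBoundary (l : List (ℕ × ℕ)) : List (ℕ × ℕ) :=
  l.flatMap fun t => scale t.2 (boundaryList (Nat.div t.1 1156) (Nat.mod (Nat.div t.1 34) 34)
    (Nat.mod t.1 34))

/-- Whether all coordinates in a linear form are numbers of coordinates. -/
def formRange (l : List (ℕ × ℕ)) : Bool := l.all fun t => Nat.blt t.1 39304

/-- The linear map with one non-zero entry. -/
def matrixUnit (K : Type*) [Field K] (p r : ℕ) : Vec K →ₗ[K] Vec K :=
  (LinearMap.toSpanSingleton K (Vec K) (e (gen r))).comp (LinearMap.proj (gen p))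

variable [CharP K 2] {α : K}

lemma lin_scale (φ : ℕ → K) (c : ℕ) (l : List (ℕ × ℕ)) :
    lin (ev α) φ (scale c l) = ev α c * lin (ev α) φ l := by
  induction l with
  | nil => simp [scale]
  | cons t l ih =>
    have : scale c (t :: l) = (t.1, pmul t.2 c) :: scale c l := rfl
    rw [this, lin_cons, ih, lin_cons, ev_pmul]
    ring

omit [CharP K 2] in
lemma linForm_single (c : (bgl4 α).PreCochain) (u : ℕ) : linForm α [(u, 1)] c = coord c.1 u := by
  change lin _ _ _ = _
  rw [lin_cons, lin_nil, ev_one, one_mul, add_zero]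

variable (hα0 : α ≠ 0) (hα1 : α ≠ 1)
include hα0 hα1

lemma linForm_boundary {c : (bgl4 α).PreCochain} {f : Vec K →ₗ[K] Vec K}
    (h : ∀ u v, c.1 u v = f (wk4 α u v) + wk4 α (f u) v + wk4 α u (f v)) {l : List (ℕ × ℕ)}
    (hl : formRange l = true) :
    linForm α l c = lin (ev α) (entry f) (substBoundary l) := by
  change lin _ _ _ = _
  induction l with
  | nil => rfl
  | cons t l ih =>
    rw [formRange, List.all_cons, Bool.and_eq_true, Nat.blt_eq] at hl
    have hs : substBoundary (t :: l) = scale t.2 (boundaryList (Nat.div t.1 1156)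
      (Nat.mod (Nat.div t.1 34) 34) (Nat.mod t.1 34)) ++ substBoundary l := rfl
    rw [hs, lin_append, lin_cons, ih hl.2, lin_scale]
    congr 2
    refine boundaryList_eq hα0 hα1 h ?_ (Nat.mod_lt _ (by omega)) (Nat.mod_lt _ (by omega))
    omega

/-- Composed with the differential, the form becomes a formal linear form in the matrix entries of
`f`. If it cancels formally, it vanishes on every coboundary. -/
lemma linForm_eq_zero_of_mem_B2 {c : (bgl4 α).PreCochain} (hc : c ∈ (bgl4 α).B2)
    {l : List (ℕ × ℕ)} (hl : formRange l = true) (hz : isZero (substBoundary l) = true) :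
    linForm α l c = 0 := by
  obtain ⟨f, h, -⟩ := hc
  rw [linForm_boundary hα0 hα1 h hl, lin_ev_eq_zero hz]

omit [CharP K 2] hα0 hα1 in
lemma boundaryList_lt {a b k : ℕ} (ha : a < 34) (hb : b < 34) (hk : k < 34) :
    ∀ t ∈ boundaryList a b k, t.1 < 1156 := by
  intro t ht
  have hN : ∀ m n : ℕ, m < 34 → n < 34 → Nat.add (Nat.mul 34 m) n < 1156 := by
    intro m n hm hn
    change 34 * m + n < 1156
    omega
  rw [boundaryList, List.mem_append, List.mem_append] at ht
  rcases ht with ht | ht | ht <;> obtain ⟨s, hs, rfl⟩ := List.mem_map.mp ht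
  · exact hN _ _ (inRange_wkTable a ha b hb s hs) hk
  · exact hN _ _ ha (rowList_lt hs)
  · exact hN _ _ hb (rowList_lt hs)

omit [CharP K 2] hα0 hα1 in
lemma entry_matrixUnit {p r n : ℕ} (hp : p < 34) (hr : r < 34) (hn : n < 1156) :
    entry (matrixUnit K p r) n = if n = 34 * p + r then 1 else 0 := by
  have h : entry (matrixUnit K p r) n =
      (e (gen (n / 34)) : Vec K) (gen p) * (e (gen r) : Vec K) (gen (n % 34)) := by
    simp [entry, matrixUnit]
  have hinj : ∀ {a b : ℕ}, a < 34 → b < 34 → (gen a = gen b ↔ a = b) := fun ha hb =>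
    ⟨fun h => by rw [← idx_gen ha, h, idx_gen hb], fun h => h ▸ rfl⟩
  rw [h]
  simp only [e, Pi.single_apply]
  simp only [hinj hp (show n / 34 < 34 by omega), hinj (show n % 34 < 34 by omega) hr]
  by_cases h1 : p = n / 34 <;> by_cases h2 : n % 34 = r
  · rw [if_pos h1, if_pos h2, if_pos (by omega), one_mul]
  · rw [if_neg h2, mul_zero, if_neg (by omega)]
  · rw [if_neg h1, zero_mul, if_neg (by omega)]
  · rw [if_neg h1, zero_mul, if_neg (by omega)]

lemma coord_boundary_matrixUnit {a b k p r : ℕ} (ha : a < 34) (hb : b < 34) (hk : k < 34)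
    (hp : p < 34) (hr : r < 34) : (boundary α (matrixUnit K p r)).1 (e (gen a)) (e (gen b)) (gen k) =
      ev α (coeffOf (34 * p + r) (boundaryList a b k)) := by
  have h : ∀ u v, (boundary α (matrixUnit K p r)).1 u v = matrixUnit K p r (wk4 α u v) +
    wk4 α (matrixUnit K p r u) v + wk4 α u (matrixUnit K p r v) := fun _ _ => (add_assoc _ _ _).symm
  rw [boundaryList_eq hα0 hα1 h ha hb hk,
    lin_eq_sum (ev_xor α) (ev_zero α) _ (Finset.range 1156)
      fun t ht => Finset.mem_range.mpr (boundaryList_lt ha hb hk t ht),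
    Finset.sum_eq_single (34 * p + r)]
  · rw [entry_matrixUnit hp hr (by omega), if_pos rfl, mul_one]
  · intro n hn hne
    rw [entry_matrixUnit hp hr (Finset.mem_range.mp hn), if_neg hne, mul_zero]
  · intro h
    exact absurd (Finset.mem_range.mpr (by omega)) h

end Forms

/-- The matrix of the coordinates of `gaugeList` is triangular. -/
def gaugeCheck : List (ℕ × ℕ × ℕ × ℕ × ℕ) → Bool
  | [] => true
  | t :: l => (Nat.blt t.1 34 && (Nat.blt t.2.1 34 && (Nat.blt t.2.2.1 34 &&
      (Nat.blt t.2.2.2.1 34 && Nat.blt t.2.2.2.2 34)))) &&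
      (isUnit (coeffOf (34 * t.2.2.2.1 + t.2.2.2.2) (boundaryList t.1 t.2.1 t.2.2.1)) &&
      ((l.all fun s => Nat.beq
        (coeffOf (34 * s.2.2.2.1 + s.2.2.2.2) (boundaryList t.1 t.2.1 t.2.2.1)) 0) && gaugeCheck l))

lemma gaugeCheck_gaugeList : gaugeCheck gaugeList = true := by decide +kernel

/-! ### Normalization of cocycles by coboundaries. -/

section Gauge

variable {K : Type*} [Field K] [CharP K 2] {α : K}

/-- Solving a triangular system: a multiple of `m i` corrects the first form, and the later
corrections are sought in its kernel, where triangularity places the later vectors. -/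
lemma exists_add_apply_eq_zero {ι M : Type*} [AddCommGroup M] [Module K M] (ψ : ι → M →ₗ[K] K)
    (m : ι → M) : ∀ (L : List ι) (S : Submodule K M), L.Pairwise (fun i j => ψ i (m j) = 0) →
      (∀ i ∈ L, ψ i (m i) ≠ 0) → (∀ i ∈ L, m i ∈ S) → ∀ c : M, ∃ b ∈ S, ∀ i ∈ L, ψ i (c + b) = 0
  | [], S, _, _, _, c => ⟨0, S.zero_mem, by simp⟩
  | i :: L, S, hp, hu, hS, c => by
    rw [List.pairwise_cons] at hp
    have hi := hu i List.mem_cons_self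
    obtain ⟨b, hb, hL⟩ := exists_add_apply_eq_zero ψ m L (S ⊓ LinearMap.ker (ψ i)) hp.2
      (fun j hj => hu j (List.mem_cons_of_mem _ hj))
      (fun j hj => ⟨hS j (List.mem_cons_of_mem _ hj), hp.1 j hj⟩)
      (c + (ψ i c / ψ i (m i)) • m i)
    refine ⟨(ψ i c / ψ i (m i)) • m i + b,
      S.add_mem (S.smul_mem _ (hS i List.mem_cons_self)) hb.1, fun j hj => ?_⟩
    rcases List.mem_cons.mp hj with rfl | hj
    · have : ψ j b = 0 := hb.2
      rw [map_add, map_add, this, map_smul, smul_eq_mul, div_mul_cancel₀ _ hi, add_zero,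
        CharTwo.add_self_eq_zero]
    · rw [← hL j hj, add_assoc]

variable (hα0 : α ≠ 0) (hα1 : α ≠ 1)
include hα0 hα1

lemma gauge_triangular : ∀ L : List (ℕ × ℕ × ℕ × ℕ × ℕ), gaugeCheck L = true →
    L.Pairwise (fun t s => linForm α [(uid t.1 t.2.1 t.2.2.1, 1)]
      (boundary α (matrixUnit K s.2.2.2.1 s.2.2.2.2)) = 0) ∧
    ∀ t ∈ L, (t.1 < 34 ∧ t.2.1 < 34 ∧ t.2.2.1 < 34 ∧ t.2.2.2.1 < 34 ∧ t.2.2.2.2 < 34) ∧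
    linForm α [(uid t.1 t.2.1 t.2.2.1, 1)]
      (boundary α (matrixUnit K t.2.2.2.1 t.2.2.2.2)) ≠ 0 := by
  intro L
  induction L with
  | nil => exact fun _ => ⟨List.Pairwise.nil, by simp⟩
  | cons t l ih =>
    intro h
    rw [gaugeCheck] at h
    simp only [Bool.and_eq_true, Nat.blt_eq, List.all_eq_true] at h
    obtain ⟨⟨h1, h2, h3, h4, h5⟩, h6, h7, h8⟩ := h
    obtain ⟨ih1, ih2⟩ := ih h8
    have hv : ∀ p < 34, ∀ r < 34, linForm α [(uid t.1 t.2.1 t.2.2.1, 1)]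
        (boundary α (matrixUnit K p r)) =
        ev α (coeffOf (34 * p + r) (boundaryList t.1 t.2.1 t.2.2.1)) := by
      intro p hp r hr
      rw [linForm_single, coord_uid (isAlternating_of_mem_Z2
        (B2_le_Z2 hα0 hα1 (boundary_mem_B2 α _))) h1 h2 h3,
        coord_boundary_matrixUnit hα0 hα1 h1 h2 h3 hp hr]
    refine ⟨List.pairwise_cons.mpr ⟨fun s hs => ?_, ih1⟩, fun s hs => ?_⟩
    · obtain ⟨-, -, -, h4', h5'⟩ := (ih2 s hs).1
      rw [hv _ h4' _ h5', Nat.eq_of_beq_eq_true (h7 s hs), ev_zero]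
    · rcases List.mem_cons.mp hs with rfl | hs
      · refine ⟨⟨h1, h2, h3, h4, h5⟩, ?_⟩
        rw [hv _ h4 _ h5]
        exact ev_ne_zero hα0 hα1 h6
      · exact ih2 s hs

lemma exists_gauge_of_check {L : List (ℕ × ℕ × ℕ × ℕ × ℕ)} (hL : gaugeCheck L = true)
    (c : (bgl4 α).PreCochain) : ∃ b ∈ (bgl4 α).B2, ∀ t ∈ L,
    linForm α [(uid t.1 t.2.1 t.2.2.1, 1)] (c + b) = 0 := by
  obtain ⟨h1, h2⟩ := gauge_triangular hα0 hα1 L hL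
  exact exists_add_apply_eq_zero (fun t => linForm α [(uid t.1 t.2.1 t.2.2.1, 1)])
    (fun t => boundary α (matrixUnit K t.2.2.2.1 t.2.2.2.2)) L (bgl4 α).B2 h1
    (fun t ht => (h2 t ht).2) (fun t _ => boundary_mem_B2 α _) c

/-- Every cocycle is cohomologous to one for which the coordinates of `gaugeList` vanish. -/
lemma exists_gauge (c : (bgl4 α).PreCochain) : ∃ b ∈ (bgl4 α).B2, ∀ t ∈ gaugeList,
    linForm α [(uid t.1 t.2.1 t.2.2.1, 1)] (c + b) = 0 :=
  exists_gauge_of_check hα0 hα1 gaugeCheck_gaugeList c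

lemma coord_eq_zero_of_propagate {c : (bgl4 α).PreCochain} (hc : c ∈ (bgl4 α).Z2)
    {es start : List ℕ}
    (hp : force (bitSet start) (propagate diagUid cocycleEqn es evenKnown) = true)
    (hs : ∀ u ∈ start, coord c.1 u = 0) {a b k : ℕ} (ha : a < 34) (hb : b < 34) (hk : k < 34)
    (he : evenCoord a b k = true) : c.1 (e (gen a)) (e (gen b)) (gen k) = 0 := by
  have hF := isAlternating_of_mem_Z2 hc
  rw [force_eq] at hp
  obtain ⟨known, h1, h2⟩ := propagate_sound (ev_xor α) (ev_zero α)
    (fun n hn => ev_ne_zero hα0 hα1 hn) (fun u hu => coord_diagUid hF hu)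
    (cocycleEqn_eq_zero hα0 hα1 hc hF) es _ (fun u hu => hs u (mem_of_bit_bitSet hu)) hp
  have key : ∀ a < 34, ∀ b < a, evenCoord b a k = true →
      c.1 (e (gen b)) (e (gen a)) (gen k) = 0 := by
    intro a ha b hb he
    have h3 := allBelow_apply (allBelow_apply (allBelow_apply h2 ha) hb) hk
    rw [he, Bool.not_true, Bool.false_or] at h3
    rw [← coord_uid hF (hb.trans ha) ha hk]
    exact h1 _ h3
  rcases lt_trichotomy a b with h | rfl | h
  · exact key b hb a h he
  · rw [hF.self]; rfl
  · rw [hF.symm]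
    refine key a ha b h ?_
    unfold evenCoord at he ⊢
    rwa [show Nat.xor (nibble b) (nibble a) = Nat.xor (nibble a) (nibble b) from
      Nat.xor_comm _ _]

lemma coord_eq_zero_of_even {c : (bgl4 α).PreCochain} (hc : c ∈ (bgl4 α).Z2)
    (hs : ∀ u ∈ startList, coord c.1 u = 0) {a b k : ℕ} (ha : a < 34) (hb : b < 34) (hk : k < 34)
    (he : evenCoord a b k = true) : c.1 (e (gen a)) (e (gen b)) (gen k) = 0 :=
  coord_eq_zero_of_propagate hα0 hα1 hc propagate_even hs ha hb hk he

end Gauge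

/-! ## The coordinates of odd weight -/

section Homotopy

/-- The value on `h_{j+1}` of a weight with the given coordinates modulo 2. -/
def weightVal (n j : ℕ) : ℕ :=
  bif Nat.beq j 0 then Nat.xor (bif bit n 1 then 2 else 0) (bif bit n 2 then 1 else 0)
  else bif Nat.beq j 1 then (bif bit n 0 then 2 else 0)
  else bif Nat.beq j 2 then Nat.xor (bif bit n 0 then 1 else 0) (bif bit n 3 then 1 else 0)
  else bif bit n 2 then 1 else 0

/-- An index such that the weight does not vanish on the corresponding `h_{j+1}`. -/
def weightSel (n : ℕ) : ℕ := bif bit n 0 then 1 else bif bit n 2 then 3 else bif bit n 1 then 0 else 2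

lemma weightVal_xor : ∀ m < 16, ∀ n < 16, ∀ j < 4,
    weightVal (Nat.xor m n) j = Nat.xor (weightVal m j) (weightVal n j) := by decide +kernel

lemma weightVal_zero : ∀ j, weightVal 0 j = 0 := by
  intro j
  unfold weightVal
  cases Nat.beq j 0 <;> cases Nat.beq j 1 <;> cases Nat.beq j 2 <;> rfl

/-- Nondegeneracy of the Cartan matrix: a weight that is nonzero modulo twice the root lattice takes
an invertible value on some `h_j`. -/
lemma isUnit_weightVal : ∀ n < 16, n = 0 ∨ isUnit (weightVal n (weightSel n)) = true := by
  decide +kernel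

lemma weightSel_lt (n : ℕ) : weightSel n < 4 := by
  unfold weightSel
  cases bit n 0 <;> cases bit n 2 <;> cases bit n 1 <;> decide

lemma nibble_lt : ∀ a < 34, nibble a < 16 := by decide +kernel

lemma nibble_check : (allBelow 34 fun a => allBelow 34 fun b => (wkTable a b).all fun t =>
    Nat.beq (nibble t.1) (Nat.xor (nibble a) (nibble b))) = true := by decide +kernel

lemma wkTable_cartan : ∀ j < 4, ∀ a < 34, wkTable (15 + j) a = single a (weightVal (nibble a) j) := by
  decide +kernel

lemma wkTable_cartan_check : ∀ j < 4, ∀ a < 34,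
    (allBelow 34 fun l => l == a || coeffOf a (wkTable l (15 + j)) == 0) = true ∧
      coeffOf a (wkTable a (15 + j)) = weightVal (nibble a) j := by decide +kernel

/-- No root lies in twice the root lattice, so some `h_j` acts invertibly on each root vector. -/
lemma nibble_root : ∀ a < 34, isCartan a = false → nibble a ≠ 0 := by decide +kernel

variable {K : Type*} [Field K]

/-- The span of the basis vectors whose weight has the given coordinates modulo 2. -/
abbrev nibblePart (K : Type*) [Field K] (n : ℕ) : Submodule K (Vec K) :=
  vanishing K fun g => nibble (idx g) ≠ n

variable [CharP K 2] {α : K}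

/-- The homotopy between a cocycle and zero in the odd weights. -/
def homotopy (α : K) (F : Vec K →ₗ[K] Vec K →ₗ[K] Vec K) : Vec K →ₗ[K] Vec K :=
  LinearMap.pi fun k => ∑ a, ((ev α (weightVal (Nat.xor (nibble (idx a)) (nibble (idx k)))
    (weightSel (Nat.xor (nibble (idx a)) (nibble (idx k))))))⁻¹ *
    F (e (gen (15 + weightSel (Nat.xor (nibble (idx a)) (nibble (idx k)))))) (e a) k) •
      LinearMap.proj a

omit [CharP K 2] in
-- For a fixed residue of `u` and a fixed coordinate `k`, the homotopy is contraction with a single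
-- `h_j` followed by division. The choice of `h_j` depends on `k`, so the formula holds only
-- coordinate by coordinate.
lemma homotopy_apply (F : Vec K →ₗ[K] Vec K →ₗ[K] Vec K) {m : ℕ} {u : Vec K}
    (hu : u ∈ nibblePart K m) (k : Gen) :
    homotopy α F u k = (ev α (weightVal (Nat.xor m (nibble (idx k)))
      (weightSel (Nat.xor m (nibble (idx k))))))⁻¹ *
      F (e (gen (15 + weightSel (Nat.xor m (nibble (idx k)))))) u k := by
  conv_rhs => rw [vec_eq_sum u]
  rw [map_sum, Finset.sum_apply, Finset.mul_sum, homotopy, LinearMap.pi_apply,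
    LinearMap.sum_apply]
  refine Finset.sum_congr rfl fun a _ => ?_
  rw [LinearMap.smul_apply, LinearMap.proj_apply, map_smul, Pi.smul_apply, smul_eq_mul, smul_eq_mul]
  by_cases ha : nibble (idx a) = m
  · rw [ha]; ring
  · rw [hu a ha]; ring

omit [CharP K 2] in
lemma e_mem_nibblePart (a : Gen) : (e a : Vec K) ∈ nibblePart K (nibble (idx a)) := by
  intro g hg
  have : g ≠ a := fun h => hg (h ▸ rfl)
  simp [this]

variable (hα0 : α ≠ 0) (hα1 : α ≠ 1)
include hα0 hα1

lemma wk4_mem_nibblePart (a b : Gen) :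
    wk4 α (e a) (e b) ∈ nibblePart K (Nat.xor (nibble (idx a)) (nibble (idx b))) := by
  have h := List.all_eq_true.mp
    (allBelow_apply (allBelow_apply nibble_check (idx_lt a)) (idx_lt b))
  have hT := isTable_wk4 hα0 hα1 _ (idx_lt a) _ (idx_lt b)
  rw [gen_idx, gen_idx] at hT
  rw [hT]
  have hr := inRange_wkTable _ (idx_lt a) _ (idx_lt b)
  clear hT
  generalize wkTable (idx a) (idx b) = l at *
  induction l with
  | nil => exact Submodule.zero_mem _
  | cons t l ih =>
    rw [den_cons]
    refine Submodule.add_mem _ (Submodule.smul_mem _ _ ?_)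
      (ih (fun s hs => h s (List.mem_cons_of_mem _ hs))
        fun s hs => hr s (List.mem_cons_of_mem _ hs))
    have h1 := e_mem_nibblePart (K := K) (gen t.1)
    rwa [idx_gen (hr t List.mem_cons_self), Nat.eq_of_beq_eq_true (h t List.mem_cons_self)] at h1

/-- The coordinate `k` of a bracket with `e b` sees only coordinates of one residue. The vectors
need to be proportional only there, which is what the homotopy provides. -/
lemma wk4_congr {u u' : Vec K} {r : K} {b k : Gen}
    (h : ∀ g, nibble (idx g) = Nat.xor (nibble (idx k)) (nibble (idx b)) → u g = r * u' g) :
    wk4 α u (e b) k = r * wk4 α u' (e b) k := by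
  have hsum : ∀ u : Vec K, wk4 α u (e b) k = ∑ g, u g * wk4 α (e g) (e b) k := by
    intro u
    conv_lhs => rw [vec_eq_sum u]
    rw [map_sum, LinearMap.sum_apply, Finset.sum_apply]
    exact Finset.sum_congr rfl fun g _ => by
      rw [map_smul, LinearMap.smul_apply, Pi.smul_apply, smul_eq_mul]
  rw [hsum, hsum, Finset.mul_sum]
  refine Finset.sum_congr rfl fun g _ => ?_
  by_cases hg : nibble (idx g) = Nat.xor (nibble (idx k)) (nibble (idx b))
  · rw [h g hg, mul_assoc]
  · rw [wk4_mem_nibblePart hα0 hα1 g b k fun hk => hg ?_, mul_zero, mul_zero, mul_zero]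
    rw [hk]
    exact (Nat.xor_xor_cancel_right _ _).symm

lemma wk4_cartan_left {j : ℕ} (hj : j < 4) (a : Gen) : wk4 α (e (gen (15 + j))) (e a) =
    ev α (weightVal (nibble (idx a)) j) • e a := by
  have := isTable_wk4 hα0 hα1 (15 + j) (by omega) _ (idx_lt a)
  rw [gen_idx] at this
  rw [this, wkTable_cartan j hj _ (idx_lt a), den_single, gen_idx]

lemma wk4_cartan_right {j : ℕ} (hj : j < 4) (u : Vec K) (k : Gen) :
    wk4 α u (e (gen (15 + j))) k = u k * ev α (weightVal (nibble (idx k)) j) := by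
  have h := wkTable_cartan_check j hj _ (idx_lt k)
  have := wk4_apply_root (isTable_wk4 hα0 hα1) inRange_wkTable (b := 15 + j) (by omega) (idx_lt k)
    (idx_lt k) h.1 u
  rwa [gen_idx, h.2] at this

omit hα0 hα1 in
lemma xor_rotate (a b k : ℕ) : Nat.xor a (Nat.xor k b) = Nat.xor (Nat.xor a b) k := by
  change (a ^^^ (k ^^^ b) : ℕ) = (a ^^^ b) ^^^ k
  rw [Nat.xor_comm k, Nat.xor_assoc]

/-- The cocycle identity on `(h_j, e_a, e_b)` says that the differential of the contraction with
`h_j` is the cocycle times the value of its weight on `h_j`. Where this value is a unit, division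
gives the claim. -/
lemma boundary_homotopy {c : (bgl4 α).PreCochain} (hc : c ∈ (bgl4 α).Z2)
    (heven : ∀ a < 34, ∀ b < 34, ∀ k < 34, evenCoord a b k = true →
      c.1 (e (gen a)) (e (gen b)) (gen k) = 0) (a b k : Gen) :
    (boundary α (homotopy α c.1)).1 (e a) (e b) k = c.1 (e a) (e b) k := by
  have hF := isAlternating_of_mem_Z2 hc
  set n := Nat.xor (Nat.xor (nibble (idx a)) (nibble (idx b))) (nibble (idx k)) with hn
  set j := weightSel n with hj
  set μ := (ev α (weightVal n j))⁻¹ with hμ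
  have hn1 : Nat.xor (nibble (idx a)) (Nat.xor (nibble (idx k)) (nibble (idx b))) = n :=
    xor_rotate _ _ _
  have hn2 : Nat.xor (nibble (idx b)) (Nat.xor (nibble (idx k)) (nibble (idx a))) = n := by
    rw [xor_rotate, hn, show Nat.xor (nibble (idx b)) (nibble (idx a)) =
      Nat.xor (nibble (idx a)) (nibble (idx b)) from Nat.xor_comm _ _]
  have t1 : homotopy α c.1 (wk4 α (e a) (e b)) k =
      μ * c.1 (e (gen (15 + j))) (wk4 α (e a) (e b)) k :=
    homotopy_apply c.1 (wk4_mem_nibblePart hα0 hα1 a b) k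
  have t2 : wk4 α (homotopy α c.1 (e a)) (e b) k =
      μ * wk4 α (c.1 (e (gen (15 + j))) (e a)) (e b) k := by
    refine wk4_congr hα0 hα1 fun g hg => ?_
    rw [homotopy_apply c.1 (e_mem_nibblePart a), hg, hn1]
  have t3 : wk4 α (homotopy α c.1 (e b)) (e a) k =
      μ * wk4 α (c.1 (e (gen (15 + j))) (e b)) (e a) k := by
    refine wk4_congr hα0 hα1 fun g hg => ?_
    rw [homotopy_apply c.1 (e_mem_nibblePart b), hg, hn2]
  have hd : (boundary α (homotopy α c.1)).1 (e a) (e b) k =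
      homotopy α c.1 (wk4 α (e a) (e b)) k + (wk4 α (homotopy α c.1 (e a)) (e b) k +
        wk4 α (homotopy α c.1 (e b)) (e a) k) := by
    rw [isAlternating_wk4.symm (homotopy α c.1 (e b))]
    rfl
  rw [hd, t1, t2, t3]
  have hlt : n < 16 := by
    have h1 := nibble_lt _ (idx_lt a)
    have h2 := nibble_lt _ (idx_lt b)
    have h3 := nibble_lt _ (idx_lt k)
    exact Nat.xor_lt_two_pow (n := 4) (Nat.xor_lt_two_pow (n := 4) h1 h2) h3
  rcases isUnit_weightVal n hlt with h0 | hu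
  -- In the residue zero the cocycle vanishes by hypothesis, and the homotopy contributes nothing
  -- because the inverse of zero is zero.
  · have hz := heven _ (idx_lt a) _ (idx_lt b) _ (idx_lt k) (by
      rw [evenCoord, ← hn, h0]; rfl)
    rw [gen_idx, gen_idx, gen_idx] at hz
    rw [hz, hμ, h0, weightVal_zero, ev_zero, inv_zero]
    ring
  · have hu' := ev_ne_zero hα0 hα1 hu
    have hj4 : j < 4 := weightSel_lt n
    have h4 : c.1 (wk4 α (e (gen (15 + j))) (e a)) (e b) + c.1 (wk4 α (e a) (e b)) (e (gen (15 + j))) +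
        c.1 (wk4 α (e b) (e (gen (15 + j)))) (e a) + (wk4 α (c.1 (e (gen (15 + j))) (e a)) (e b) +
        wk4 α (c.1 (e a) (e b)) (e (gen (15 + j))) +
        wk4 α (c.1 (e b) (e (gen (15 + j)))) (e a)) = 0 :=
      hc.2.2.2.1 (e (gen (15 + j))) (e a) (e b)
    have h5 := congrFun h4 k
    rw [isAlternating_wk4.symm (e b) (e (gen (15 + j))), wk4_cartan_left hα0 hα1 hj4,
      wk4_cartan_left hα0 hα1 hj4, hF.symm (e b) (e (gen (15 + j))),
      hF.symm (wk4 α (e a) (e b))] at h5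
    simp only [Pi.add_apply, Pi.zero_apply, map_smul, LinearMap.smul_apply, Pi.smul_apply,
      smul_eq_mul, wk4_cartan_right hα0 hα1 hj4] at h5
    rw [hF.symm (e b) (e a)] at h5
    -- The value of a weight on `h_j` is additive; signs play no role in characteristic 2.
    have h6 : ev α (weightVal n j) = ev α (weightVal (nibble (idx a)) j) +
        ev α (weightVal (nibble (idx b)) j) + ev α (weightVal (nibble (idx k)) j) := by
      rw [hn, weightVal_xor _ _ _ (nibble_lt _ (idx_lt k)) _ hj4, ev_xor,
        weightVal_xor _ (nibble_lt _ (idx_lt a)) _ (nibble_lt _ (idx_lt b)) _ hj4, ev_xor]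
      exact Nat.xor_lt_two_pow (n := 4) (nibble_lt _ (idx_lt a)) (nibble_lt _ (idx_lt b))
    rw [← mul_add, ← mul_add, hμ, inv_mul_eq_iff_eq_mul₀ hu', ← CharTwo.add_eq_zero, ← h5, hj, h6]
    ring

/-- The center is trivial. -/
lemma eq_zero_of_wk4_eq_zero {u : Vec K} (h : ∀ v, wk4 α u v = 0) : u = 0 := by
  have hroot : ∀ a < 34, isCartan a = false → u (gen a) = 0 := by
    intro a ha hc
    have h1 := wk4_cartan_right hα0 hα1 (weightSel_lt (nibble a)) u (gen a)
    rw [h, idx_gen ha] at h1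
    have hu := (isUnit_weightVal _ (nibble_lt a ha)).resolve_left (nibble_root a ha hc)
    exact (mul_eq_zero.mp h1.symm).resolve_right (ev_ne_zero hα0 hα1 hu)
  -- The diagonal coordinates involve only the Cartan part of `u`. The rows of the four simple roots
  -- already force that part to be zero.
  have hrow : ∀ i < 15, lin (ev α) (fun n => u (gen n)) (rowList i i) = 0 := by
    intro i hi
    rw [← wk4_row hα0 hα1 u (by omega) (by omega), h]; rfl
  have h0 := hrow 0 (by omega)
  have h1 := hrow 1 (by omega)
  have h2 := hrow 2 (by omega)
  have h3 := hrow 3 (by omega)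
  have r : rowList 0 0 = [(15, 0), (16, 2), (17, 1), (18, 0)] ∧
      rowList 1 1 = [(15, 2), (16, 0), (17, 0), (18, 0)] ∧
      rowList 2 2 = [(15, 1), (16, 0), (17, 0), (18, 1)] ∧
      rowList 3 3 = [(15, 0), (16, 0), (17, 1), (18, 0)] := by decide +kernel
  rw [r.1] at h0
  rw [r.2.1] at h1
  rw [r.2.2.1] at h2
  rw [r.2.2.2] at h3
  simp only [lin_cons, lin_nil, ev_zero, ev_one, ev_two, zero_mul, one_mul, zero_add, add_zero]
    at h0 h1 h2 h3
  have h15 := (mul_eq_zero.mp h1).resolve_left hα0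
  rw [h15, zero_add] at h2
  rw [h3, add_zero] at h0
  have h16 := (mul_eq_zero.mp h0).resolve_left hα0
  funext g
  rw [← gen_idx g]
  have hg := idx_lt g
  by_cases hc : isCartan (idx g) = true
  · have hcases : ∀ n < 34, isCartan n = true → n = 15 ∨ n = 16 ∨ n = 17 ∨ n = 18 := by decide
    rcases hcases _ hg hc with h | h | h | h <;> rw [h] <;> assumption
  · exact hroot _ hg (Bool.eq_false_iff.mpr hc)

/-- A cocycle is determined by its bilinear part. -/
lemma eq_zero_of_fst_eq_zero {c : (bgl4 α).PreCochain} (hc : c ∈ (bgl4 α).Z2) (h : c.1 = 0) :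
    c = 0 := by
  refine Prod.ext h (QuadraticMap.ext fun x => ?_)
  refine eq_zero_of_wk4_eq_zero hα0 hα1 fun v => ?_
  have := hc.2.2.2.2 x v
  rw [h] at this
  simp only [LinearMap.zero_apply, map_zero, add_zero, zero_add] at this
  exact this

omit hα0 hα1 in
lemma cochain_add_self (c : (bgl4 α).PreCochain) : c + c = 0 := by
  have h : (2 : K) • c = 0 := by rw [CharTwo.two_eq_zero, zero_smul]
  rwa [two_smul] at h

/-- Adding the differential of the homotopy leaves a cocycle without bilinear part, and such a
cocycle is zero. -/
lemma mem_B2_of_even {c : (bgl4 α).PreCochain} (hc : c ∈ (bgl4 α).Z2)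
    (heven : ∀ a < 34, ∀ b < 34, ∀ k < 34, evenCoord a b k = true →
      c.1 (e (gen a)) (e (gen b)) (gen k) = 0) : c ∈ (bgl4 α).B2 := by
  have hb := boundary_mem_B2 α (homotopy α c.1)
  have hcb : c + boundary α (homotopy α c.1) ∈ (bgl4 α).Z2 :=
    (bgl4 α).Z2.add_mem hc (B2_le_Z2 hα0 hα1 hb)
  have h1 : (c + boundary α (homotopy α c.1)).1 = 0 := by
    refine LinearMap.ext fun u => LinearMap.ext fun v => ?_
    rw [bilin_expand]
    refine Finset.sum_eq_zero fun a _ => Finset.sum_eq_zero fun b _ => ?_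
    have : (c + boundary α (homotopy α c.1)).1 (e a) (e b) =
        c.1 (e a) (e b) + (boundary α (homotopy α c.1)).1 (e a) (e b) := rfl
    rw [this, vec_add_eq_zero.mpr (funext fun k => (boundary_homotopy hα0 hα1 hc heven a b k).symm),
      smul_zero]
  have h2 := eq_zero_of_fst_eq_zero hα0 hα1 hcb h1
  generalize boundary α (homotopy α c.1) = b at *
  have h3 : c = b := by
    rw [← add_zero c, ← cochain_add_self b, ← add_assoc, h2, zero_add]
  rw [h3]
  exact hb

end Homotopy

/-! ## The classes -/

section Classes

/-- The numbers of the root vectors `g` with a cocycle of weight `-2γ_g`, and 34 for the cocycle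
of weight zero. -/
def classIdx : List ℕ := specialIdx ++ [34]

/-- A coordinate of weight `-2γ_g` that vanishes on coboundaries. -/
def classUid (g : ℕ) : ℕ :=
  (classList.map fun t => bif Nat.beq t.1 g then uid t.2.1 t.2.2.1 t.2.2.2 else 0).sum

/-- A linear form that vanishes on coboundaries, and on all but one of the basic cocycles. -/
def classForm (g : ℕ) : List (ℕ × ℕ) :=
  -- On the differential of `f` the three coordinates are `f(h_1)_{h_4}`, `f(h_1)_{h_1} +
  -- f(h_1)_{h_4}` and `α f(h_1)_{h_1}`. With the factors `α`, `α`, `1` they cancel.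
  bif Nat.beq g 34 then [(uid 0 19 18, 2), (uid 15 2 2, 2), (uid 15 1 1, 1)]
  else [(classUid g, 1)]

/-- The tables of the basic cocycles. -/
def classTable (g a b : ℕ) : List (ℕ × ℕ) :=
  bif Nat.beq g 34 then c0Table a b else cocycleTable g a b

/-- The value of a linear form on an alternating map with the given table. -/
def formCode (P : ℕ → ℕ → List (ℕ × ℕ)) : List (ℕ × ℕ) → ℕ
  | [] => 0
  | t :: l => Nat.xor (pmul t.2 (coeffOf (Nat.mod t.1 34)
      (P (Nat.div t.1 1156) (Nat.mod (Nat.div t.1 34) 34)))) (formCode P l)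

/-- The duality between the nineteen forms and the nineteen cocycles, together with the vanishing of
the forms on coboundaries. It yields linear independence at once, and the coefficients of a class in
the basis. -/
lemma classForm_check : (classIdx.all fun g => formRange (classForm g) &&
    (isZero (substBoundary (classForm g)) && (isUnit (formCode (classTable g) (classForm g)) &&
    classIdx.all fun g' => Nat.beq g g' ||
      Nat.beq (formCode (classTable g') (classForm g)) 0))) = true := by decide +kernel

lemma startList_check : (startList.all fun u =>
    (gaugeList.map fun t => uid t.1 t.2.1 t.2.2.1).contains u || Nat.beq u (uid 0 19 18) ||
      specialIdx.any fun g => Nat.beq u (classUid g)) = true := by decide +kernel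

lemma gaugeList_contains : ((gaugeList.map fun t => uid t.1 t.2.1 t.2.2.1).contains (uid 15 2 2) &&
    (gaugeList.map fun t => uid t.1 t.2.1 t.2.2.1).contains (uid 15 1 1)) = true := by
  decide +kernel

variable {K : Type*} [Field K] [CharP K 2] {α : K}

/-- The basic cocycles. -/
def classCocycle (α : K) (g : ℕ) : (bgl4 α).PreCochain :=
  bif Nat.beq g 34 then c0bar α else rootCocycle α g

lemma isTable_classCocycle {g : ℕ} (hg : g ∈ classIdx) :
    IsTable α (classCocycle α g).1 (classTable g) := by
  rcases List.mem_append.mp hg with h | h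
  · have h34 : ∀ g ∈ specialIdx, Nat.beq g 34 = false := by decide
    unfold classCocycle classTable
    rw [h34 g h]
    exact isTable_rootCocycle α h
  · rw [List.mem_singleton] at h
    subst h
    exact isTable_c0 α

lemma inRange_classTable {g : ℕ} (hg : g ∈ classIdx) : InRange (classTable g) := by
  rcases List.mem_append.mp hg with h | h
  · have h34 : ∀ g ∈ specialIdx, Nat.beq g 34 = false := by decide
    unfold classTable
    rw [h34 g h]
    exact (isGradedTable_cocycleTable h).range
  · rw [List.mem_singleton] at h
    subst h
    exact isGradedTable_c0Table.range

lemma linForm_table {c : (bgl4 α).PreCochain} {P : ℕ → ℕ → List (ℕ × ℕ)} (hP : IsTable α c.1 P)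
    (hr : InRange P) {l : List (ℕ × ℕ)} (hl : formRange l = true) :
    linForm α l c = ev α (formCode P l) := by
  change lin _ _ _ = _
  induction l with
  | nil => simp [formCode]
  | cons t l ih =>
    rw [formRange, List.all_cons, Bool.and_eq_true, Nat.blt_eq] at hl
    have h1 : t.1 / 1156 < 34 := by omega
    have h2 : t.1 / 34 % 34 < 34 := Nat.mod_lt _ (by omega)
    rw [lin_cons, ih hl.2, formCode, ev_xor, ev_pmul, coord, hP _ h1 _ h2,
      den_apply α (hr _ h1 _ h2), idx_gen (Nat.mod_lt _ (by omega))]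
    rfl

lemma classForm_ne {g g' : ℕ} (hg : g ∈ classIdx) (hg' : g' ∈ classIdx) (hne : g ≠ g') :
    linForm α (classForm g) (classCocycle α g') = 0 := by
  have h := List.all_eq_true.mp classForm_check g hg
  simp only [Bool.and_eq_true, List.all_eq_true, Bool.or_eq_true] at h
  rw [linForm_table (isTable_classCocycle hg') (inRange_classTable hg') h.1,
    Nat.eq_of_beq_eq_true ((h.2.2.2 g' hg').resolve_left (by rw [beq_eq_false hne]; simp)), ev_zero]

variable (hα0 : α ≠ 0) (hα1 : α ≠ 1)
include hα0 hα1

lemma classForm_self {g : ℕ} (hg : g ∈ classIdx) :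
    linForm α (classForm g) (classCocycle α g) ≠ 0 := by
  have h := List.all_eq_true.mp classForm_check g hg
  simp only [Bool.and_eq_true] at h
  rw [linForm_table (isTable_classCocycle hg) (inRange_classTable hg) h.1]
  exact ev_ne_zero hα0 hα1 h.2.2.1

lemma classForm_of_mem_B2 {g : ℕ} (hg : g ∈ classIdx) {c : (bgl4 α).PreCochain}
    (hc : c ∈ (bgl4 α).B2) : linForm α (classForm g) c = 0 := by
  have h := List.all_eq_true.mp classForm_check g hg
  simp only [Bool.and_eq_true] at h
  exact linForm_eq_zero_of_mem_B2 hα0 hα1 hc h.1 h.2.1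

lemma classCocycle_mem_Z2 {g : ℕ} (hg : g ∈ classIdx) : classCocycle α g ∈ (bgl4 α).Z2 := by
  rcases List.mem_append.mp hg with h | h
  · have h34 : ∀ g ∈ specialIdx, Nat.beq g 34 = false := by decide
    unfold classCocycle
    rw [h34 g h]
    exact rootCocycle_mem_Z2 hα0 hα1 h
  · rw [List.mem_singleton] at h
    subst h
    exact c0bar_mem_Z2 hα0 hα1

/-- A cocycle is a coboundary if the linear forms vanish. -/
lemma mem_B2_of_classForm {c : (bgl4 α).PreCochain} (hc : c ∈ (bgl4 α).Z2)
    (h : ∀ g ∈ classIdx, linForm α (classForm g) c = 0) : c ∈ (bgl4 α).B2 := by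
  obtain ⟨b, hb, hg⟩ := exists_gauge hα0 hα1 c
  have hcb : c + b ∈ (bgl4 α).Z2 := (bgl4 α).Z2.add_mem hc (B2_le_Z2 hα0 hα1 hb)
  have hform : ∀ g ∈ classIdx, linForm α (classForm g) (c + b) = 0 := fun g hg => by
    rw [map_add, h g hg, classForm_of_mem_B2 hα0 hα1 hg hb, add_zero]
  have hgauge : ∀ u, (gaugeList.map fun t => uid t.1 t.2.1 t.2.2.1).contains u = true →
      coord (c + b).1 u = 0 := by
    intro u hu
    rw [List.contains_iff_mem] at hu
    obtain ⟨t, ht, rfl⟩ := List.mem_map.mp hu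
    rw [← linForm_single]
    exact hg t ht
  have hstart : ∀ u ∈ startList, coord (c + b).1 u = 0 := by
    intro u hu
    have h1 := List.all_eq_true.mp startList_check u hu
    rw [Bool.or_eq_true, Bool.or_eq_true, List.any_eq_true] at h1
    rcases h1 with (h1 | h1) | ⟨g, hg, h1⟩
    · exact hgauge u h1
    · rw [Nat.eq_of_beq_eq_true h1]
      -- The coordinates `c(h_1, x_3)_{x_3}` and `c(h_1, x_2)_{x_2}` are among those already made to
      -- vanish, so this form reduces to `α` times its first coordinate.
      have h2 := hform 34 (by decide)
      have h3 := gaugeList_contains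
      rw [Bool.and_eq_true] at h3
      change lin (ev α) (coord (c + b).1) [(uid 0 19 18, 2), (uid 15 2 2, 2), (uid 15 1 1, 1)] = 0
        at h2
      rw [lin_cons, lin_cons, lin_cons, lin_nil, hgauge _ h3.1, hgauge _ h3.2, mul_zero, mul_zero,
        add_zero, add_zero, add_zero, ev_two] at h2
      exact (mul_eq_zero.mp h2).resolve_left hα0
    · rw [Nat.eq_of_beq_eq_true h1]
      have h34 : ∀ g ∈ specialIdx, Nat.beq g 34 = false := by decide
      have h2 := hform g (List.mem_append_left _ hg)
      rwa [classForm, h34 g hg, cond_false, linForm_single] at h2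
  have := mem_B2_of_even hα0 hα1 hcb fun a ha b hb k hk he =>
    coord_eq_zero_of_even hα0 hα1 hcb hstart ha hb hk he
  have h2 := (bgl4 α).B2.add_mem this hb
  rwa [add_assoc, cochain_add_self, add_zero] at h2

end Classes


/-! ## A basis of the second cohomology -/

/-! ### A basis of a quotient from dual linear forms. -/

section DualBasis

variable {K M : Type*} [Field K] [AddCommGroup M] [Module K M]

/-- Cocycles form a basis of the cohomology if there are dual linear forms that vanish exactly on
coboundaries. -/
lemma basis_mkQ_of_dual {ι : Type*} [Fintype ι] {Z B : Submodule K M} {c : ι → M}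
    {ψ : ι → M →ₗ[K] K} (hc : ∀ i, c i ∈ Z) (hB : ∀ i, ∀ b ∈ B, ψ i b = 0)
    (hne : ∀ i j, i ≠ j → ψ i (c j) = 0) (hself : ∀ i, ψ i (c i) ≠ 0)
    (hZ : ∀ z ∈ Z, (∀ i, ψ i z = 0) → z ∈ B) :
    LinearIndependent K (fun i => B.mkQ (c i)) ∧
      Submodule.span K (Set.range fun i => B.mkQ (c i)) = Z.map B.mkQ := by
  have hsum : ∀ (r : ι → K) j, ψ j (∑ i, r i • c i) = r j * ψ j (c j) := by
    intro r j
    rw [map_sum, Finset.sum_eq_single j]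
    · rw [map_smul, smul_eq_mul]
    · intro i _ hij
      rw [map_smul, hne j i hij.symm, smul_zero]
    · simp
  constructor
  · rw [Fintype.linearIndependent_iff]
    intro r hr j
    have h1 : ∑ i, r i • c i ∈ B := by
      rw [← Submodule.ker_mkQ B, LinearMap.mem_ker, map_sum, ← hr]
      exact Finset.sum_congr rfl fun i _ => map_smul _ _ _
    have h2 := hB j _ h1
    rw [hsum] at h2
    exact (mul_eq_zero.mp h2).resolve_right (hself j)
  · refine le_antisymm (Submodule.span_le.mpr ?_) ?_
    · rintro _ ⟨i, rfl⟩
      exact Submodule.mem_map_of_mem (hc i)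
    · rintro _ ⟨z, hz, rfl⟩
      have h1 : z - ∑ i, (ψ i z / ψ i (c i)) • c i ∈ B := by
        refine hZ _ (Z.sub_mem hz (Z.sum_mem fun i _ => Z.smul_mem _ (hc i))) fun j => ?_
        rw [map_sub, hsum, div_mul_cancel₀ _ (hself j), sub_self]
      have h2 : B.mkQ z = ∑ i, (ψ i z / ψ i (c i)) • B.mkQ (c i) := by
        rw [← Submodule.ker_mkQ B, LinearMap.mem_ker, map_sub, sub_eq_zero] at h1
        rw [h1, map_sum]
        exact Finset.sum_congr rfl fun i _ => map_smul _ _ _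
      rw [h2]
      exact Submodule.sum_mem _ fun i _ =>
        Submodule.smul_mem _ _ (Submodule.subset_span ⟨i, rfl⟩)

end DualBasis

/-! ### The nineteen classes form a basis. -/

section Cohomology

/-- The numbering of the basic cocycles. -/
def classNum : (Fin 9 ⊕ Fin 9) ⊕ Unit → ℕ
  | .inl (.inl n) => specialRoot n - 1
  | .inl (.inr n) => specialRoot n + 18
  | .inr _ => 34

lemma classNum_mem (i : (Fin 9 ⊕ Fin 9) ⊕ Unit) : classNum i ∈ classIdx := by
  revert i; decide

lemma classNum_injective : Function.Injective classNum := by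
  unfold Function.Injective
  decide

lemma exists_classNum : ∀ g ∈ classIdx, ∃ i, classNum i = g := by decide

variable {K : Type*} [Field K] [CharP K 2] {α : K} (hα0 : α ≠ 0) (hα1 : α ≠ 1)
include hα0 hα1

lemma isCohomologyBasis_classCocycle :
    (bgl4 α).IsCohomologyBasis fun i => classCocycle α (classNum i) := by
  have h := basis_mkQ_of_dual (Z := (bgl4 α).Z2) (B := (bgl4 α).B2)
    (c := fun i => classCocycle α (classNum i)) (ψ := fun i => linForm α (classForm (classNum i)))
    (fun i => classCocycle_mem_Z2 hα0 hα1 (classNum_mem i))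
    (fun i b hb => classForm_of_mem_B2 hα0 hα1 (classNum_mem i) hb)
    (fun i j hij => classForm_ne (classNum_mem i) (classNum_mem j)
      fun h => hij (classNum_injective h))
    (fun i => classForm_self hα0 hα1 (classNum_mem i))
    (fun z hz h => mem_B2_of_classForm hα0 hα1 hz fun g hg => by
      obtain ⟨i, rfl⟩ := exists_classNum g hg
      exact h i)
  exact ⟨fun i => classCocycle_mem_Z2 hα0 hα1 (classNum_mem i), h.1, h.2⟩

end Cohomology

/-! ## Deforms -/

section Deform

variable {K : Type*} [Field K] [CharP K 2] {α : K}

lemma jac_add_jac_of_mem_Z2 {c : (bgl4 α).PreCochain} (hc : c ∈ (bgl4 α).Z2) (u v w : Vec K) :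
    jac (wk4 α) c.1 u v w + jac c.1 (wk4 α) u v w = 0 := by
  have halt := isAlternating_of_mem_Z2 hc
  have hwk : IsAlternating (wk4 α) := isAlternating_wk4
  have h : c.1 (wk4 α u v) w + c.1 (wk4 α v w) u + c.1 (wk4 α w u) v +
      (wk4 α (c.1 u v) w + wk4 α (c.1 v w) u + wk4 α (c.1 w u) v) = 0 := hc.2.2.2.1 u v w
  rw [← h, jac, jac, halt.symm (wk4 α u v) w, halt.symm (wk4 α v w) u,
    halt.symm (wk4 α w u) v, hwk.symm (c.1 u v) w, hwk.symm (c.1 v w) u, hwk.symm (c.1 w u) v]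
  abel

variable (hα0 : α ≠ 0) (hα1 : α ≠ 1)
include hα0 hα1

/-- The Jacobi expression is quadratic in `t`: the constant term is that of `wk4`, the linear term
is the cocycle identity, and the quadratic term is the hypothesis. -/
lemma isLieBracket_deform {c : (bgl4 α).PreCochain} (hc : c ∈ (bgl4 α).Z2)
    (hj : ∀ u v w, jac c.1 c.1 u v w = 0) (t : K) : IsLieBracket (wk4 α + t • c.1) := by
  have halt := isAlternating_of_mem_Z2 hc
  have hwk : IsAlternating (wk4 α) := isAlternating_wk4
  refine isLieBracket_of_jac ⟨fun u v => ?_, fun u => ?_⟩ fun u v w => ?_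
  · simp only [LinearMap.add_apply, LinearMap.smul_apply, hwk.symm u, halt.symm u]
  · simp only [LinearMap.add_apply, LinearMap.smul_apply, hwk.self, halt.self, smul_zero, add_zero]
  · have : jac (wk4 α + t • c.1) (wk4 α + t • c.1) u v w = jac (wk4 α) (wk4 α) u v w +
        t • (jac (wk4 α) c.1 u v w + jac c.1 (wk4 α) u v w) + (t * t) • jac c.1 c.1 u v w := by
      simp only [jac, LinearMap.add_apply, LinearMap.smul_apply, map_add, map_smul, smul_add,
        smul_smul]
      abel
    rw [this, jac_wk4 hα0 hα1, jac_add_jac_of_mem_Z2 hc, hj]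
    simp

/-- The deform by a cocycle that itself satisfies the identities of a Lie superalgebra. -/
lemma isLieSuperalgebra_deform {c : (bgl4 α).PreCochain} (hc : c ∈ (bgl4 α).Z2)
    (heven : IsEvenCochain c) (hj : ∀ u v w, jac c.1 c.1 u v w = 0)
    (hq : ∀ (x : (bgl4 α).oddPart) (v : Vec K), c.1 (c.2 x) v = c.1 x (c.1 x v)) (t : K) :
    ((bgl4 α).deform c t).IsLieSuperalgebra := by
  have halt := isAlternating_of_mem_Z2 hc
  have hwk : IsAlternating (wk4 α) := isAlternating_wk4
  have hL := isLieSuperalgebra_bgl4 hα0 hα1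
  have hpar : RespectsParity (wk4 α) := (respectsParity_structConst hα0 hα1).wedge
  have hadd : ∀ x y : (bgl4 α).oddPart, ((bgl4 α).sq + t • c.2) (x + y) =
      ((bgl4 α).sq + t • c.2) x + ((bgl4 α).sq + t • c.2) y +
        ((bgl4 α).bracket + t • c.1) x y := fun x y => by
    change (bgl4 α).sq (x + y) + t • c.2 (x + y) = (bgl4 α).sq x + t • c.2 x +
      ((bgl4 α).sq y + t • c.2 y) + ((bgl4 α).bracket x y + t • c.1 x y)
    rw [hL.sq_add, hc.2.2.1, smul_add, smul_add]
    abel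
  refine isLieSuperalgebra_of (α := α) rfl rfl ⟨fun u v => ?_, fun u => ?_⟩
    (isLieBracket_deform hα0 hα1 hc hj t) (fun a b => ?_) (fun x => ?_) hadd
    fun x v => ?_
  · change (wk4 α + t • c.1) u v = (wk4 α + t • c.1) v u
    simp only [LinearMap.add_apply, LinearMap.smul_apply, hwk.symm u, halt.symm u]
  · change (wk4 α + t • c.1) u u = 0
    simp only [LinearMap.add_apply, LinearMap.smul_apply, hwk.self, halt.self, smul_zero, add_zero]
  · exact Submodule.add_mem _ (hpar a b) (Submodule.smul_mem _ _ (heven.1 a b))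
  · exact Submodule.add_mem _ (hL.sq_even x) (Submodule.smul_mem _ _ (heven.2 x))
  · have h1 := hL.sq_bracket x v
    have h2 := hc.2.2.2.2 x v
    have h3 := hq x v
    change (bgl4 α).bracket ((bgl4 α).sq x + t • c.2 x) v + t • c.1 ((bgl4 α).sq x + t • c.2 x) v =
      (bgl4 α).bracket x ((bgl4 α).bracket x v + t • c.1 x v) +
        t • c.1 x ((bgl4 α).bracket x v + t • c.1 x v)
    have h4 := congrArg (t • ·) h2
    simp only [smul_add] at h4
    simp only [map_add, map_smul, LinearMap.add_apply, LinearMap.smul_apply, smul_add, h1, h3]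
    rw [add_assoc, ← add_assoc (t • _) (t • _), add_comm (t • (bgl4 α).bracket (c.2 x) v), h4]
    abel

lemma isLieSuperalgebra_deform_c0bar (t : K) : ((bgl4 α).deform (c0bar α) t).IsLieSuperalgebra :=
  isLieSuperalgebra_deform hα0 hα1 (c0bar_mem_Z2 hα0 hα1) (c0bar_isEvenCochain α) (jac_c0 α)
    (c0bar_sq_bracket α) t

lemma isLieBracket_deform_c0 (t : K) : IsLieBracket (wk4 α + t • c0 α) :=
  isLieBracket_deform hα0 hα1 (c0bar_mem_Z2 hα0 hα1) (jac_c0 α) t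

end Deform

/-! ## Homogeneous cocycles of nonzero weight -/

section NonzeroWeight

lemma classUid_weight : ∀ g ∈ specialIdx, classUid g < 39304 ∧
    wt (gen (classUid g % 34)) = wt (gen (classUid g / 1156)) + wt (gen (classUid g / 34 % 34)) +
      -(wt (gen g) + wt (gen g)) := by
  decide +kernel

/-- The eighteen basic cocycles of nonzero weight have different weights, so a homogeneous cocycle
is seen by at most one of their forms. -/
lemma specialIdx_weight : ∀ g ∈ specialIdx, ∀ g' ∈ specialIdx,
    wt (gen g) + wt (gen g) = wt (gen g') + wt (gen g') → g = g' := by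
  decide +kernel

/-- There are no vectors of the weight of a double product of cocycles. -/
lemma triple_weight_check : (specialIdx.all fun g => allBelow 34 fun a => allBelow a fun b =>
    allBelow b fun c => not (bit wideMask (Nat.sub (Nat.add (Nat.add (Nat.add (wideCode a)
      (wideCode b)) (wideCode c)) 1060) (Nat.mul 4 (wideCode g))))) = true := by
  decide +kernel

/-- In the squaring identity on basis vectors the weight is `2γ_a + γ_b - 4γ_g`. Only for `a = b =
g` is it the weight of a basis vector, namely `-γ_g`. -/
lemma double_weight_check : (specialIdx.all fun g => allBelow 34 fun a => allBelow 34 fun b =>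
    not (bit wideMask (Nat.sub (Nat.add (Nat.add (Nat.add (wideCode a) (wideCode a))
      (wideCode b)) 1060) (Nat.mul 4 (wideCode g)))) || (Nat.beq a g && Nat.beq b g)) = true := by
  decide +kernel

/-- These coordinates settle the case that weights leave open. On the differential of `f` they
vanish: the entry of `f` from `g` to `bar g` enters twice with the same factor, and no vector of
weight `-2γ_g` exists to give another term. -/
lemma cartan_form_check : (specialIdx.all fun g => allBelow 4 fun j =>
    isZero (substBoundary [(uid (15 + j) g (bar g), 1)]) &&
      Nat.beq (formCode (cocycleTable g) [(uid (15 + j) g (bar g), 1)]) 0) = true := by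
  decide +kernel

lemma bar_weight : ∀ g ∈ specialIdx, ∀ k < 34,
    wt (gen k) = wt (gen g) + -(wt (gen g) + wt (gen g)) → k = bar g := by
  decide +kernel

lemma specialIdx_lt : ∀ g ∈ specialIdx, g < 34 := by decide

lemma bar_lt : ∀ a < 34, bar a < 34 := by decide

lemma wt_cartan : ∀ a < 34, wt (gen a) = 0 → ∃ j < 4, a = 15 + j := by decide +kernel

lemma formRange_single {u : ℕ} (h : u < 39304) : formRange [(u, 1)] = true := by
  rw [formRange, List.all_cons, List.all_nil, Bool.and_true, Nat.blt_eq]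
  exact h

lemma uid_lt {a b k : ℕ} (ha : a < 34) (hb : b < 34) (hk : k < 34) : uid a b k < 39304 := by
  wlog hab : a ≤ b generalizing a b
  · rw [uid_comm]; exact this hb ha (not_le.mp hab).le
  · rw [uid_of_le hab]; omega

variable {K : Type*} [Field K] [CharP K 2] {α : K}

omit [CharP K 2] in
lemma coord_eq_zero_of_hasWeight {c : (bgl4 α).PreCochain} {w : Fin 4 → ℤ} (hw : HasWeight c w)
    {u : ℕ} (h : wt (gen (u % 34)) ≠ wt (gen (u / 1156)) + wt (gen (u / 34 % 34)) + w) :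
    coord c.1 u = 0 := hw.1 _ _ _ h

variable (hα0 : α ≠ 0) (hα1 : α ≠ 1)
include hα0 hα1

/-- A homogeneous cocycle of nonzero weight is a multiple of a basic cocycle up to coboundaries. -/
lemma exists_rootCocycle {c : (bgl4 α).PreCochain} (hc : c ∈ (bgl4 α).Z2) {w : Fin 4 → ℤ}
    (hw : HasWeight c w) (hw0 : w ≠ 0) (hcB : c ∉ (bgl4 α).B2) :
    ∃ g ∈ specialIdx, w = -(wt (gen g) + wt (gen g)) ∧
      ∃ r : K, ∃ b ∈ (bgl4 α).B2, c = r • rootCocycle α g + b := by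
  -- All coordinates in this form have weight zero, so they vanish on a cochain of nonzero weight.
  have h34 : linForm α (classForm 34) c = 0 := by
    change lin (ev α) (coord c.1) [(uid 0 19 18, 2), (uid 15 2 2, 2), (uid 15 1 1, 1)] = 0
    have hz : ∀ a b k : ℕ, uid a b k < 39304 →
        wt (gen (uid a b k % 34)) = wt (gen (uid a b k / 1156)) + wt (gen (uid a b k / 34 % 34)) →
        coord c.1 (uid a b k) = 0 := by
      intro a b k _ h
      refine coord_eq_zero_of_hasWeight hw fun h' => hw0 ?_
      rw [h] at h'
      exact (left_eq_add.mp h')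
    rw [lin_cons, lin_cons, lin_cons, lin_nil, hz 0 19 18 (by decide) (by decide +kernel),
      hz 15 2 2 (by decide) (by decide +kernel), hz 15 1 1 (by decide) (by decide +kernel)]
    simp
  have hne : ∀ g ∈ specialIdx, Nat.beq g 34 = false := by decide
  have hform : ∀ g ∈ specialIdx, linForm α (classForm g) c ≠ 0 → w = -(wt (gen g) + wt (gen g)) := by
    intro g hg h
    rw [classForm, hne g hg, cond_false, linForm_single] at h
    by_contra hwg
    refine h (coord_eq_zero_of_hasWeight hw fun h' => hwg ?_)
    rw [(classUid_weight g hg).2] at h'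
    exact (add_left_cancel h').symm
  obtain ⟨g, hg, hgc⟩ : ∃ g ∈ specialIdx, linForm α (classForm g) c ≠ 0 := by
    by_contra hcon
    push Not at hcon
    refine hcB (mem_B2_of_classForm hα0 hα1 hc fun g hg => ?_)
    rcases List.mem_append.mp hg with h | h
    · exact hcon g h
    · rw [List.mem_singleton.mp h, h34]
  have hg' : g ∈ classIdx := List.mem_append_left _ hg
  have hrc : classCocycle α g = rootCocycle α g := by rw [classCocycle, hne g hg, cond_false]
  have hself := classForm_self hα0 hα1 hg'
  -- The quotient of the values of the form on `c` and on the basic cocycle is the coefficient; the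
  -- remainder is killed by all nineteen forms.
  refine ⟨g, hg, hform g hg hgc, linForm α (classForm g) c / linForm α (classForm g)
    (classCocycle α g), c + (linForm α (classForm g) c / linForm α (classForm g)
    (classCocycle α g)) • classCocycle α g, ?_, ?_⟩
  · refine mem_B2_of_classForm hα0 hα1 ((bgl4 α).Z2.add_mem hc
      ((bgl4 α).Z2.smul_mem _ (classCocycle_mem_Z2 hα0 hα1 hg'))) fun g₁ hg₁ => ?_
    rw [map_add, map_smul, smul_eq_mul]
    by_cases h : g₁ = g
    · rw [h, div_mul_cancel₀ _ hself, CharTwo.add_self_eq_zero]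
    · rw [classForm_ne hg₁ hg' h, mul_zero, add_zero]
      rcases List.mem_append.mp hg₁ with h1 | h1
      · by_contra hne₁
        have e1 := hform g hg hgc
        rw [hform g₁ h1 hne₁] at e1
        exact h (specialIdx_weight g₁ h1 g hg (neg_injective e1))
      · rw [List.mem_singleton.mp h1, h34]
  · rw [hrc, add_comm c, ← add_assoc, cochain_add_self, zero_add]

/-- A linear form that vanishes on coboundaries and on the basic cocycle. -/
lemma linForm_eq_zero_of_decomp {g : ℕ} (hg : g ∈ specialIdx) {c b : (bgl4 α).PreCochain} {r : K}
    (hb : b ∈ (bgl4 α).B2) (hc : c = r • rootCocycle α g + b) {l : List (ℕ × ℕ)}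
    (hl : formRange l = true) (hz : isZero (substBoundary l) = true)
    (hg0 : formCode (cocycleTable g) l = 0) : linForm α l c = 0 := by
  rw [hc, map_add, map_smul, linForm_eq_zero_of_mem_B2 hα0 hα1 hb hl hz,
    linForm_table (isTable_rootCocycle α hg) (isGradedTable_cocycleTable hg).range hl, hg0,
    ev_zero, smul_zero, add_zero]

omit hα0 hα1 in
-- On three different basis vectors the double product would have a weight that no basis vector has.
-- The argument uses only the weight of `c`, not its particular form.
lemma jac_eq_zero_of_weight {c : (bgl4 α).PreCochain} (hc : c ∈ (bgl4 α).Z2) {g : ℕ}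
    (hg : g ∈ specialIdx) (hw : HasWeight c (-(wt (gen g) + wt (gen g)))) (u v x : Vec K) :
    jac c.1 c.1 u v x = 0 := by
  have halt := isAlternating_of_mem_Z2 hc
  have h0 : IsAlternating (0 : Vec K →ₗ[K] Vec K →ₗ[K] Vec K) := ⟨by simp, by simp⟩
  have hh : IsHomogeneous c.1 (-(wt (gen g) + wt (gen g))) := hw.1
  have := jac_ext (br₁ := c.1) (br₂ := 0) halt h0 (fun a ha b hb d hd => ?_) u v x
  · simpa [jac] using this
  · have hl := allBelow_apply (allBelow_apply (allBelow_apply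
      (List.all_eq_true.mp triple_weight_check g hg) ha) hb) hd
    have hz := (Bool.not_eq_true' _).mp hl
    have hj0 : jac (0 : Vec K →ₗ[K] Vec K →ₗ[K] Vec K) 0 (e (gen a)) (e (gen b)) (e (gen d)) = 0 := by
      simp [jac]
    rw [hj0, add_zero]
    refine eq_zero_of_mem_weightSpace (hh.jac_mem hh (gen a) (gen b) (gen d)) fun k hk => ?_
    refine bit_wideCode k ?_
    have hk' : wideCode (idx k) = wideCode a + wideCode b + wideCode d + 1060 - 4 * wideCode g := by
      have e1 := wideCode_eq k
      have e2 := wideCode_eq (gen a)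
      have e3 := wideCode_eq (gen b)
      have e4 := wideCode_eq (gen d)
      have e5 := wideCode_eq (gen g)
      rw [idx_gen ha] at e2
      rw [idx_gen (hb.trans ha)] at e3
      rw [idx_gen (hd.trans (hb.trans ha))] at e4
      rw [idx_gen (specialIdx_lt g hg)] at e5
      rw [hk] at e1
      simp only [wideForm_add, wideForm_neg] at e1
      omega
    rw [hk']
    exact hz

/-- Weights dispose of all pairs of basis vectors except `x = v = e (gen g)`. There `c(x, x) = 0`,
while `c.2 x` lies in the span of the `h_j`, so it remains to see that `c(h_j, x) = 0`. Only for
this is the decomposition of `c` needed. -/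
lemma sq_bracket_of_weight {c b : (bgl4 α).PreCochain} (hc : c ∈ (bgl4 α).Z2) {g : ℕ}
    (hg : g ∈ specialIdx) (hw : HasWeight c (-(wt (gen g) + wt (gen g)))) {r : K}
    (hb : b ∈ (bgl4 α).B2) (hcb : c = r • rootCocycle α g + b) (x : (bgl4 α).oddPart) (v : Vec K) :
    c.1 (c.2 x) v = c.1 x (c.1 x v) := by
  have halt := isAlternating_of_mem_Z2 hc
  have hh : IsHomogeneous c.1 (-(wt (gen g) + wt (gen g))) := hw.1
  have hg34 := specialIdx_lt g hg
  have hcart : ∀ a < 34, wt (gen a) = 0 → c.1 (e (gen a)) (e (gen g)) = 0 := by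
    intro a ha hwa
    obtain ⟨j, hj, rfl⟩ := wt_cartan a ha hwa
    funext k
    by_cases hk : wt k = wt (gen (15 + j)) + wt (gen g) + -(wt (gen g) + wt (gen g))
    · rw [hwa, zero_add] at hk
      have hk' := bar_weight g hg (idx k) (idx_lt k) (by rwa [gen_idx])
      have hch := allBelow_apply (List.all_eq_true.mp cartan_form_check g hg) hj
      rw [Bool.and_eq_true] at hch
      have hbar := bar_lt g hg34
      have := linForm_eq_zero_of_decomp hα0 hα1 hg hb hcb
        (formRange_single (uid_lt ha hg34 hbar)) hch.1 (Nat.eq_of_beq_eq_true hch.2)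
      rw [linForm_single, coord_uid halt ha hg34 hbar, ← hk', gen_idx] at this
      exact this
    · exact hh _ _ _ hk
  rw [← vec_add_eq_zero]
  refine sq_ext (G := fun x => c.1 (c.2 x) v + c.1 x (c.1 x v)) ?_ ?_ ?_ x
  · intro x y
    have hj := jac_eq_zero_of_weight hc hg hw x y v
    rw [jac, halt.symm v x, halt.symm v (c.1 x y)] at hj
    rw [hc.2.2.1, Submodule.coe_add, map_add, map_add, map_add, LinearMap.add_apply,
      LinearMap.add_apply, LinearMap.add_apply, LinearMap.add_apply, map_add, map_add]
    rw [← sub_eq_zero, ← hj]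
    abel
  · intro s x
    simp only [QuadraticMap.map_smul, Submodule.coe_smul, map_smul, LinearMap.smul_apply, smul_smul,
      smul_add]
  · intro x a hx
    refine vec_induction (p := fun v => c.1 (c.2 x) v + c.1 x (c.1 x v) = 0) ?_ ?_ ?_ ?_ v
    · intro d
      have hl := allBelow_apply (allBelow_apply (List.all_eq_true.mp double_weight_check g hg)
        (idx_lt a)) (idx_lt d)
      rw [Bool.or_eq_true, Bool.and_eq_true] at hl
      have hq := hw.2 a x hx
      rw [hx]
      rcases hl with hl | ⟨h1, h2⟩
      · have hz := (Bool.not_eq_true' _).mp hl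
        have m1 := hh.apply_mem d hq
        have m2 := hh.apply_mem a (hh a d)
        rw [halt.symm (c.2 x)]
        have e1 : wt d + (wt a + wt a + -(wt (gen g) + wt (gen g))) + -(wt (gen g) + wt (gen g)) =
          wt a + (wt a + wt d + -(wt (gen g) + wt (gen g))) + -(wt (gen g) + wt (gen g)) := by abel
        rw [e1] at m1
        refine eq_zero_of_mem_weightSpace (Submodule.add_mem _ m1 m2) fun k hk => ?_
        refine bit_wideCode k ?_
        have hk' : wideCode (idx k) =
            wideCode (idx a) + wideCode (idx a) + wideCode (idx d) + 1060 - 4 * wideCode g := by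
          have e1 := wideCode_eq k
          have e2 := wideCode_eq a
          have e3 := wideCode_eq d
          have e5 := wideCode_eq (gen g)
          rw [idx_gen hg34] at e5
          rw [hk] at e1
          simp only [wideForm_add, wideForm_neg] at e1
          omega
        rw [hk']
        exact hz
      · have ha : a = gen g := by rw [← Nat.eq_of_beq_eq_true h1, gen_idx]
        have hd : d = gen g := by rw [← Nat.eq_of_beq_eq_true h2, gen_idx]
        subst ha hd
        rw [halt.self, map_zero, add_zero, vec_eq_sum (c.2 x), map_sum, LinearMap.sum_apply]
        refine Finset.sum_eq_zero fun l _ => ?_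
        rw [map_smul, LinearMap.smul_apply]
        by_cases hl : wt l = 0
        · have := hcart (idx l) (idx_lt l) (by rwa [gen_idx])
          rw [gen_idx] at this
          rw [this, smul_zero]
        · rw [hq l (by rwa [add_neg_cancel]), zero_smul]
    · simp
    · intro u u' h h'
      have : c.1 (c.2 x) (u + u') + c.1 x (c.1 x (u + u')) =
          c.1 (c.2 x) u + c.1 x (c.1 x u) + (c.1 (c.2 x) u' + c.1 x (c.1 x u')) := by
        simp only [map_add]; abel
      rw [this, h, h', add_zero]
    · intro s u h
      have : c.1 (c.2 x) (s • u) + c.1 x (c.1 x (s • u)) =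
          s • (c.1 (c.2 x) u + c.1 x (c.1 x u)) := by
        simp only [map_smul, smul_add]
      rw [this, h, smul_zero]

lemma isLieSuperalgebra_deform_of_weight {c b : (bgl4 α).PreCochain} (hc : c ∈ (bgl4 α).Z2) {g : ℕ}
    (hg : g ∈ specialIdx) (hw : HasWeight c (-(wt (gen g) + wt (gen g)))) {r : K}
    (hb : b ∈ (bgl4 α).B2) (hcb : c = r • rootCocycle α g + b) (t : K) :
    ((bgl4 α).deform c t).IsLieSuperalgebra :=
  isLieSuperalgebra_deform hα0 hα1 hc
    (isEvenCochain_of_hasWeight hw (by simp only [Pi.neg_apply, Pi.add_apply]; omega) hc.2.2.1)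
    (jac_eq_zero_of_weight hc hg hw) (sq_bracket_of_weight hα0 hα1 hc hg hw hb hcb) t

end NonzeroWeight


/-! ## Invariant forms -/

section GramTable

/-- The nonzero entries of the columns of `gram α`. -/
def gramTable (d : ℕ) : List (ℕ × ℕ) :=
  bif isCartan d then
    bif Nat.beq d 15 then [(16, 2), (17, 1)] else bif Nat.beq d 16 then [(15, 2)]
    else bif Nat.beq d 17 then [(15, 1), (18, 1)] else [(17, 1)]
  else [(bar d, monomial (nuCode (absIdx d)))]

/-- The nonzero entries of the columns of the derivative of `gramC0 α t` with respect to `t`. -/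
def gramDerivTable (d : ℕ) : List (ℕ × ℕ) :=
  scale 3 ((gramTable d).filter fun t =>
    !(bit 0x260004c d || (Nat.beq t.1 17 || Nat.beq d 17)))

/-- The properties of the table of a symmetric form of weight zero. -/
def gramTableCheck (P : ℕ → List (ℕ × ℕ)) : Bool := allBelow 34 fun d =>
  ((P d).all fun t => Nat.blt t.1 34 && decide (wt (gen t.1) + wt (gen d) = 0)) &&
    allBelow 34 fun k => Nat.beq (coeffOf k (P d)) (coeffOf d (P k))

lemma gramTableCheck_gramTable : gramTableCheck gramTable = true := by decide +kernel

lemma gramTableCheck_gramDerivTable : gramTableCheck gramDerivTable = true := by decide +kernel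

/-- A linear form in the coordinates of `F` whose vanishing means invariance on a triple of basis
vectors. -/
def invList (P : ℕ → List (ℕ × ℕ)) (a b d : ℕ) : List (ℕ × ℕ) :=
  ((P d).map fun t => (uid a b t.1, t.2)) ++ (P a).map fun t => (uid b d t.1, t.2)

/-- The form and the bracket are both affine in `t`, so the defect of invariance is quadratic in
`t`. The three last conditions are the vanishing of its coefficients. -/
lemma gramTable_c0_check : (allBelow 34 fun a => allBelow 34 fun b =>
    (cand (Nat.sub 138 (Nat.add (wtCode a) (wtCode b)))).all fun d =>
      (formRange (invList gramTable a b d) && formRange (invList gramDerivTable a b d)) &&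
      (Nat.beq (formCode wkTable (invList gramTable a b d)) 0 &&
      (Nat.beq (Nat.xor (formCode wkTable (invList gramDerivTable a b d))
        (formCode c0Table (invList gramTable a b d))) 0 &&
      Nat.beq (formCode c0Table (invList gramDerivTable a b d)) 0))) = true := by
  decide +kernel

/-- The positive roots have distinct residues modulo 2, so a linear map of weight `-2γ_g` is a
multiple of `e_g ↦ e_{bar g}`. This map is self-adjoint, and in characteristic 2 the form is
invariant under the differential of a self-adjoint map. Hence the defect vanishes on coboundaries,
and only the basic cocycle requires a test of its own. -/
lemma gramTable_root_check : (specialIdx.all fun g => allBelow 34 fun a => allBelow 34 fun b =>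
    (cand (Nat.sub (Nat.add 46 (Nat.mul 2 (wtCode g))) (Nat.add (wtCode a) (wtCode b)))).all
      fun d => Nat.blt a d || !Nat.beq (Nat.add (Nat.add (wideCode a) (wideCode b)) (wideCode d))
        (Nat.add 530 (Nat.mul 2 (wideCode g))) || (formRange (invList gramTable a b d) &&
        (isZero (substBoundary (invList gramTable a b d)) &&
        Nat.beq (formCode (cocycleTable g) (invList gramTable a b d)) 0))) = true := by
  decide +kernel

/-- The number of an entry of a Gram matrix. -/
def fid (a b : ℕ) : ℕ := bif Nat.ble a b then Nat.add (Nat.mul 34 a) b else Nat.add (Nat.mul 34 b) a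

/-- The bracket of the deform of `wk(4;α)` by `c0`. The code `p + 2 ^ 16 q` stands for
`p + t q`. -/
def deformTable (a b : ℕ) : List (ℕ × ℕ) :=
  wkTable a b ++ (c0Table a b).map fun t => (t.1, Nat.mul 65536 t.2)

/-- The invariance of a form with respect to the deform, on a triple of basis vectors. -/
def invEqn (n : ℕ) : List (ℕ × ℕ) :=
  let u := Nat.mod (Nat.div n 1156) 34
  let w := Nat.mod (Nat.div n 34) 34
  let v := Nat.mod n 34
  ((deformTable u w).map fun t => (fid t.1 v, t.2)) ++
    (deformTable w v).map fun t => (fid u t.1, t.2)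

/-- Equations that determine the Gram matrix from its entry number 89. -/
def invSteps : List ℕ :=
  [1, 2, 6, 7, 10, 12, 16, 23, 28, 30, 32, 35, 36, 37, 38, 40, 41, 43, 44, 45, 46, 48, 50, 51, 52,
    53, 55, 56, 58, 59, 61, 62, 64, 65, 66, 69, 70, 73, 74, 75, 76, 77, 78, 80, 81, 82, 84, 85, 87,
    88, 90, 91, 95, 96, 97, 98, 100, 101, 104, 109, 119, 124, 127, 129, 132, 138, 148, 155, 166,
    180, 198, 202, 205, 206, 207, 208, 210, 211, 212, 213, 214, 215, 216, 217, 218, 219, 220, 221,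
    222, 223, 224, 225, 227, 228, 230, 232, 233, 234, 235, 236, 237, 239, 240, 241, 244, 245, 247,
    248, 249, 250, 251, 252, 253, 254, 255, 256, 257, 258, 259, 260, 262, 263, 265, 268, 269, 270,
    271, 341, 342, 343, 345, 346, 347, 350, 351, 352, 353, 354, 355, 356, 357, 358, 359, 360, 361,
    362, 363, 364, 365, 366, 367, 368, 371, 372, 373, 409, 410, 411, 412, 414, 415, 418, 420, 421,
    422, 423, 424, 425, 426, 427, 428, 429, 430, 431, 432, 433, 434, 435, 436, 437, 441, 509, 512,
    535, 542, 560, 561, 566, 611, 650, 784, 785, 786, 788, 789, 792, 794, 796, 797, 798, 799, 800,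
    801, 802, 803, 804, 805, 806, 807, 808, 809, 810, 811, 812, 813, 814, 815, 818, 953, 954, 955,
    956, 957, 958, 959, 961, 962, 964, 966, 967, 968, 969, 970, 971, 973, 974, 975, 976, 977, 978,
    979, 980, 981, 982, 983, 984, 985, 1021, 1022, 1023, 1024, 1026, 1027, 1029, 1030, 1031, 1032,
    1034, 1035, 1036, 1037, 1038, 1039, 1041, 1042, 1043, 1044, 1045, 1047, 1048, 1049, 1050, 1051,
    1052, 1053, 1089, 1090, 1091, 1093, 1094, 1095, 1098, 1100, 1101, 1102, 1103, 1104, 1105, 1106,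
    1107, 1109, 1110, 1111, 1112, 1113, 1115, 1116, 1118, 1119, 1120, 1121, 1161, 1189, 1195, 1198,
    1203, 1205, 1210, 1213, 1216, 1219, 1223, 1227, 1235, 1239, 1245, 1249, 1250, 1255, 1275, 1280,
    1283, 1288, 1315, 1328, 1329, 1332, 1333, 1336, 1338, 1340, 1341, 1342, 1343, 1344, 1345, 1347,
    1348, 1349, 1350, 1351, 1352, 1353, 1354, 1356, 1358, 1359, 1430, 1431, 1434, 1438, 1440, 1442,
    1443, 1444, 1445, 1446, 1447, 1449, 1450, 1451, 1452, 1453, 1455, 1456, 1458, 1460, 1461, 1600,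
    1601, 1604, 1610, 1612, 1613, 1614, 1615, 1616, 1617, 1619, 1620, 1621, 1622, 1623, 1625, 1626,
    1628, 1630, 1631, 1691, 1699, 1838, 1839, 1842, 1848, 1851, 1852, 1853, 1854, 1855, 1857, 1858,
    1859, 1860, 1861, 1863, 1864, 1866, 1868, 1869, 1940, 1941, 1944, 1950, 1953, 1955, 1956, 1957,
    1959, 1960, 1961, 1962, 1963, 1965, 1966, 1968, 1970, 1971, 2042, 2043, 2045, 2046, 2052, 2055,
    2057, 2058, 2061, 2062, 2063, 2064, 2065, 2067, 2068, 2070, 2072, 2073, 2144, 2145, 2148, 2150,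
    2154, 2157, 2159, 2160, 2163, 2164, 2165, 2167, 2169, 2170, 2172, 2174, 2175, 2280, 2281, 2284,
    2290, 2291, 2293, 2295, 2296, 2299, 2300, 2301, 2303, 2306, 2308, 2310, 2311, 2315, 2327, 2330,
    2333, 2337, 2383, 2391, 2395, 2401, 2405, 2406, 2411, 2417, 2420, 2426, 2429, 2432, 2435, 2437,
    2439, 2442, 2447, 2537, 2541, 2547, 2576, 2689, 2698, 2701, 2703, 2704, 2707, 2708, 2709, 2711,
    2714, 2716, 2719, 2855, 2915, 3029, 3032, 3041, 3043, 3044, 3047, 3048, 3049, 3051, 3054, 3056,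
    3059, 3165, 3168, 3170, 3177, 3180, 3183, 3184, 3185, 3187, 3190, 3192, 3195, 3199, 3200, 3205,
    3211, 3214, 3217, 3219, 3221, 3224, 3226, 3229, 3369, 3372, 3377, 3379, 3381, 3384, 3387, 3391,
    3394, 3396, 3399, 3587, 3592, 3595, 3600, 3627, 3663, 4003, 4045, 4231, 4234, 4237, 4241, 4244,
    4249, 4333, 4339, 4343, 4346, 4351, 4497, 4503, 4513, 4516, 4521, 5421, 5431, 5439, 18215,
    18223, 19651]

/-- Polynomials coded below `2 ^ 16` do not interfere with the part of the code that is multiplied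
by `t`. -/
lemma wkTable_code_check : (allBelow 34 fun a => allBelow 34 fun b =>
    (wkTable a b).all fun t => Nat.blt t.2 65536) = true := by decide +kernel

-- Entry `89 = 34 * 2 + 21` belongs to `(x_3, y_3)`. The pivots are accepted by `isUnit` and
-- therefore do not involve `t`, so one elimination is valid for all `t`, including `(1 + α) t = 1`.
set_option maxRecDepth 10000 in
lemma invSteps_check : propagate (fun _ => false) invEqn invSteps
    (fun known => allBelow 34 fun a => allBelow 34 fun b => bit known (fid a b))
    (bitSet [89]) = true := by decide +kernel

end GramTable


/-! ### Testing invariance on triples of basis vectors. -/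

section InvariantForms

variable {K : Type*} [Field K]

lemma linear_den (f : Vec K →ₗ[K] K) (α : K) (l : List (ℕ × ℕ)) :
    f (den α l) = lin (ev α) (fun n => f (e (gen n))) l := by
  induction l with
  | nil => simp
  | cons t l ih => rw [den_cons, map_add, map_smul, lin_cons, ← ih, smul_eq_mul]

/-- The defect of the invariance of `B` with respect to `F` on a triple of basis vectors. -/
def invDefect (B : LinearMap.BilinForm K (Vec K)) (F : Vec K →ₗ[K] Vec K →ₗ[K] Vec K)
    (a b d : Gen) : K :=
  B (F (e a) (e b)) (e d) + B (e a) (F (e b) (e d))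

lemma bilinForm_ext {B B' : LinearMap.BilinForm K (Vec K)}
    (h : ∀ a b, B (e a) (e b) = B' (e a) (e b)) : B = B' := by
  refine LinearMap.ext fun u => LinearMap.ext fun v => ?_
  rw [vec_eq_sum u, vec_eq_sum v]
  simp only [map_sum, map_smul, LinearMap.sum_apply, LinearMap.smul_apply, h]

lemma formSymm_of_basis {B : LinearMap.BilinForm K (Vec K)}
    (h : ∀ a b, B (e a) (e b) = B (e b) (e a)) (u v : Vec K) : B u v = B v u := by
  have : B = B.flip := bilinForm_ext h
  conv_lhs => rw [this]
  rfl

lemma invDefect_add_left (B B' : LinearMap.BilinForm K (Vec K))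
    (F : Vec K →ₗ[K] Vec K →ₗ[K] Vec K) (a b d : Gen) :
    invDefect (B + B') F a b d = invDefect B F a b d + invDefect B' F a b d := by
  simp only [invDefect, LinearMap.add_apply]; ring

lemma invDefect_smul_left (s : K) (B : LinearMap.BilinForm K (Vec K))
    (F : Vec K →ₗ[K] Vec K →ₗ[K] Vec K) (a b d : Gen) :
    invDefect (s • B) F a b d = s * invDefect B F a b d := by
  simp only [invDefect, LinearMap.smul_apply, smul_eq_mul]; ring

lemma invDefect_add_right (B : LinearMap.BilinForm K (Vec K))
    (F F' : Vec K →ₗ[K] Vec K →ₗ[K] Vec K) (a b d : Gen) :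
    invDefect B (F + F') a b d = invDefect B F a b d + invDefect B F' a b d := by
  simp only [invDefect, LinearMap.add_apply, map_add]; ring

lemma invDefect_smul_right (s : K) (B : LinearMap.BilinForm K (Vec K))
    (F : Vec K →ₗ[K] Vec K →ₗ[K] Vec K) (a b d : Gen) :
    invDefect B (s • F) a b d = s * invDefect B F a b d := by
  simp only [invDefect, LinearMap.smul_apply, map_smul, smul_eq_mul]; ring

variable [CharP K 2] {α : K}

lemma invariant_of_invDefect {B : LinearMap.BilinForm K (Vec K)}
    {F : Vec K →ₗ[K] Vec K →ₗ[K] Vec K} (h : ∀ a b d, invDefect B F a b d = 0) (u v w : Vec K) :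
    B (F u v) w = B u (F v w) := by
  induction u using vec_induction with
  | h0 => simp
  | hadd u u' h h' => simp only [map_add, LinearMap.add_apply, h, h']
  | hsmul s u h => simp only [map_smul, LinearMap.smul_apply, h]
  | hb a =>
    induction v using vec_induction with
    | h0 => simp
    | hadd u u' h h' => simp only [map_add, LinearMap.add_apply, h, h']
    | hsmul s u h => simp only [map_smul, LinearMap.smul_apply, h]
    | hb b =>
      induction w using vec_induction with
      | h0 => simp
      | hadd u u' h h' => simp only [map_add, h, h']
      | hsmul s u h => simp only [map_smul, h]
      | hb d => exact CharTwo.add_eq_zero.mp (h a b d)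

/-- The table `P` describes the columns of the symmetric matrix `Γ` of weight zero. -/
structure IsGramTable (α : K) (Γ : Matrix Gen Gen K) (P : ℕ → List (ℕ × ℕ)) : Prop where
  entry : ∀ k d : Gen, Γ k d = ev α (coeffOf (idx k) (P (idx d)))
  range : ∀ d < 34, ∀ t ∈ P d, t.1 < 34
  weight : ∀ d < 34, ∀ t ∈ P d, wt (gen t.1) + wt (gen d) = 0
  symm : ∀ k d, Γ k d = Γ d k

omit [CharP K 2] in
lemma isGramTable_of_check {Γ : Matrix Gen Gen K} {P : ℕ → List (ℕ × ℕ)}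
    (hP : gramTableCheck P = true)
    (h : ∀ k d : Gen, Γ k d = ev α (coeffOf (idx k) (P (idx d)))) : IsGramTable α Γ P := by
  have h1 : ∀ d < 34, (∀ t ∈ P d, t.1 < 34 ∧ wt (gen t.1) + wt (gen d) = 0) ∧
      ∀ k < 34, coeffOf k (P d) = coeffOf d (P k) := by
    intro d hd
    have h2 := allBelow_apply hP hd
    rw [Bool.and_eq_true] at h2
    refine ⟨fun t ht => ?_, fun k hk => Nat.eq_of_beq_eq_true (allBelow_apply h2.2 hk)⟩
    have h3 := List.all_eq_true.mp h2.1 t ht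
    rw [Bool.and_eq_true, Nat.blt_eq] at h3
    exact ⟨h3.1, of_decide_eq_true h3.2⟩
  exact ⟨h, fun d hd t ht => ((h1 d hd).1 t ht).1, fun d hd t ht => ((h1 d hd).1 t ht).2,
    fun k d => by rw [h, h, (h1 _ (idx_lt d)).2 _ (idx_lt k)]⟩

variable {Γ : Matrix Gen Gen K} {P : ℕ → List (ℕ × ℕ)}

lemma IsGramTable.toBilin'_apply (h : IsGramTable α Γ P) (u : Vec K) {d : ℕ} (hd : d < 34) :
    Matrix.toBilin' Γ u (e (gen d)) = lin (ev α) (fun n => u (gen n)) (P d) := by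
  rw [lin_eq_sum (ev_xor α) (ev_zero α) (P d) (Finset.range 34)
    fun t ht => Finset.mem_range.mpr (h.range d hd t ht)]
  conv_lhs => rw [vec_eq_sum u]
  rw [map_sum, LinearMap.sum_apply]
  refine Finset.sum_nbij' idx gen (fun g _ => Finset.mem_range.mpr (idx_lt g)) (by simp)
    (fun g _ => gen_idx g) (fun n hn => idx_gen (Finset.mem_range.mp hn)) fun g _ => ?_
  rw [map_smul, LinearMap.smul_apply, Matrix.toBilin'_single, h.entry, idx_gen hd, gen_idx,
    smul_eq_mul, mul_comm]

omit [CharP K 2] in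
lemma IsGramTable.toBilin'_symm (h : IsGramTable α Γ P) (u v : Vec K) :
    Matrix.toBilin' Γ u v = Matrix.toBilin' Γ v u :=
  formSymm_of_basis (fun a b => by rw [Matrix.toBilin'_single, Matrix.toBilin'_single, h.symm]) u v

variable {F : Vec K →ₗ[K] Vec K →ₗ[K] Vec K}

lemma IsGramTable.lin_invList (h : IsGramTable α Γ P) (hF : IsAlternating F) {a b d : ℕ}
    (ha : a < 34) (hb : b < 34) (hd : d < 34) :
    lin (ev α) (coord F) (invList P a b d) =
      invDefect (Matrix.toBilin' Γ) F (gen a) (gen b) (gen d) := by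
  rw [invDefect, h.toBilin'_symm (e (gen a)), h.toBilin'_apply _ hd, h.toBilin'_apply _ ha, invList,
    lin_append, lin_map (f := fun n => uid a b n), lin_map (f := fun n => uid b d n)]
  congr 1
  · exact lin_congr _ _ fun t ht => coord_uid hF ha hb (h.range d hd t ht)
  · exact lin_congr _ _ fun t ht => coord_uid hF hb hd (h.range a ha t ht)

/-- The form pairs only opposite weights, so a triple whose total weight, shifted by that of `F`, is
nonzero contributes nothing. -/
lemma IsGramTable.invDefect_eq_zero (h : IsGramTable α Γ P) {w : Fin 4 → ℤ}
    (hw : IsHomogeneous F w) {a b d : Gen} (hne : wt a + wt b + wt d + w ≠ 0) :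
    invDefect (Matrix.toBilin' Γ) F a b d = 0 := by
  have h1 := h.toBilin'_apply (F (e a) (e b)) (idx_lt d)
  have h2 := h.toBilin'_apply (F (e b) (e d)) (idx_lt a)
  rw [gen_idx] at h1 h2
  rw [invDefect, h.toBilin'_symm (e a), h1, h2, lin_eq_zero_of_forall, lin_eq_zero_of_forall,
    add_zero]
  · intro t ht
    refine hw b d _ fun h' => hne ?_
    have h3 := h.weight _ (idx_lt a) t ht
    rw [h', gen_idx] at h3
    rw [← h3]
    abel
  · intro t ht
    refine hw a b _ fun h' => hne ?_
    have h3 := h.weight _ (idx_lt d) t ht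
    rw [h', gen_idx] at h3
    rw [← h3]
    abel

omit [CharP K 2] in
lemma IsGramTable.invDefect_comm (h : IsGramTable α Γ P) (hF : IsAlternating F) (a b d : Gen) :
    invDefect (Matrix.toBilin' Γ) F a b d = invDefect (Matrix.toBilin' Γ) F d b a := by
  rw [invDefect, invDefect, h.toBilin'_symm (e a), h.toBilin'_symm (e d), hF.symm (e b) (e d),
    hF.symm (e b) (e a), add_comm]

end InvariantForms

/-! ### Invariance of the proposed form on the deforms by `c0`. -/

section Gram

variable {K : Type*} [Field K] [CharP K 2] {α : K}

/-- The derivative of `gramC0 α t` with respect to `t`. -/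
def gramDeriv (α : K) : Matrix Gen Gen K := fun a b =>
  if (a, b) ∈ [(H 1, H 3), (H 3, H 1), (H 3, H 4), (H 4, H 3),
      (X 3, Y 3), (X 4, Y 4), (X 7, Y 7), (Y 3, X 3), (Y 4, X 4), (Y 7, X 7)]
  then 0 else (1 + α) * gram α a b

omit [CharP K 2] in
lemma gramC0_eq (t : K) : gramC0 α t = gram α + t • gramDeriv α := by
  funext a b
  rw [Matrix.add_apply, Matrix.smul_apply, smul_eq_mul]
  unfold gramC0 gramDeriv
  split_ifs
  · rw [mul_zero, add_zero]
  · ring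

lemma isGramTable_gram : IsGramTable α (gram α) gramTable := by
  refine isGramTable_of_check gramTableCheck_gramTable ?_
  have hxy : ∀ i j : Fin 15, coeffOf (idx (.x i)) (gramTable (idx (.y j))) =
      if i = j then monomial (nuCode i) else 0 := by decide +kernel
  have hyx : ∀ i j : Fin 15, coeffOf (idx (.y i)) (gramTable (idx (.x j))) =
      if i = j then monomial (nuCode i) else 0 := by decide +kernel
  have hxx : ∀ i j : Fin 15, coeffOf (idx (.x i)) (gramTable (idx (.x j))) = 0 := by decide +kernel
  have hyy : ∀ i j : Fin 15, coeffOf (idx (.y i)) (gramTable (idx (.y j))) = 0 := by decide +kernel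
  have hxh : ∀ (i : Fin 15) (j : Fin 4), coeffOf (idx (.x i)) (gramTable (idx (.h j))) = 0 := by
    decide +kernel
  have hyh : ∀ (i : Fin 15) (j : Fin 4), coeffOf (idx (.y i)) (gramTable (idx (.h j))) = 0 := by
    decide +kernel
  have hhx : ∀ (i : Fin 4) (j : Fin 15), coeffOf (idx (.h i)) (gramTable (idx (.x j))) = 0 := by
    decide +kernel
  have hhy : ∀ (i : Fin 4) (j : Fin 15), coeffOf (idx (.h i)) (gramTable (idx (.y j))) = 0 := by
    decide +kernel
  have hhh : ∀ i j : Fin 4, coeffOf (idx (.h i)) (gramTable (idx (.h j))) =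
      (![![0, 2, 1, 0], ![2, 0, 0, 0], ![1, 0, 0, 1], ![0, 0, 1, 0]] : Fin 4 → Fin 4 → ℕ) i j := by
    decide +kernel
  have hc : ∀ i j : Fin 4, cartan α i j =
      ev α ((![![0, 2, 1, 0], ![2, 0, 0, 0], ![1, 0, 0, 1], ![0, 0, 1, 0]] : Fin 4 → Fin 4 → ℕ) i j) := by
    intro i j
    fin_cases i <;> fin_cases j <;> simp [cartan, ev_two]
  rintro (i | i | i) (j | j | j)
  · rw [hxx, ev_zero]; rfl
  · rw [hxh, ev_zero]; rfl
  · rw [hxy]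
    change (if i = j then nu α i else 0) = _
    split_ifs
    · exact nu_eq α i
    · rw [ev_zero]
  · rw [hhx, ev_zero]; rfl
  · rw [hhh, ← hc]; rfl
  · rw [hhy, ev_zero]; rfl
  · rw [hyx]
    change (if i = j then nu α i else 0) = _
    split_ifs
    · exact nu_eq α i
    · rw [ev_zero]
  · rw [hyh, ev_zero]; rfl
  · rw [hyy, ev_zero]; rfl

lemma isGramTable_gramDeriv : IsGramTable α (gramDeriv α) gramDerivTable := by
  refine isGramTable_of_check gramTableCheck_gramDerivTable fun k d => ?_
  have h : ∀ k < 34, ∀ d < 34, coeffOf k (gramDerivTable d) =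
      if (gen k, gen d) ∈ [(H 1, H 3), (H 3, H 1), (H 3, H 4), (H 4, H 3),
        (X 3, Y 3), (X 4, Y 4), (X 7, Y 7), (Y 3, X 3), (Y 4, X 4), (Y 7, X 7)]
      then 0 else pmul 3 (coeffOf k (gramTable d)) := by
    decide +kernel
  have h' := h _ (idx_lt k) _ (idx_lt d)
  rw [gen_idx, gen_idx] at h'
  rw [h', gramDeriv]
  split_ifs
  · rw [ev_zero]
  · rw [ev_pmul, ev_three, isGramTable_gram.entry]

omit [CharP K 2] in
lemma toBilin'_gramC0 (t : K) : Matrix.toBilin' (gramC0 α t) =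
    Matrix.toBilin' (gram α) + t • Matrix.toBilin' (gramDeriv α) := by
  rw [gramC0_eq, map_add, map_smul]

lemma toBilin'_gramC0_symm (t : K) (u v : Vec K) :
    Matrix.toBilin' (gramC0 α t) u v = Matrix.toBilin' (gramC0 α t) v u := by
  rw [toBilin'_gramC0, LinearMap.add_apply, LinearMap.add_apply, LinearMap.smul_apply,
    LinearMap.smul_apply, LinearMap.add_apply, LinearMap.add_apply, LinearMap.smul_apply,
    LinearMap.smul_apply, isGramTable_gram.toBilin'_symm u v,
    isGramTable_gramDeriv.toBilin'_symm u v]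

/-- The form with the Gram matrix `gramC0 α t` in coordinates. -/
lemma toBilin'_gramC0_apply (t : K) (u : Vec K) {d : ℕ} (hd : d < 34) :
    Matrix.toBilin' (gramC0 α t) u (e (gen d)) =
      lin (ev α) (fun n => u (gen n)) (gramTable d) +
        t * lin (ev α) (fun n => u (gen n)) (gramDerivTable d) := by
  rw [toBilin'_gramC0, LinearMap.add_apply, LinearMap.smul_apply, LinearMap.add_apply,
    LinearMap.smul_apply, isGramTable_gram.toBilin'_apply u hd,
    isGramTable_gramDeriv.toBilin'_apply u hd, smul_eq_mul]

variable (hα0 : α ≠ 0) (hα1 : α ≠ 1)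
include hα0 hα1

lemma invariant_gramC0 (t : K) (u v w : Vec K) :
    Matrix.toBilin' (gramC0 α t) ((wk4 α + t • c0 α) u v) w =
      Matrix.toBilin' (gramC0 α t) u ((wk4 α + t • c0 α) v w) := by
  refine invariant_of_invDefect (fun a b d => ?_) u v w
  rw [toBilin'_gramC0, invDefect_add_left, invDefect_smul_left, invDefect_add_right,
    invDefect_add_right, invDefect_smul_right, invDefect_smul_right]
  have hwk := isHomogeneous_wk4 hα0 hα1
  have hc0 : IsHomogeneous (c0 α) 0 := (c0bar_hasWeight α).1
  by_cases hne : wt a + wt b + wt d + 0 ≠ 0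
  · rw [isGramTable_gram.invDefect_eq_zero hwk hne, isGramTable_gram.invDefect_eq_zero hc0 hne,
      isGramTable_gramDeriv.invDefect_eq_zero hwk hne,
      isGramTable_gramDeriv.invDefect_eq_zero hc0 hne]
    simp
  · rw [not_not, add_zero] at hne
    have hd : idx d ∈ cand (Nat.sub 138 (Nat.add (wtCode (idx a)) (wtCode (idx b)))) := by
      have e1 := wtCode_eq a
      have e2 := wtCode_eq b
      have e3 := wtCode_eq d
      have e4 := congrArg wtForm hne
      rw [wtForm_add, wtForm_add] at e4
      have e5 : wtForm 0 = 0 := by simp [wtForm]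
      have : Nat.sub 138 (Nat.add (wtCode (idx a)) (wtCode (idx b))) = wtCode (idx d) := by
        change 138 - (wtCode (idx a) + wtCode (idx b)) = _
        omega
      rw [this]
      exact mem_cand _ (idx_lt d)
    have h := List.all_eq_true.mp (allBelow_apply (allBelow_apply gramTable_c0_check (idx_lt a))
      (idx_lt b)) _ hd
    simp only [Bool.and_eq_true] at h
    obtain ⟨⟨r0, r1⟩, h0, h1, h2⟩ := h
    have k0 := (isGramTable_gram (α := α)).lin_invList (isAlternating_wk4 (α := α)) (idx_lt a) (idx_lt b)
      (idx_lt d)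
    have k1 := (isGramTable_gramDeriv (α := α)).lin_invList (isAlternating_wk4 (α := α)) (idx_lt a) (idx_lt b)
      (idx_lt d)
    have k2 := (isGramTable_gram (α := α)).lin_invList (isAlternating_c0 α) (idx_lt a)
      (idx_lt b) (idx_lt d)
    have k3 := (isGramTable_gramDeriv (α := α)).lin_invList (isAlternating_c0 α) (idx_lt a)
      (idx_lt b) (idx_lt d)
    have m0 := linForm_table (α := α) (c := (wk4 α, 0)) (isTable_wk4 hα0 hα1) inRange_wkTable r0
    have m1 := linForm_table (α := α) (c := (wk4 α, 0)) (isTable_wk4 hα0 hα1) inRange_wkTable r1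
    have m2 := linForm_table (α := α) (c := (c0 α, 0)) (isTable_c0 α) isGradedTable_c0Table.range r0
    have m3 := linForm_table (α := α) (c := (c0 α, 0)) (isTable_c0 α) isGradedTable_c0Table.range r1
    have n1 := congrArg (ev α) (Nat.eq_of_beq_eq_true h1)
    rw [ev_xor, ev_zero] at n1
    rw [gen_idx, gen_idx, gen_idx] at k0 k1 k2 k3
    rw [← k0, ← k1, ← k2, ← k3]
    change lin _ _ _ = _ at m0 m1 m2 m3
    rw [m0, m1, m2, m3, Nat.eq_of_beq_eq_true h0, Nat.eq_of_beq_eq_true h2, ev_zero]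
    -- The constant and the quadratic coefficients vanish separately; in the linear one the
    -- contributions of the bracket and of `c0` cancel each other.
    linear_combination t * n1

end Gram

/-! ### Uniqueness of the invariant form up to a factor. -/

section Uniqueness

variable {K : Type*} [Field K]

/-- The value of the code `p + 2 ^ 16 q` is `p + t q`. -/
def evPair (α t : K) (n : ℕ) : K := ev α (n % 65536) + t * ev α (n / 65536)

/-- The entries of a Gram matrix, by their numbers. -/
def formCoord (D : LinearMap.BilinForm K (Vec K)) (n : ℕ) : K :=
  D (e (gen (n / 34))) (e (gen (n % 34)))

lemma formCoord_fid {D : LinearMap.BilinForm K (Vec K)} (h : ∀ u v, D u v = D v u) {a b : ℕ}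
    (ha : a < 34) (hb : b < 34) : formCoord D (fid a b) = D (e (gen a)) (e (gen b)) := by
  have h1 : ∀ a b, b < 34 → formCoord D (34 * a + b) = D (e (gen a)) (e (gen b)) := by
    intro a b hb
    have h1 : (34 * a + b) / 34 = a := by omega
    have h2 : (34 * a + b) % 34 = b := by omega
    rw [formCoord, h1, h2]
  rw [fid]
  cases Nat.ble a b
  · exact (h1 b a ha).trans (h _ _)
  · exact h1 a b hb

variable (α t : K)

lemma evPair_of_lt {n : ℕ} (h : n < 65536) : evPair α t n = ev α n := by
  rw [evPair, Nat.mod_eq_of_lt h, Nat.div_eq_of_lt h, ev_zero, mul_zero, add_zero]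

lemma evPair_mul (n : ℕ) : evPair α t (Nat.mul 65536 n) = t * ev α n := by
  change evPair α t (65536 * n) = _
  rw [evPair, Nat.mul_mod_right, Nat.mul_div_cancel_left n (by norm_num), ev_zero, zero_add]

variable [CharP K 2]

/-- Exclusive or works digit by digit, so it respects the splitting of a code at `2 ^ 16`. -/
lemma evPair_xor (m n : ℕ) : evPair α t (Nat.xor m n) = evPair α t m + evPair α t n := by
  have h1 : Nat.xor m n % 2 ^ 16 = Nat.xor (m % 2 ^ 16) (n % 2 ^ 16) := Nat.xor_mod_two_pow
  have h2 : Nat.xor m n / 2 ^ 16 = Nat.xor (m / 2 ^ 16) (n / 2 ^ 16) := Nat.xor_div_two_pow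
  norm_num at h1 h2
  have e1 := ev_xor α (m % 65536) (n % 65536)
  have e2 := ev_xor α (m / 65536) (n / 65536)
  change ev α (_ ^^^ _) = _ at e1 e2
  change ev α ((m ^^^ n) % 65536) + t * ev α ((m ^^^ n) / 65536) = _
  rw [h1, h2, e1, e2, evPair, evPair]
  ring

variable {α}

lemma isUnit_lt {n : ℕ} (h : isUnit n = true) : n < 65536 := by
  simp only [isUnit, Bool.or_eq_true, beq_iff_eq] at h
  omega

variable (hα0 : α ≠ 0) (hα1 : α ≠ 1)
include hα0 hα1

lemma linear_deform (f : Vec K →ₗ[K] K) {a b : ℕ} (ha : a < 34) (hb : b < 34) :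
    f ((wk4 α + t • c0 α) (e (gen a)) (e (gen b))) =
      lin (evPair α t) (fun n => f (e (gen n))) (deformTable a b) := by
  rw [LinearMap.add_apply, LinearMap.add_apply, LinearMap.smul_apply, LinearMap.smul_apply, map_add,
    map_smul, isTable_wk4 hα0 hα1 a ha b hb, isTable_c0 α a ha b hb, linear_den, linear_den,
    deformTable, lin_append]
  congr 1
  · unfold lin
    congr 1
    refine List.map_congr_left fun s hs => ?_
    have := List.all_eq_true.mp (allBelow_apply (allBelow_apply wkTable_code_check ha) hb) s hs
    rw [evPair_of_lt α t (Nat.blt_eq.mp this)]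
  · generalize c0Table a b = l
    induction l with
    | nil => simp
    | cons s l ih =>
      rw [lin_cons, smul_add, ih, List.map_cons, lin_cons, evPair_mul, smul_eq_mul, mul_assoc]

/-- An invariant symmetric form is determined by its entry at `(x_3, y_3)`. -/
lemma eq_zero_of_invariant {D : LinearMap.BilinForm K (Vec K)} (hs : ∀ u v, D u v = D v u)
    (hD : ∀ u v w, D ((wk4 α + t • c0 α) u w) v = D u ((wk4 α + t • c0 α) w v))
    (h3 : D (e (X 3)) (e (Y 3)) = 0) : D = 0 := by
  have hm : ∀ m : ℕ, Nat.mod m 34 < 34 := fun m => Nat.mod_lt m (by omega)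
  have heq : ∀ n, lin (evPair α t) (formCoord D) (invEqn n) = 0 := by
    intro n
    rw [invEqn]
    generalize hu : Nat.mod (Nat.div n 1156) 34 = u
    generalize hw : Nat.mod (Nat.div n 34) 34 = w
    generalize hv : Nat.mod n 34 = v
    have hu' : u < 34 := hu ▸ hm _
    have hw' : w < 34 := hw ▸ hm _
    have hv' : v < 34 := hv ▸ hm _
    have hr : ∀ a < 34, ∀ b < 34, ∀ s ∈ deformTable a b, s.1 < 34 := by
      intro a ha b hb s h
      rcases List.mem_append.mp h with h | h
      · exact inRange_wkTable a ha b hb s h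
      · obtain ⟨r, hr, rfl⟩ := List.mem_map.mp h
        exact isGradedTable_c0Table.range a ha b hb r hr
    have h1 := linear_deform t hα0 hα1 (D.flip (e (gen v))) hu' hw'
    have h2 := linear_deform t hα0 hα1 (D (e (gen u))) hw' hv'
    change lin (evPair α t) (formCoord D) (((deformTable u w).map fun s => (fid s.1 v, s.2)) ++
      (deformTable w v).map fun s => (fid u s.1, s.2)) = 0
    rw [lin_append, lin_map (f := fun n => fid n v), lin_map (f := fun n => fid u n),
      lin_congr (φ' := fun n => D (e (gen n)) (e (gen v))) _ _
        fun s h => formCoord_fid hs (hr u hu' w hw' s h) hv',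
      lin_congr (φ' := fun n => D (e (gen u)) (e (gen n))) _ _
        fun s h => formCoord_fid hs hu' (hr w hw' v hv' s h)]
    refine CharTwo.add_eq_zero.mpr ?_
    exact h1.symm.trans ((hD _ _ _).trans h2)
  obtain ⟨known, hk, hfin⟩ := propagate_sound (v := evPair α t) (φ := formCoord D) (evPair_xor α t)
    (by simp [evPair]) (fun n hn => by
      rw [evPair_of_lt α t (isUnit_lt hn)]; exact ev_ne_zero hα0 hα1 hn) (z := fun _ => false)
    (eqn := invEqn) (by simp) heq invSteps (bitSet [89]) (fun u hu => by
      rw [List.mem_singleton.mp (mem_of_bit_bitSet hu)]; exact h3) invSteps_check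
  refine bilinForm_ext fun a b => ?_
  have := hk _ (allBelow_apply (allBelow_apply hfin (idx_lt a)) (idx_lt b))
  rw [formCoord_fid hs (idx_lt a) (idx_lt b), gen_idx, gen_idx] at this
  exact this

end Uniqueness


/-! ### Nondegeneracy and the classification of the forms. -/

section Nondegenerate

variable {K : Type*} [Field K] {α : K}

lemma toBilin'_e_right (Γ : Matrix Gen Gen K) (u : Vec K) (g : Gen) :
    Matrix.toBilin' Γ u (e g) = ∑ k, u k * Γ k g := by
  conv_lhs => rw [vec_eq_sum u]
  rw [map_sum, LinearMap.sum_apply]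
  refine Finset.sum_congr rfl fun k _ => ?_
  rw [map_smul, LinearMap.smul_apply, Matrix.toBilin'_single, smul_eq_mul]

lemma gramC0_eq_zero {t : K} {a b : Gen} (h : gram α a b = 0) : gramC0 α t a b = 0 := by
  rw [gramC0, h, mul_zero, ite_self]

lemma gramC0_ne_zero {t : K} (ht : 1 + (1 + α) * t ≠ 0) {a b : Gen} (h : gram α a b ≠ 0) :
    gramC0 α t a b ≠ 0 := by
  unfold gramC0
  split_ifs
  · exact h
  · exact mul_ne_zero ht h

lemma gramC0_X3_Y3 (t : K) : gramC0 α t (X 3) (Y 3) = 1 := by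
  rw [gramC0, if_pos (by decide)]
  change (if (2 : Fin 15) = 2 then nu α 2 else 0) = 1
  rw [if_pos rfl]
  rfl

lemma gramC0_X1 (t : K) (g : Gen) : gramC0 α t (X 1) g = (1 + (1 + α) * t) * gram α (X 1) g := by
  rw [gramC0, if_neg]
  revert g
  decide

lemma gramC0_zero : gramC0 α 0 = gram α := by rw [gramC0_eq, zero_smul, add_zero]

variable [CharP K 2]

/-- The Cartan block is not a permutation pattern, so its four equations are solved directly. The
only quantities to be inverted are `α` and `1 + (1 + α) t`. -/
lemma apply_cartan_eq_zero (hα0 : α ≠ 0) {t : K} (ht : 1 + (1 + α) * t ≠ 0) {u : Vec K}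
    (h : ∀ v, Matrix.toBilin' (gramC0 α t) u v = 0) (j : Fin 4) : u (.h j) = 0 := by
  have hrow : ∀ d < 34, lin (ev α) (fun n => u (gen n)) (gramTable d) +
      t * lin (ev α) (fun n => u (gen n)) (gramDerivTable d) = 0 := fun d hd => by
    rw [← toBilin'_gramC0_apply t u hd, h]
  have e6 : ev α 6 = α * (1 + α) := by rw [show 6 = 2 * 3 from rfl, ev_two_mul, ev_three]
  have h15 := hrow 15 (by omega)
  have h16 := hrow 16 (by omega)
  have h17 := hrow 17 (by omega)
  have h18 := hrow 18 (by omega)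
  rw [show gramTable 15 = [(16, 2), (17, 1)] by decide +kernel,
    show gramDerivTable 15 = [(16, 6)] by decide +kernel] at h15
  rw [show gramTable 16 = [(15, 2)] by decide +kernel,
    show gramDerivTable 16 = [(15, 6)] by decide +kernel] at h16
  rw [show gramTable 17 = [(15, 1), (18, 1)] by decide +kernel,
    show gramDerivTable 17 = [] by decide +kernel] at h17
  rw [show gramTable 18 = [(17, 1)] by decide +kernel,
    show gramDerivTable 18 = [] by decide +kernel] at h18
  simp only [lin_cons, lin_nil, ev_one, ev_two, e6, add_zero, mul_zero, one_mul] at h15 h16 h17 h18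
  have k0 : u (gen 15) = 0 := by
    refine (mul_eq_zero.mp (?_ : (α * (1 + (1 + α) * t)) * u (gen 15) = 0)).resolve_left
      (mul_ne_zero hα0 ht)
    linear_combination h16
  rw [k0, zero_add] at h17
  rw [h18, add_zero] at h15
  have k1 : u (gen 16) = 0 := by
    refine (mul_eq_zero.mp (?_ : (α * (1 + (1 + α) * t)) * u (gen 16) = 0)).resolve_left
      (mul_ne_zero hα0 ht)
    linear_combination h15
  fin_cases j
  · exact k0
  · exact k1
  · exact h18
  · exact h17

variable (hα0 : α ≠ 0) (hα1 : α ≠ 1)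
include hα0 hα1

/-- Each root vector is paired with its opposite alone, so its coordinate can be read off from one
equation; the Cartan part is the preceding lemma. -/
lemma eq_zero_of_gramC0 {t : K} (ht : 1 + (1 + α) * t ≠ 0) {u : Vec K}
    (h : ∀ v, Matrix.toBilin' (gramC0 α t) u v = 0) : u = 0 := by
  funext g
  have hg : ∀ a b : Gen, gram α a b ≠ 0 → (∀ k, k ≠ a → gram α k b = 0) → u a = 0 := by
    intro a b hab hk
    have h1 := h (e b)
    rw [toBilin'_e_right, Finset.sum_eq_single a (fun k _ hka => by
      rw [gramC0_eq_zero (hk k hka), mul_zero]) (by simp)] at h1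
    exact (mul_eq_zero.mp h1).resolve_right (gramC0_ne_zero ht hab)
  rcases g with i | j | i
  · refine hg (.x i) (.y i) ?_ ?_
    · change (if i = i then nu α i else 0) ≠ 0
      rw [if_pos rfl]
      exact nu_ne_zero hα0 hα1 i
    · rintro (k | k | k) hk
      · exact if_neg fun h' => hk (congrArg _ h')
      · rfl
      · rfl
  · exact apply_cartan_eq_zero hα0 ht h j
  · refine hg (.y i) (.x i) ?_ ?_
    · change (if i = i then nu α i else 0) ≠ 0
      rw [if_pos rfl]
      exact nu_ne_zero hα0 hα1 i
    · rintro (k | k | k) hk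
      · rfl
      · rfl
      · exact if_neg fun h' => hk (congrArg _ h')

lemma isNIS_gramC0 {t : K} (ht : 1 + (1 + α) * t ≠ 0) {a : K} (ha : a ≠ 0) :
    IsNIS (wk4 α + t • c0 α) (a • Matrix.toBilin' (gramC0 α t)) := by
  have hsymm : ∀ u v, (a • Matrix.toBilin' (gramC0 α t)) u v =
      (a • Matrix.toBilin' (gramC0 α t)) v u := fun u v => by
    rw [LinearMap.smul_apply, LinearMap.smul_apply, LinearMap.smul_apply, LinearMap.smul_apply,
      toBilin'_gramC0_symm]
  have hleft : ∀ u, (∀ v, (a • Matrix.toBilin' (gramC0 α t)) u v = 0) → u = 0 := fun u hu =>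
    eq_zero_of_gramC0 hα0 hα1 ht fun v => (smul_eq_zero.mp (hu v)).resolve_left ha
  refine ⟨⟨hleft, fun u hu => hleft u fun v => (hsymm u v).trans (hu v)⟩, hsymm, fun u v w => ?_⟩
  rw [LinearMap.smul_apply, LinearMap.smul_apply, LinearMap.smul_apply, LinearMap.smul_apply,
    invariant_gramC0 hα0 hα1]

/-- The Gram matrices of the NISes on the deforms by `c0`. -/
lemma hasNISWithGram_deform_c0 (t : K) (Γ : Matrix Gen Gen K) :
    HasNISWithGram (wk4 α + t • c0 α) Γ ↔
      (1 + α) * t ≠ 1 ∧ ∃ a : K, a ≠ 0 ∧ Γ = a • gramC0 α t := by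
  have hs : (1 + α) * t ≠ 1 ↔ 1 + (1 + α) * t ≠ 0 := by
    rw [ne_eq, ne_eq, CharTwo.add_eq_zero, eq_comm]
  rw [hs]
  constructor
  · rintro ⟨B, hB, hΓ⟩
    set b := B (e (X 3)) (e (Y 3))
    -- The entry of the standard form at `(x_3, y_3)` is 1 for every `t`, so with the factor `b` the
    -- two forms agree there, and uniqueness applies to their difference, which is their sum.
    have hD : B + b • Matrix.toBilin' (gramC0 α t) = 0 := by
      refine eq_zero_of_invariant t hα0 hα1 (fun u v => ?_) (fun u v w => ?_) ?_
      · simp only [LinearMap.add_apply, LinearMap.smul_apply]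
        rw [hB.symm u v, toBilin'_gramC0_symm]
      · change B _ v + b * Matrix.toBilin' (gramC0 α t) _ v = B u _ + b * Matrix.toBilin' _ u _
        rw [hB.invariant, invariant_gramC0 hα0 hα1]
      · rw [LinearMap.add_apply, LinearMap.add_apply, LinearMap.smul_apply, LinearMap.smul_apply,
          Matrix.toBilin'_single, gramC0_X3_Y3, smul_eq_mul, mul_one]
        exact CharTwo.add_self_eq_zero b
    have hBe : ∀ u v, B u v = b * Matrix.toBilin' (gramC0 α t) u v := fun u v =>
      CharTwo.add_eq_zero.mp (LinearMap.congr_fun₂ hD u v)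
    have hnz : ∀ g, ∃ v, B (e g) v ≠ 0 := by
      intro g
      by_contra hcon
      push Not at hcon
      have h1 := congrFun (hB.nondegenerate.1 _ hcon) g
      simp at h1
    have hb : b ≠ 0 := by
      intro hb
      obtain ⟨v, hv⟩ := hnz (X 3)
      rw [hBe, hb, zero_mul] at hv
      exact hv rfl
    refine ⟨fun ht => ?_, b, hb, ?_⟩
    -- If `(1 + α) t = 1`, the whole row of `x_1` carries the factor `1 + (1 + α) t = 0`, contrary
    -- to nondegeneracy.
    · obtain ⟨v, hv⟩ := hnz (X 1)
      refine hv ?_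
      rw [vec_eq_sum v, map_sum]
      refine Finset.sum_eq_zero fun g _ => ?_
      rw [map_smul, hBe, Matrix.toBilin'_single, gramC0_X1, ht, zero_mul, mul_zero, smul_zero]
    · funext i j
      rw [← hΓ, hBe, Matrix.toBilin'_single]
      rfl
  · rintro ⟨ht, a, ha, rfl⟩
    refine ⟨_, isNIS_gramC0 hα0 hα1 ht ha, fun i j => ?_⟩
    rw [LinearMap.smul_apply, LinearMap.smul_apply, Matrix.toBilin'_single]
    rfl

lemma hasNISWithGram_wk4 (Γ : Matrix Gen Gen K) :
    HasNISWithGram (wk4 α) Γ ↔ ∃ a : K, a ≠ 0 ∧ Γ = a • gram α := by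
  have h := hasNISWithGram_deform_c0 hα0 hα1 0 Γ
  rw [zero_smul, add_zero, gramC0_zero, mul_zero] at h
  rw [h]
  exact and_iff_right zero_ne_one

lemma isNIS_gram {a : K} (ha : a ≠ 0) : IsNIS (wk4 α) (a • Matrix.toBilin' (gram α)) := by
  have h := isNIS_gramC0 hα0 hα1 (t := 0) (by simp) ha
  rwa [zero_smul, add_zero, gramC0_zero] at h

/-- The form is invariant with respect to homogeneous cocycles of nonzero weight. -/
lemma invDefect_eq_zero_of_weight {c b : (bgl4 α).PreCochain} (hc : c ∈ (bgl4 α).Z2) {g : ℕ}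
    (hg : g ∈ specialIdx) (hw : HasWeight c (-(wt (gen g) + wt (gen g)))) {r : K}
    (hb : b ∈ (bgl4 α).B2) (hcb : c = r • rootCocycle α g + b) (x y z : Gen) :
    invDefect (Matrix.toBilin' (gram α)) c.1 x y z = 0 := by
  have halt := isAlternating_of_mem_Z2 hc
  have hG := isGramTable_gram (α := α)
  -- The defect is symmetric in its outer arguments, which is why the finite test covers only one
  -- order of them.
  wlog hzx : idx z ≤ idx x generalizing x z
  · rw [hG.invDefect_comm halt]
    exact this z x (not_le.mp hzx).le
  by_cases hne : wt x + wt y + wt z + -(wt (gen g) + wt (gen g)) ≠ 0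
  · exact hG.invDefect_eq_zero hw.1 hne
  rw [not_not, add_neg_eq_zero] at hne
  have hg34 := specialIdx_lt g hg
  have hz : idx z ∈ cand (Nat.sub (Nat.add 46 (Nat.mul 2 (wtCode g)))
      (Nat.add (wtCode (idx x)) (wtCode (idx y)))) := by
    have e1 := wtCode_eq x
    have e2 := wtCode_eq y
    have e3 := wtCode_eq z
    have e4 := wtCode_eq (gen g)
    have e5 := congrArg wtForm hne
    rw [wtForm_add, wtForm_add, wtForm_add] at e5
    rw [idx_gen hg34] at e4
    have : Nat.sub (Nat.add 46 (Nat.mul 2 (wtCode g)))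
        (Nat.add (wtCode (idx x)) (wtCode (idx y))) = wtCode (idx z) := by
      change 46 + 2 * wtCode g - (wtCode (idx x) + wtCode (idx y)) = _
      omega
    rw [this]
    exact mem_cand _ (idx_lt z)
  have hwide : Nat.beq (Nat.add (Nat.add (wideCode (idx x)) (wideCode (idx y))) (wideCode (idx z)))
      (Nat.add 530 (Nat.mul 2 (wideCode g))) = true := by
    have e1 := wideCode_eq x
    have e2 := wideCode_eq y
    have e3 := wideCode_eq z
    have e4 := wideCode_eq (gen g)
    have e5 := congrArg wideForm hne
    rw [wideForm_add, wideForm_add, wideForm_add] at e5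
    rw [idx_gen hg34] at e4
    rw [Nat.beq_eq]
    change wideCode (idx x) + wideCode (idx y) + wideCode (idx z) = 530 + 2 * wideCode g
    omega
  have hlt : Nat.blt (idx x) (idx z) = false := by
    rw [Bool.eq_false_iff, ne_eq, Nat.blt_eq]
    omega
  have h := List.all_eq_true.mp (allBelow_apply (allBelow_apply
    (List.all_eq_true.mp gramTable_root_check g hg) (idx_lt x)) (idx_lt y)) _ hz
  rw [hlt, hwide, Bool.not_true, Bool.or_false, Bool.false_or, Bool.and_eq_true,
    Bool.and_eq_true] at h
  have h1 := hG.lin_invList halt (idx_lt x) (idx_lt y) (idx_lt z)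
  rw [gen_idx, gen_idx, gen_idx] at h1
  rw [← h1]
  exact linForm_eq_zero_of_decomp hα0 hα1 hg hb hcb h.1 h.2.1 (Nat.eq_of_beq_eq_true h.2.2)

lemma hasNISWithGram_deform_of_weight {c b : (bgl4 α).PreCochain} (hc : c ∈ (bgl4 α).Z2) {g : ℕ}
    (hg : g ∈ specialIdx) (hw : HasWeight c (-(wt (gen g) + wt (gen g)))) {r : K}
    (hb : b ∈ (bgl4 α).B2) (hcb : c = r • rootCocycle α g + b) (t : K) {Γ : Matrix Gen Gen K}
    (hΓ : HasNISWithGram (wk4 α) Γ) : HasNISWithGram (wk4 α + t • c.1) Γ := by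
  obtain ⟨a, ha, rfl⟩ := (hasNISWithGram_wk4 hα0 hα1 Γ).mp hΓ
  have hB := isNIS_gram hα0 hα1 ha
  refine ⟨_, ⟨hB.nondegenerate, hB.symm, fun u v w => ?_⟩, fun i j => ?_⟩
  · have h2 := invariant_of_invDefect (invDefect_eq_zero_of_weight hα0 hα1 hc hg hw hb hcb) u w v
    have h3 := hB.invariant u v w
    simp only [LinearMap.add_apply, LinearMap.smul_apply, map_add, map_smul] at h3 ⊢
    rw [h3, h2]
  · rw [LinearMap.smul_apply, LinearMap.smul_apply, Matrix.toBilin'_single]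
    rfl

end Nondegenerate

/-! ### Matching the two numberings of the special roots. -/

section BasisCocycles

lemma specialRoot_mem (n : Fin 9) : specialRoot n - 1 ∈ specialIdx ∧
    specialRoot n + 18 ∈ specialIdx := by
  revert n; decide

lemma gen_specialRoot (n : Fin 9) : gen (specialRoot n - 1) = X (specialRoot n) ∧
    gen (specialRoot n + 18) = Y (specialRoot n) := by
  revert n; decide

lemma wt_specialRoot (n : Fin 9) : -wt (X (specialRoot n)) = wt (Y (specialRoot n)) := by
  revert n; decide +kernel

lemma absIdx_specialRoot (n : Fin 9) : absIdx (specialRoot n - 1) = specialRoot n - 1 ∧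
    absIdx (specialRoot n + 18) = specialRoot n - 1 := by
  revert n; decide

end BasisCocycles

end

end Bgl

/-! ### The main theorem. -/

theorem lemma4p3 {K : Type*} [Field K] [CharP K 2] (α : K) (hα0 : α ≠ 0) (hα1 : α ≠ 1) :
    -- `wk(4;α)` is the Lie algebra with the given Cartan matrix, in its Chevalley basis
    (IsLieBracket (wk4 α) ∧
      IsCartanAlgebra (cartan α) (wk4 α)
        (fun i => e (X (i + 1))) (fun i => e (.h i)) (fun i => e (Y (i + 1))) ∧
      ChevalleyRelations (wk4 α) (fun n => e (X n)) ∧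
      ChevalleyRelations (wk4 α) (fun n => e (Y n))) ∧
    -- `bgl(4;α)` is a Lie superalgebra, its desuperization is `wk(4;α)`
    ((bgl4 α).IsLieSuperalgebra ∧ (bgl4 α).desuperization = wk4 α) ∧
    -- the NIS on `bgl(4;α)`, unique up to a nonzero factor
    (∀ Γ, HasNISWithGram (bgl4 α).bracket Γ ↔ ∃ a : K, a ≠ 0 ∧ Γ = a • gram α) ∧
    -- a basis of `H²`: cocycles `c n` of negative degree, `c' n` of positive degree, and `c_0`
    (∃ c c' : Fin 9 → (bgl4 α).PreCochain,
      (∀ n, HasWeight (c n) (wt (Y (specialRoot n)) + wt (Y (specialRoot n))) ∧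
        IsEvenCochain (c n) ∧
        ∀ x : (bgl4 α).oddPart, (x : Vec K) = e (X (specialRoot n)) →
          (c n).2 x = squareTerm α n) ∧
      (∀ n, HasWeight (c' n) (wt (X (specialRoot n)) + wt (X (specialRoot n))) ∧
        IsEvenCochain (c' n) ∧
        ∀ x : (bgl4 α).oddPart, (x : Vec K) = e (Y (specialRoot n)) →
          (c' n).2 x = squareTerm α n) ∧
      (HasWeight (c0bar α) 0 ∧ IsEvenCochain (c0bar α)) ∧
      (bgl4 α).IsCohomologyBasis (Sum.elim (Sum.elim c c') fun _ : Unit => c0bar α)) ∧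
    -- deforms by cocycles of nonzero weight, whatever cocycle represents the class
    (∀ (w : Fin 4 → ℤ), w ≠ 0 → ∀ c ∈ (bgl4 α).Z2, HasWeight c w → c ∉ (bgl4 α).B2 → ∀ t : K,
      ((bgl4 α).deform c t).IsLieSuperalgebra ∧
      ∀ Γ, HasNISWithGram (bgl4 α).bracket Γ → HasNISWithGram ((bgl4 α).deform c t).bracket Γ) ∧
    -- deforms by `c_0`
    (∀ t : K,
      ((bgl4 α).deform (c0bar α) t).IsLieSuperalgebra ∧
      IsLieBracket (wk4 α + t • c0 α) ∧
      ((bgl4 α).deform (c0bar α) t).desuperization = wk4 α + t • c0 α ∧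
      -- the NISes on the deform of `bgl(4;α)`
      (∀ Γ, HasNISWithGram ((bgl4 α).deform (c0bar α) t).bracket Γ ↔
        (1 + α) * t ≠ 1 ∧ ∃ a : K, a ≠ 0 ∧ Γ = a • gramC0 α t) ∧
      -- they differ from the NISes on `bgl(4;α)`
      (t ≠ 0 → ∀ Γ, HasNISWithGram (bgl4 α).bracket Γ →
        ¬ HasNISWithGram ((bgl4 α).deform (c0bar α) t).bracket Γ) ∧
      -- they coincide with the NISes on the deform of `wk(4;α)`
      (∀ Γ, HasNISWithGram (wk4 α + t • c0 α) Γ ↔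
        (1 + α) * t ≠ 1 ∧ ∃ a : K, a ≠ 0 ∧ Γ = a • gramC0 α t)) := by
  have hL := isLieSuperalgebra_bgl4 hα0 hα1
  refine ⟨⟨isLieBracket_wk4 hα0 hα1, isCartanAlgebra_wk4 hα0 hα1, chevalleyRelations_x hα0 hα1,
    chevalleyRelations_y hα0 hα1⟩, ⟨hL, rfl⟩, hasNISWithGram_wk4 hα0 hα1,
    ⟨fun n => rootCocycle α (specialRoot n - 1), fun n => rootCocycle α (specialRoot n + 18),
      fun n => ?_, fun n => ?_, ⟨c0bar_hasWeight α, c0bar_isEvenCochain α⟩, ?_⟩, ?_, fun t => ?_⟩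
  · have hg := (specialRoot_mem n).1
    refine ⟨?_, isEvenCochain_rootCocycle α hg, fun x hx => ?_⟩
    · have h := hasWeight_rootCocycle α hg
      rwa [(gen_specialRoot n).1, neg_add, wt_specialRoot] at h
    · rw [rootCocycle_sq α hg (specialIdx_lt _ hg) (by rw [hx, (gen_specialRoot n).1]),
        (absIdx_specialRoot n).1, squareTerm_eq]
  · have hg := (specialRoot_mem n).2
    refine ⟨?_, isEvenCochain_rootCocycle α hg, fun x hx => ?_⟩
    · have h := hasWeight_rootCocycle α hg
      rwa [(gen_specialRoot n).2, neg_add, ← wt_specialRoot, neg_neg] at h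
    · rw [rootCocycle_sq α hg (specialIdx_lt _ hg) (by rw [hx, (gen_specialRoot n).2]),
        (absIdx_specialRoot n).2, squareTerm_eq]
  · convert isCohomologyBasis_classCocycle hα0 hα1 using 1
    have hne : ∀ n, Nat.beq (specialRoot n - 1) 34 = false ∧
        Nat.beq (specialRoot n + 18) 34 = false := by decide
    funext i
    rcases i with (n | n) | _
    · simp only [Sum.elim_inl, classNum, classCocycle, (hne n).1, cond_false]
    · simp only [Sum.elim_inl, Sum.elim_inr, classNum, classCocycle, (hne n).2, cond_false]
    · rfl
  · intro w hw0 c hc hw hcB t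
    obtain ⟨g, hg, rfl, r, b, hb, hcb⟩ := exists_rootCocycle hα0 hα1 hc hw hw0 hcB
    exact ⟨isLieSuperalgebra_deform_of_weight hα0 hα1 hc hg hw hb hcb t,
      fun Γ hΓ => hasNISWithGram_deform_of_weight hα0 hα1 hc hg hw hb hcb t hΓ⟩
  · refine ⟨isLieSuperalgebra_deform_c0bar hα0 hα1 t, isLieBracket_deform_c0 hα0 hα1 t, rfl,
      hasNISWithGram_deform_c0 hα0 hα1 t, fun ht Γ hΓ hΓt => ?_,
      hasNISWithGram_deform_c0 hα0 hα1 t⟩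
    obtain ⟨a, ha, h1⟩ := (hasNISWithGram_wk4 hα0 hα1 Γ).mp hΓ
    obtain ⟨-, b, -, h2⟩ := (hasNISWithGram_deform_c0 hα0 hα1 t Γ).mp hΓt
    rw [h1, ← gramC0_zero] at h2
    -- The entry at `(x_3, y_3)` is not rescaled, so the two factors agree. The entry at `(x_1,
    -- y_1)` is rescaled by `1 + (1 + α) t`, which then has to be 1, and this is impossible for `t ≠
    -- 0`.
    have h3 := congrFun (congrFun h2 (X 3)) (Y 3)
    have h4 := congrFun (congrFun h2 (X 1)) (Y 1)
    rw [Matrix.smul_apply, Matrix.smul_apply, gramC0_X3_Y3, gramC0_X3_Y3, smul_eq_mul,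
      smul_eq_mul, mul_one, mul_one] at h3
    have hX1 : gram α (X 1) (Y 1) = 1 := by
      change (if (0 : Fin 15) = 0 then nu α 0 else 0) = 1
      rw [if_pos rfl]
      rfl
    rw [Matrix.smul_apply, Matrix.smul_apply, gramC0_X1, gramC0_X1, hX1, ← h3, smul_eq_mul,
      smul_eq_mul, mul_zero, add_zero, mul_one, mul_one] at h4
    have h5 : a * ((1 + α) * t) = 0 := by linear_combination -h4
    exact mul_ne_zero ha (mul_ne_zero (one_add_ne_zero hα1) ht) h5
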